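/- Let $n$ be a natural number, $1\le p\le 2$ and $s\ge 0$; write $\langle\xi\rangle=(1+|\xi|^2)^{1/2}$. Let $\mathcal FL^1_s(\mathbf R^n)$ be the space of all tempered distributions $f$ on $\mathbf R^n$ whose Fourier transform $\widehat f$ (normalized by $\widehat f(\xi)=\int f(x)e^{-ix\xi}\,dx$) is a function with $$\|f\|_{\mathcal FL^1_s}=\int_{\mathbf R^n}\langle\xi\rangle^s|\widehat f(\xi)|\,d\xi<\infty .$$ Fix a Schwartz function $\phi\neq 0$, let $V_\phi f(x,\xi)=\langle f,\,e^{i\xi\cdot}\phi(\cdot-x)\rangle=\int f(t)\overline{\phi(t-x)}e^{-it\xi}\,dt$ be the short-time Fourier transform of a tempered distribution $f$, and let $M^{p,1}_s(\mathbf R^n)$ be the space of all tempered distributions $f$ with $$\|f\|_{M^{p,1}_s}=\int_{\mathbf R^n}\langle\xi\rangle^s\Big(\int_{\mathbf R^n}|V_\phi f(x,\xi)|^p\,dx\Big)^{1/p}d\xi<\infty .$$ The elements of both spaces are continuous functions, and both spaces are algebras under pointwise multiplication. A closed ideal of one of these algebras $X$ is a linear subspace $I\subset X$ that is closed in the norm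 of $X$ and satisfies $fg\in I$ for all $f\in X$, $g\in I$. Let $\mathcal I_F$ and $\mathcal I_M$ be the sets of all closed ideals of $\mathcal FL^1_s(\mathbf R^n)$ and of $M^{p,1}_s(\mathbf R^n)$, respectively. Then $\iota(I)=I\cap M^{p,1}_s(\mathbf R^n)$ defines a bijection $\iota:\mathcal I_F\to\mathcal I_M$. For every $I_M\in\mathcal I_M$, the closure $\overline{I_M}$ of $I_M$ in $\mathcal FL^1_s(\mathbf R^n)$ belongs to $\mathcal I_F$, and $$\iota^{-1}(I_M)=\overline{I_M},\qquad \iota(\overline{I_M})=\overline{I_M}\cap M^{p,1}_s(\mathbf R^n)=I_M .$$ -/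

import Mathlib

open MeasureTheory SchwartzMap
open scoped ENNReal FourierTransform

namespace SegalIdeal

noncomputable section

/-- The space `ℝⁿ` with its Euclidean structure. -/
abbrev Rn (n : ℕ) : Type := EuclideanSpace ℝ (Fin n)

/-- The weight `⟨ξ⟩ ^ s = (1 + |ξ|²) ^ (s / 2)`, as an extended nonnegative number. -/
def weight {n : ℕ} (s : ℝ) (ξ : Rn n) : ℝ≥0∞ :=
  ENNReal.ofReal ((1 + ‖ξ‖ ^ 2) ^ (s / 2))

/-- The tempered distribution `u` is given by the function `g`, i.e. `u(φ) = ∫ φ g` with an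
absolutely convergent integral for all Schwartz functions `φ` (this forces `g` to be a.e. strongly
measurable and locally integrable, and determines `g` almost everywhere). -/
def IsGivenBy {n : ℕ} (u : 𝓢'(Rn n, ℂ)) (g : Rn n → ℂ) : Prop :=
  ∀ φ : 𝓢(Rn n, ℂ), Integrable (fun x => φ x * g x) ∧ u φ = ∫ x, φ x * g x

/-! ### The Fourier transform `∫ f(x) exp(-i x ξ) dx` and the Fourier-Beurling algebra -/

/-- The linear bijection `ξ ↦ (2π)⁻¹ ξ` of `ℝⁿ`. -/
def scaleEquiv (n : ℕ) : Rn n ≃L[ℝ] Rn n :=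
  ContinuousLinearEquiv.smulLeft (Units.mk0 ((2 * Real.pi)⁻¹ : ℝ) (by positivity))

/-- The Fourier transform `φ ↦ (ξ ↦ ∫ φ(x) exp(-i ⟨x, ξ⟩) dx)` on Schwartz functions. -/
def fourierS (n : ℕ) : 𝓢(Rn n, ℂ) →L[ℂ] 𝓢(Rn n, ℂ) :=
  (compCLMOfContinuousLinearEquiv ℂ (scaleEquiv n)) ∘L
    FourierTransform.fourierCLM ℂ 𝓢(Rn n, ℂ)

theorem fourierS_apply {n : ℕ} (φ : 𝓢(Rn n, ℂ)) (ξ : Rn n) :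
    fourierS n φ ξ = ∫ x, Complex.exp (-(Complex.I * (inner ℝ x ξ : ℝ))) * φ x := by
  have h1 : fourierS n φ ξ = 𝓕 (φ : Rn n → ℂ) ((2 * Real.pi)⁻¹ • ξ) := rfl
  rw [h1, Real.fourier_eq']
  congr 1
  ext x
  rw [inner_smul_right, smul_eq_mul]
  congr 2
  have : (Real.pi : ℂ) ≠ 0 := by exact_mod_cast Real.pi_ne_zero
  push_cast
  field_simp

/-- The Fourier transform on tempered distributions, `û(φ) = u(φ̂)`. -/
def fourierD {n : ℕ} (u : 𝓢'(Rn n, ℂ)) : 𝓢'(Rn n, ℂ) :=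
  PointwiseConvergenceCLM.precomp ℂ (fourierS n) u

theorem fourierD_apply {n : ℕ} (u : 𝓢'(Rn n, ℂ)) (φ : 𝓢(Rn n, ℂ)) :
    fourierD u φ = u (fourierS n φ) :=
  rfl

/-- The norm `‖u‖ = ∫ ⟨ξ⟩ ^ s |û(ξ)| dξ` of `FL¹_s`; it is `∞` if `û` is not a function.
(The function `û` is unique almost everywhere, so the infimum has at most one value.) -/
def flNorm {n : ℕ} (s : ℝ) (u : 𝓢'(Rn n, ℂ)) : ℝ≥0∞ :=
  ⨅ (g : Rn n → ℂ) (_ : IsGivenBy (fourierD u) g), ∫⁻ ξ, weight s ξ * ‖g ξ‖ₑ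

/-! ### The short-time Fourier transform and the modulation spaces `M^{p,1}_s` -/

/-- The function `t ↦ exp(-i ⟨t, ξ⟩)`. -/
def character {n : ℕ} (ξ : Rn n) (t : Rn n) : ℂ :=
  Complex.exp (-(Complex.I * (inner ℝ t ξ : ℝ)))

theorem exp_mul_I_hasTemperateGrowth :
    (fun x : ℝ => Complex.exp (x * Complex.I)).HasTemperateGrowth := by
  have hd : ∀ x : ℝ, HasDerivAt (fun x : ℝ => Complex.exp (x * Complex.I))
      (Complex.exp (x * Complex.I) * Complex.I) x := by
    intro x
    have h := ((hasDerivAt_id (x : ℂ)).mul_const Complex.I).cexp.comp_ofReal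
    simpa using h
  have hi : ∀ k : ℕ, iteratedDeriv k (fun x : ℝ => Complex.exp (x * Complex.I)) =
      fun x : ℝ => Complex.exp (x * Complex.I) * Complex.I ^ k := by
    intro k
    induction k with
    | zero => ext x; simp
    | succ k ih =>
      rw [iteratedDeriv_succ, ih]
      ext x
      rw [((hd x).mul_const (Complex.I ^ k)).deriv, pow_succ]
      ring
  refine ⟨?_, fun k => ⟨0, 1, fun x => ?_⟩⟩
  · have h1 : ContDiff ℝ ((⊤ : ℕ∞) : WithTop ℕ∞) (fun x : ℝ => (x : ℂ)) := Complex.ofRealCLM.contDiff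
    exact (h1.mul contDiff_const).cexp
  · rw [norm_iteratedFDeriv_eq_norm_iteratedDeriv, hi k]
    simp [Complex.norm_exp_ofReal_mul_I]

theorem character_hasTemperateGrowth {n : ℕ} (ξ : Rn n) :
    (character ξ).HasTemperateGrowth := by
  have h := (Function.HasTemperateGrowth.comp (g := fun x : ℝ => Complex.exp (x * Complex.I))
    (f := fun t : Rn n => -(inner ℝ t ξ : ℝ)) exp_mul_I_hasTemperateGrowth (by fun_prop))
  convert h using 1
  ext t
  simp [character, mul_comm]

/-- The Schwartz function `t ↦ conj(φ(t - x)) exp(-i ⟨t, ξ⟩)`, the complex conjugate of the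
time-frequency shift `M_ξ T_x φ` of the window `φ`. -/
def shiftedWindow {n : ℕ} (φ : 𝓢(Rn n, ℂ)) (x ξ : Rn n) : 𝓢(Rn n, ℂ) :=
  smulLeftCLM ℂ (character ξ)
    (postcompCLM (𝕜 := ℝ) (Complex.conjCLE : ℂ →L[ℝ] ℂ) (compSubConstCLM ℝ x φ))

theorem shiftedWindow_apply {n : ℕ} (φ : 𝓢(Rn n, ℂ)) (x ξ t : Rn n) :
    shiftedWindow φ x ξ t =
      Complex.exp (-(Complex.I * (inner ℝ t ξ : ℝ))) * (starRingEnd ℂ) (φ (t - x)) := by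
  rw [shiftedWindow, smulLeftCLM_apply_apply (character_hasTemperateGrowth ξ)]
  simp [character]

/-- The short-time Fourier transform `V_φ u (x, ξ) = ⟨u, M_ξ T_x φ⟩`, where the pairing is
antilinear in the second argument. -/
def stft {n : ℕ} (φ : 𝓢(Rn n, ℂ)) (u : 𝓢'(Rn n, ℂ)) (x ξ : Rn n) : ℂ :=
  u (shiftedWindow φ x ξ)

/-- The norm `‖u‖ = ∫ ⟨ξ⟩ ^ s (∫ |V_φ u (x, ξ)| ^ p dx) ^ (1 / p) dξ` of `M^{p,1}_s` with respect
to the window `φ`. -/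
def modNorm {n : ℕ} (φ : 𝓢(Rn n, ℂ)) (p : ℝ≥0∞) (s : ℝ) (u : 𝓢'(Rn n, ℂ)) : ℝ≥0∞ :=
  ∫⁻ ξ, weight s ξ * eLpNorm (fun x => stft φ u x ξ) p volume

/-! ### Spaces, closures and closed ideals

A space of tempered distributions is described by its norm `N`, which takes the value `∞` exactly
outside the space. -/

/-- The space of all tempered distributions of finite norm. -/
def space {n : ℕ} (N : 𝓢'(Rn n, ℂ) → ℝ≥0∞) : Set 𝓢'(Rn n, ℂ) :=
  {u | N u < ∞}

/-- The closure of `S` in the space with norm `N`. -/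
def normClosure {n : ℕ} (N : 𝓢'(Rn n, ℂ) → ℝ≥0∞) (S : Set 𝓢'(Rn n, ℂ)) :
    Set 𝓢'(Rn n, ℂ) :=
  {u | u ∈ space N ∧ ∀ ε : ℝ≥0∞, 0 < ε → ∃ v ∈ S, N (u - v) < ε}

/-- `u`, `v` are continuous functions and `w` is their pointwise product. -/
def IsPointwiseProduct {n : ℕ} (u v w : 𝓢'(Rn n, ℂ)) : Prop :=
  ∃ f g : Rn n → ℂ, Continuous f ∧ Continuous g ∧
    IsGivenBy u f ∧ IsGivenBy v g ∧ IsGivenBy w (fun x => f x * g x)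

/-- `I` is a closed ideal, with respect to pointwise multiplication, of the space with norm `N`. -/
structure IsClosedIdeal {n : ℕ} (N : 𝓢'(Rn n, ℂ) → ℝ≥0∞) (I : Set 𝓢'(Rn n, ℂ)) : Prop where
  subset_space : I ⊆ space N
  zero_mem : 0 ∈ I
  add_mem : ∀ u ∈ I, ∀ v ∈ I, u + v ∈ I
  smul_mem : ∀ c : ℂ, ∀ u ∈ I, c • u ∈ I
  mul_mem : ∀ u ∈ space N, ∀ v ∈ I, ∃ w ∈ I, IsPointwiseProduct u v w
  closure_subset : normClosure N I ⊆ I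

end

end SegalIdeal

open SegalIdeal

open Filter Topology ComplexConjugate

/-! The space `M^{p,1}_s` is an abstract Segal algebra inside `FL¹_s`, and the theorem is the ideal
theorem for such pairs. Write `N` and `M` for the larger and the smaller space's norms. `SegalPair`
collects what is needed: `N ≤ C M`, `N(uv) ≤ C N(u) N(v)`, `M(uv) ≤ C N(u) M(v)`, and approximation
of each `u`, in its own norm, by products `eu` with `M(e) < ∞`. No uniform bound on `e` is required.
If `I` is a closed ideal of the larger algebra and `u ∈ I`, then `eu` lies in `I` and in the smaller
space and tends to `u`; so `I` is the closure of its trace (`normClosure_inter`). If `J` is a closed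
ideal of the smaller algebra and `u` in the smaller space is an `N`-limit of elements `k ∈ J`, then
`ek ∈ J` and `M(eu - ek) ≤ C N(u - k) M(e)` is small for fixed `e`, so `u ∈ J`
(`inter_normClosure`).

The products rest on convolution: with `c = (2π)⁻ⁿ`, multiplication by `u` acts as `c û *` on
Fourier transforms and, for each `x`, on `V_φ v(x, ·)` (`isGivenBy_fourierD_mul`, `stft_mul`).
Minkowski's inequality and `weight_add_le` then give both norm bounds. For `e` with `ê` a bump near
`0` of integral `(2π)ⁿ`, multiplication by `e` averages over small frequency translations; it is
close to the identity because translations are continuous in weighted `L¹`, with values in `ℂ` for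
`N` and in `Lᵖ` for `M`.

The analytic core is `N ≤ C M` (`exists_flNorm_le_modNorm`), the one place where `p ≤ 2` matters.
The distribution `û` is cut into pieces localized near `ξ`. Pairing the piece with a test function
costs `a(ξ) = ‖V_φ u(·, ξ)‖_p` times an `L^q` norm of a Fourier transform, `q ≥ 2` being the
conjugate exponent. For localized functions that norm is controlled by a local `L²` norm, through
`L²` and `L^∞` bounds. Cauchy-Schwarz in `ξ` makes `û` bounded on a weighted `L²` space, so the
Riesz theorem yields a density, and a second Cauchy-Schwarz bounds its weighted `L¹` norm by `∫
⟨ξ⟩^s a(ξ) dξ`. -/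

/-- Hahn-Banach: a linear form bounded by the norm of a linear map into a normed space factors
through a continuous linear form on that space. -/
theorem exists_clm_factor {V H : Type*} [AddCommGroup V] [Module ℂ V] [NormedAddCommGroup H]
    [NormedSpace ℂ H] (U : V →ₗ[ℂ] ℂ) (J : V →ₗ[ℂ] H) (C : ℝ) (hC : 0 ≤ C)
    (h : ∀ v, ‖U v‖ ≤ C * ‖J v‖) :
    ∃ L : H →L[ℂ] ℂ, ‖L‖ ≤ C ∧ ∀ v, L (J v) = U v := by
  have hk : LinearMap.ker J ≤ LinearMap.ker U := by
    intro v hv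
    rw [LinearMap.mem_ker] at hv ⊢
    have := h v
    rw [hv, norm_zero, mul_zero] at this
    exact norm_le_zero_iff.mp this
  -- The bound kills `U` on `ker J`, so `U` descends to the range of `J`; the same bound gives
  -- continuity there for the induced norm.
  let L0 : LinearMap.range J →ₗ[ℂ] ℂ :=
    ((LinearMap.ker J).liftQ U hk) ∘ₗ (J.quotKerEquivRange.symm : _ →ₗ[ℂ] _)
  have hL0 : ∀ v, L0 ⟨J v, LinearMap.mem_range_self J v⟩ = U v := by
    intro v
    have h1 : J.quotKerEquivRange.symm ⟨J v, LinearMap.mem_range_self J v⟩ =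
        (LinearMap.ker J).mkQ v := by
      rw [LinearEquiv.symm_apply_eq]
      ext
      simp
    simp only [L0, LinearMap.comp_apply, LinearEquiv.coe_coe, h1]
    simp
  let L1 : StrongDual ℂ (LinearMap.range J) := L0.mkContinuous C (by
    rintro ⟨_, v, rfl⟩
    rw [hL0]
    exact h v)
  obtain ⟨g, hg, hn⟩ := exists_extension_norm_eq _ L1
  refine ⟨g, ?_, fun v => ?_⟩
  · rw [hn]; exact LinearMap.mkContinuous_norm_le _ hC _
  · have := hg ⟨J v, LinearMap.mem_range_self J v⟩
    simp only at this
    rw [this]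
    exact hL0 v

/-! ### Jets of Schwartz functions, and integrals under a tempered distribution -/

section Jet

variable {E : Type*} [NormedAddCommGroup E] [NormedSpace ℝ E]

/-- The normed space of `j`-linear maps in which derivatives of order `j` live. -/
def JetSpace (E : Type*) [NormedAddCommGroup E] [NormedSpace ℝ E] (j : ℕ) : Type _ :=
  E [×j]→L[ℝ] ℂ

noncomputable instance (j : ℕ) : NormedAddCommGroup (JetSpace E j) :=
  inferInstanceAs (NormedAddCommGroup (E [×j]→L[ℝ] ℂ))

noncomputable instance (j : ℕ) : NormedSpace ℝ (JetSpace E j) :=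
  inferInstanceAs (NormedSpace ℝ (E [×j]→L[ℝ] ℂ))

noncomputable instance (j : ℕ) : NormedSpace ℂ (JetSpace E j) :=
  inferInstanceAs (NormedSpace ℂ (E [×j]→L[ℝ] ℂ))

instance (j : ℕ) : SMulCommClass ℂ ℝ (JetSpace E j) :=
  inferInstanceAs (SMulCommClass ℂ ℝ (E [×j]→L[ℝ] ℂ))

instance (j : ℕ) : CompleteSpace (JetSpace E j) :=
  inferInstanceAs (CompleteSpace (E [×j]→L[ℝ] ℂ))

/-- The derivative of order `j`. -/
noncomputable def jet (j : ℕ) (f : E → ℂ) (x : E) : JetSpace E j := iteratedFDeriv ℝ j f x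

/-- The identification of `0`-jets with values. -/
noncomputable def jetZeroEquiv : ℂ ≃L[ℝ] JetSpace E 0 :=
  (continuousMultilinearCurryFin0 ℝ E ℂ).symm.toContinuousLinearEquiv

/-- The identification of `(j + 1)`-jets with derivatives of `j`-jets. -/
noncomputable def jetSuccEquiv (j : ℕ) : (E →L[ℝ] JetSpace E j) ≃L[ℝ] JetSpace E (j + 1) :=
  (continuousMultilinearCurryLeftEquiv ℝ (fun _ : Fin (j + 1) => E) ℂ).symm.toContinuousLinearEquiv

theorem jet_zero (f : E → ℂ) (x : E) : jet 0 f x = jetZeroEquiv (f x) := rfl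

theorem jet_succ (j : ℕ) (f : E → ℂ) (x : E) :
    jet (j + 1) f x = jetSuccEquiv j (fderiv ℝ (jet j f) x) := rfl

theorem norm_jet (j : ℕ) (f : E → ℂ) (x : E) : ‖jet j f x‖ = ‖iteratedFDeriv ℝ j f x‖ := rfl

theorem norm_fderiv_jet (j : ℕ) (f : E → ℂ) (x : E) :
    ‖fderiv ℝ (jet j f) x‖ = ‖iteratedFDeriv ℝ (j + 1) f x‖ := norm_fderiv_iteratedFDeriv

theorem continuous_jet (j : ℕ) (f : 𝓢(E, ℂ)) : Continuous (jet j f) :=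
  (f.smooth ⊤).continuous_iteratedFDeriv (m := j) (by exact_mod_cast le_top)

theorem differentiable_jet (j : ℕ) (f : 𝓢(E, ℂ)) : Differentiable ℝ (jet j f) :=
  (f.smooth ⊤).differentiable_iteratedFDeriv (m := j) (by exact_mod_cast ENat.natCast_lt_top j)

theorem jet_add (j : ℕ) (f g : 𝓢(E, ℂ)) (x : E) :
    jet j (f + g : 𝓢(E, ℂ)) x = jet j f x + jet j g x :=
  iteratedFDeriv_add_apply (f.contDiffAt j) (g.contDiffAt j)

theorem jet_smul (j : ℕ) (a : ℂ) (f : 𝓢(E, ℂ)) (x : E) :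
    jet j (a • f : 𝓢(E, ℂ)) x = a • jet j f x :=
  iteratedFDeriv_const_smul_apply (f.contDiffAt j)

theorem weighted_iteratedFDeriv_le (k j : ℕ) (f : 𝓢(E, ℂ)) (x : E) :
    ‖((1 + ‖x‖) ^ k : ℝ) • jet j f x‖ ≤
      2 ^ k * (Finset.Iic (k, j)).sup (schwartzSeminormFamily ℂ E ℂ) f := by
  rw [norm_smul, Real.norm_of_nonneg (by positivity)]
  exact SchwartzMap.one_add_le_sup_seminorm_apply (𝕜 := ℂ) (m := (k, j)) le_rfl le_rfl f x

/-- The derivative of order `j` of a Schwartz function, multiplied by `(1 + ‖x‖) ^ k`, as a bounded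
continuous function. -/
noncomputable def weightedJet (k j : ℕ) :
    𝓢(E, ℂ) →L[ℂ] BoundedContinuousFunction E (JetSpace E j) :=
  mkCLMtoNormedSpace (fun f : 𝓢(E, ℂ) => BoundedContinuousFunction.ofNormedAddCommGroup
      (fun x => ((1 + ‖x‖) ^ k : ℝ) • jet j f x)
      (by
        have := continuous_jet j f
        fun_prop) _ (weighted_iteratedFDeriv_le k j f))
    (by
      intro f g
      ext1 x
      simp only [BoundedContinuousFunction.coe_ofNormedAddCommGroup,
        BoundedContinuousFunction.coe_add, Pi.add_apply]
      rw [← smul_add, jet_add])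
    (by
      intro a f
      ext1 x
      simp only [BoundedContinuousFunction.coe_ofNormedAddCommGroup,
        BoundedContinuousFunction.coe_smul, RingHom.id_apply]
      rw [smul_comm a, jet_smul])
    ⟨Finset.Iic (k, j), 2 ^ k, by positivity, fun f =>
      BoundedContinuousFunction.norm_ofNormedAddCommGroup_le _ (by positivity)
        (weighted_iteratedFDeriv_le k j f)⟩

theorem weightedJet_apply (k j : ℕ) (f : 𝓢(E, ℂ)) (x : E) :
    weightedJet k j f x = ((1 + ‖x‖) ^ k : ℝ) • jet j f x := rfl

theorem seminorm_le_norm_weightedJet {k k' : ℕ} (hk : k' ≤ k) (j : ℕ) (f : 𝓢(E, ℂ)) :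
    SchwartzMap.seminorm ℂ k' j f ≤ ‖weightedJet k j f‖ := by
  refine f.seminorm_le_bound ℂ k' j (norm_nonneg (weightedJet k j f)) fun x => ?_
  refine le_trans ?_ ((weightedJet k j f).norm_coe_le_norm x)
  rw [weightedJet_apply, norm_smul, Real.norm_of_nonneg (by positivity), norm_jet]
  gcongr
  calc ‖x‖ ^ k' ≤ (1 + ‖x‖) ^ k' := by gcongr; linarith
    _ ≤ (1 + ‖x‖) ^ k := pow_le_pow_right₀ (by linarith [norm_nonneg x]) hk

/-- A tempered distribution is bounded by finitely many seminorms. -/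
theorem exists_bound_tempered (U : 𝓢'(E, ℂ)) :
    ∃ N : ℕ, ∃ C : ℝ, 0 ≤ C ∧ ∀ f, ‖U f‖ ≤
      C * ‖(fun j : Fin (N + 1) => weightedJet (E := E) N j f)‖ := by
  have hc : Continuous ((normSeminorm ℂ ℂ).comp (U : 𝓢(E, ℂ) →ₗ[ℂ] ℂ)) := by
    change Continuous fun f => ‖U f‖
    exact U.continuous.norm
  obtain ⟨s, C, -, h⟩ := Seminorm.bound_of_continuous (schwartz_withSeminorms ℂ E ℂ) _ hc
  -- A single `N` serves both as the exponent of the weight and as the highest order of derivative,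
  -- whence the index set `Fin (N + 1)`.
  let N := s.sup (fun m => max m.1 m.2)
  refine ⟨N, C, C.2, fun f => ?_⟩
  refine (h f).trans ?_
  rw [smul_apply, NNReal.smul_def, smul_eq_mul]
  refine mul_le_mul_of_nonneg_left ?_ C.2
  refine Seminorm.finset_sup_apply_le (norm_nonneg _) fun m hm => ?_
  have hm' : max m.1 m.2 ≤ N := Finset.le_sup (f := fun m : ℕ × ℕ => max m.1 m.2) hm
  have h2 : m.2 < N + 1 := by omega
  exact (seminorm_le_norm_weightedJet (by omega) m.2 f).trans
    (norm_le_pi_norm (fun j : Fin (N + 1) => weightedJet (E := E) N j f) ⟨m.2, h2⟩)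

theorem norm_weightedJet_le (k j : ℕ) (f : 𝓢(E, ℂ)) :
    ‖weightedJet k j f‖ ≤ 2 ^ k * ∑ m ∈ Finset.Iic (k, j), SchwartzMap.seminorm ℂ m.1 m.2 f := by
  refine (BoundedContinuousFunction.norm_le (by positivity)).2 fun x => ?_
  refine (weighted_iteratedFDeriv_le k j f x).trans ?_
  gcongr
  refine Seminorm.finset_sup_apply_le (by positivity) fun m hm => ?_
  exact Finset.single_le_sum (f := fun m : ℕ × ℕ => SchwartzMap.seminorm ℂ m.1 m.2 f)
    (fun i _ => apply_nonneg _ _) hm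

theorem continuous_jet_apply {α : Type*} [TopologicalSpace α] {Φ : α → 𝓢(E, ℂ)} (hΦ : Continuous Φ)
    (j : ℕ) (x : E) :
    Continuous fun y => jet j (Φ y) x := by
  have h := (BoundedContinuousFunction.evalCLM ℝ x).continuous.comp
    ((weightedJet (E := E) 0 j).continuous.comp hΦ)
  refine h.congr fun y => ?_
  simp [weightedJet_apply]

variable {α : Type*} [MeasurableSpace α] [TopologicalSpace α] [OpensMeasurableSpace α]
  [SecondCountableTopology α] {μ : Measure α}

theorem integrable_weightedJet {Φ : α → 𝓢(E, ℂ)} (hΦ : Continuous Φ)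
    (hint : ∀ k j, Integrable (fun y => SchwartzMap.seminorm ℂ k j (Φ y)) μ) (k j : ℕ) :
    Integrable (fun y => weightedJet k j (Φ y)) μ := by
  refine Integrable.mono' (g := fun y => 2 ^ k * ∑ m ∈ Finset.Iic (k, j),
    SchwartzMap.seminorm ℂ m.1 m.2 (Φ y)) ?_ ?_ ?_
  · exact (integrable_finsetSum _ fun m _ => hint m.1 m.2).const_mul _
  · exact ((weightedJet k j).continuous.comp hΦ).aestronglyMeasurable
  · exact ae_of_all _ fun y => norm_weightedJet_le k j (Φ y)

/-- Differentiation under the integral sign for an integrable family of Schwartz functions. -/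
theorem jet_integral_schwartz {Φ : α → 𝓢(E, ℂ)} (hΦ : Continuous Φ)
    (hint : ∀ k j, Integrable (fun y => SchwartzMap.seminorm ℂ k j (Φ y)) μ)
    (Ψ : 𝓢(E, ℂ)) (hΨ : ∀ x, Ψ x = ∫ y, Φ y x ∂μ) (j : ℕ) :
    ∀ x, jet j Ψ x = ∫ y, jet j (Φ y) x ∂μ := by
  have hI : ∀ j x, Integrable (fun y => jet j (Φ y) x) μ := by
    intro j x
    refine (hint 0 j).mono' (continuous_jet_apply hΦ j x).aestronglyMeasurable ?_
    exact ae_of_all _ fun y => SchwartzMap.norm_iteratedFDeriv_le_seminorm ℂ (Φ y) j x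
  induction j with
  | zero =>
    intro x
    simp only [jet_zero]
    rw [hΨ x]
    exact (jetZeroEquiv.integral_comp_comm (fun y => Φ y x)).symm
  | succ j ih =>
    intro x
    simp only [jet_succ]
    have hc : Continuous fun y => fderiv ℝ (jet j (Φ y)) x := by
      refine ((jetSuccEquiv j).symm.continuous.comp
        (continuous_jet_apply hΦ (j + 1) x)).congr fun y => ?_
      simp [jet_succ]
    -- The bound does not depend on `z`, so the domination holds on the whole space and no
    -- neighbourhood has to be chosen.
    have hb : ∀ y z, ‖fderiv ℝ (jet j (Φ y)) z‖ ≤ SchwartzMap.seminorm ℂ 0 (j + 1) (Φ y) := by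
      intro y z
      rw [norm_fderiv_jet]
      exact SchwartzMap.norm_iteratedFDeriv_le_seminorm ℂ (Φ y) (j + 1) z
    have key : HasFDerivAt (fun x => ∫ y, jet j (Φ y) x ∂μ)
        (∫ y, fderiv ℝ (jet j (Φ y)) x ∂μ) x := by
      refine hasFDerivAt_integral_of_dominated_of_fderiv_le (s := Set.univ) (𝕜 := ℝ)
        (bound := fun y => SchwartzMap.seminorm ℂ 0 (j + 1) (Φ y))
        (F' := fun x y => fderiv ℝ (jet j (Φ y)) x) Filter.univ_mem ?_ (hI j x)
        hc.aestronglyMeasurable ?_ (hint 0 (j + 1)) ?_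
      · exact Eventually.of_forall fun x => (hI j x).aestronglyMeasurable
      · exact ae_of_all _ fun y z _ => hb y z
      · exact ae_of_all _ fun y z _ => (differentiable_jet j (Φ y) z).hasFDerivAt
    have h2 : jet j Ψ = fun x => ∫ y, jet j (Φ y) x ∂μ := funext ih
    rw [h2, key.fderiv]
    exact ((jetSuccEquiv j).integral_comp_comm _).symm

/-- A tempered distribution commutes with the integral of a continuous family of Schwartz functions
all of whose seminorms are integrable. -/
theorem tempered_integral {Φ : α → 𝓢(E, ℂ)} (hΦ : Continuous Φ)
    (hint : ∀ k j, Integrable (fun y => SchwartzMap.seminorm ℂ k j (Φ y)) μ)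
    (Ψ : 𝓢(E, ℂ)) (hΨ : ∀ x, Ψ x = ∫ y, Φ y x ∂μ) (U : 𝓢'(E, ℂ)) :
    U Ψ = ∫ y, U (Φ y) ∂μ := by
  obtain ⟨N, C, hC, hU⟩ := exists_bound_tempered U
  let J : 𝓢(E, ℂ) →L[ℂ] ((j : Fin (N + 1)) → BoundedContinuousFunction E (JetSpace E j)) :=
    ContinuousLinearMap.pi fun j => weightedJet N j
  obtain ⟨L, -, hL⟩ := exists_clm_factor U.toLinearMap J.toLinearMap C hC hU
  have hL' : ∀ f, U f = L (J f) := fun f => (hL f).symm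
  -- Through `J` the family takes values in a Banach space, where it has a Bochner integral that
  -- commutes with `L`. It remains to see that this integral is `J Ψ`, which is checked component by
  -- component and point by point.
  have hJ : Integrable (fun y => J (Φ y)) μ :=
    Integrable.of_eval fun j => integrable_weightedJet hΦ hint N j
  simp only [hL']
  rw [L.integral_comp_comm hJ]
  congr 1
  funext j
  ext1 x
  have h1 := (ContinuousLinearMap.proj (R := ℝ) (φ := fun j : Fin (N + 1) =>
    BoundedContinuousFunction E (JetSpace E j)) j).integral_comp_comm hJ
  have h2 := (BoundedContinuousFunction.evalCLM ℝ x).integral_comp_comm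
    (integrable_weightedJet hΦ hint N j)
  simp only [ContinuousLinearMap.proj_apply] at h1
  rw [← h1]
  have h3 : ∀ f, J f j = weightedJet N j f := fun f => rfl
  simp only [h3]
  have h4 : ∀ f : BoundedContinuousFunction E (JetSpace E j),
    BoundedContinuousFunction.evalCLM ℝ x f = f x := fun f => rfl
  rw [← h4 (∫ y, _ ∂μ), ← h2]
  simp only [h4, weightedJet_apply]
  rw [integral_smul, jet_integral_schwartz hΦ hint Ψ hΨ j x]

end Jet

/-! ### Translations and products in the Schwartz space -/

section Translation

variable {E : Type*} [NormedAddCommGroup E] [NormedSpace ℝ E]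

theorem pow_norm_mul_jet_le (k j : ℕ) (f : 𝓢(E, ℂ)) (x : E) :
    (1 + ‖x‖) ^ k * ‖jet j f x‖ ≤ ‖weightedJet k j f‖ := by
  have := (weightedJet k j f).norm_coe_le_norm x
  rwa [weightedJet_apply, norm_smul, Real.norm_of_nonneg (by positivity)] at this

theorem one_add_norm_pow_le {E : Type*} [NormedAddCommGroup E] (k : ℕ) (x y : E) :
    (1 + ‖x‖) ^ k ≤ (1 + ‖x - y‖) ^ k * (1 + ‖y‖) ^ k := by
  rw [← mul_pow]
  gcongr
  have : ‖x‖ ≤ ‖x - y‖ + ‖y‖ := by simpa using norm_add_le (x - y) y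
  nlinarith [norm_nonneg (x - y), norm_nonneg y]

theorem jet_compSubConst (j : ℕ) (f : 𝓢(E, ℂ)) (y x : E) :
    jet j (compSubConstCLM ℝ y f) x = jet j f (x - y) :=
  iteratedFDeriv_comp_sub (f := f) j y x

theorem seminorm_compSubConst_le (k j : ℕ) (f : 𝓢(E, ℂ)) (y : E) :
    SchwartzMap.seminorm ℂ k j (compSubConstCLM ℝ y f) ≤ ‖weightedJet k j f‖ * (1 + ‖y‖) ^ k := by
  refine SchwartzMap.seminorm_le_bound ℂ k j _ (by positivity) fun x => ?_
  rw [← norm_jet, jet_compSubConst]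
  calc ‖x‖ ^ k * ‖jet j f (x - y)‖
      ≤ ((1 + ‖x - y‖) ^ k * (1 + ‖y‖) ^ k) * ‖jet j f (x - y)‖ := by
        gcongr
        refine le_trans ?_ (one_add_norm_pow_le k x y)
        gcongr
        linarith
    _ = ((1 + ‖x - y‖) ^ k * ‖jet j f (x - y)‖) * (1 + ‖y‖) ^ k := by ring
    _ ≤ _ := by gcongr; exact pow_norm_mul_jet_le k j f _

/-- Mean value inequality for the `j`-jet on the ball of radius `R` around `x`, which contains `x -
y` and `x - y₀`. On that ball `‖x‖ ^ k` is at most `(1 + R) ^ k (1 + ‖z‖) ^ k`, so the weight can be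
moved to the point `z` where the derivative is taken. -/
theorem seminorm_compSubConst_sub_le (k j : ℕ) (f : 𝓢(E, ℂ)) {R : ℝ} {y y₀ : E}
    (hy : ‖y‖ ≤ R) (hy₀ : ‖y₀‖ ≤ R) :
    SchwartzMap.seminorm ℂ k j (compSubConstCLM ℝ y f - compSubConstCLM ℝ y₀ f) ≤
      ‖weightedJet k (j + 1) f‖ * (1 + R) ^ k * ‖y - y₀‖ := by
  have hR : 0 ≤ R := (norm_nonneg y).trans hy
  refine SchwartzMap.seminorm_le_bound ℂ k j _ (by positivity) fun x => ?_
  have h1 : jet j (compSubConstCLM ℝ y f - compSubConstCLM ℝ y₀ f : 𝓢(E, ℂ)) x =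
      jet j f (x - y) - jet j f (x - y₀) := by
    have h2 : compSubConstCLM ℝ y f - compSubConstCLM ℝ y₀ f =
        compSubConstCLM ℝ y f + (-1 : ℂ) • compSubConstCLM ℝ y₀ f := by
      rw [neg_one_smul, sub_eq_add_neg]
    rw [h2, jet_add, jet_smul, jet_compSubConst, jet_compSubConst, neg_one_smul, ← sub_eq_add_neg]
  rw [← norm_jet, h1]
  by_cases hx : (‖x‖ ^ k) = 0
  · rw [hx, zero_mul]; positivity
  have hx' : 0 < ‖x‖ ^ k := lt_of_le_of_ne (by positivity) (Ne.symm hx)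
  have key : ‖jet j f (x - y) - jet j f (x - y₀)‖ ≤
      (‖weightedJet k (j + 1) f‖ * (1 + R) ^ k / ‖x‖ ^ k) * ‖(x - y) - (x - y₀)‖ := by
    refine Convex.norm_image_sub_le_of_norm_fderiv_le (𝕜 := ℝ) (f := jet j f)
      (s := Metric.closedBall x R) (fun z _ => differentiable_jet j f z) (fun z hz => ?_)
      (convex_closedBall x R) ?_ ?_
    · rw [norm_fderiv_jet, ← norm_jet, le_div_iff₀ hx']
      have hz' : ‖x - z‖ ≤ R := by rwa [mem_closedBall_iff_norm'] at hz
      calc ‖jet (j + 1) f z‖ * ‖x‖ ^ k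
          ≤ ‖jet (j + 1) f z‖ * ((1 + ‖z‖) ^ k * (1 + R) ^ k) := by
            gcongr
            have h2 := one_add_norm_pow_le k x (x - z)
            rw [sub_sub_cancel] at h2
            calc ‖x‖ ^ k ≤ (1 + ‖x‖) ^ k := by gcongr; linarith
              _ ≤ _ := h2
              _ ≤ _ := by gcongr
        _ = ((1 + ‖z‖) ^ k * ‖jet (j + 1) f z‖) * (1 + R) ^ k := by ring
        _ ≤ _ := by gcongr; exact pow_norm_mul_jet_le k (j + 1) f z
    · simpa using hy₀
    · simpa using hy
  calc ‖x‖ ^ k * ‖jet j f (x - y) - jet j f (x - y₀)‖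
      ≤ ‖x‖ ^ k * ((‖weightedJet k (j + 1) f‖ * (1 + R) ^ k / ‖x‖ ^ k) * ‖y - y₀‖) := by
        gcongr
        refine key.trans_eq ?_
        rw [sub_sub_sub_cancel_left, norm_sub_rev]
    _ = _ := by field_simp

/-- Translations act continuously on the Schwartz space. -/
theorem continuous_compSubConst (f : 𝓢(E, ℂ)) : Continuous fun y => compSubConstCLM ℝ y f := by
  rw [continuous_iff_continuousAt]
  intro y₀
  refine ((schwartz_withSeminorms ℂ E ℂ).tendsto_nhds _ _).2 fun m ε hε => ?_
  set B := ‖weightedJet m.1 (m.2 + 1) f‖ * (1 + (‖y₀‖ + 1)) ^ m.1 with hB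
  have h1 : Tendsto (fun y => B * ‖y - y₀‖) (𝓝 y₀) (𝓝 0) := by
    have : Continuous fun y => B * ‖y - y₀‖ := by fun_prop
    simpa using this.tendsto y₀
  filter_upwards [h1.eventually (gt_mem_nhds hε), Metric.ball_mem_nhds y₀ one_pos] with y hy hy1
  refine lt_of_le_of_lt ?_ hy
  refine seminorm_compSubConst_sub_le m.1 m.2 f ?_ (by linarith)
  have h2 := norm_sub_norm_le y y₀
  rw [mem_ball_iff_norm] at hy1
  linarith

/-- The pointwise product of Schwartz functions. -/
noncomputable def mulS (f g : 𝓢(E, ℂ)) : 𝓢(E, ℂ) := smulLeftCLM ℂ (f : E → ℂ) g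

theorem mulS_apply (f g : 𝓢(E, ℂ)) (x : E) : mulS f g x = f x * g x :=
  smulLeftCLM_apply_apply f.hasTemperateGrowth g x

theorem continuous_mulS (f : 𝓢(E, ℂ)) : Continuous (mulS f) :=
  (smulLeftCLM ℂ (f : E → ℂ)).continuous

/-- By Leibniz, each term has one factor decaying in `x` and one in `x - y`, and `1 + ‖y‖ ≤ (1 +
‖x‖)(1 + ‖x - y‖)` converts the two into decay in `y`. This makes the localizations of a Schwartz
function integrable in every seminorm. -/
theorem seminorm_mulS_compSubConst_le (f g : 𝓢(E, ℂ)) (N k j : ℕ) :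
    ∃ C : ℝ, 0 ≤ C ∧ ∀ y,
      (1 + ‖y‖) ^ N * SchwartzMap.seminorm ℂ k j (mulS f (compSubConstCLM ℝ y g)) ≤ C := by
  set C := ∑ i ∈ Finset.range (j + 1),
    (j.choose i : ℝ) * ‖weightedJet (k + N) i f‖ * ‖weightedJet N (j - i) g‖
  refine ⟨C, by positivity, fun y => ?_⟩
  rw [← le_div_iff₀' (by positivity)]
  refine SchwartzMap.seminorm_le_bound ℂ k j _ (by positivity) fun x => ?_
  rw [le_div_iff₀' (by positivity)]
  have h1 : ‖iteratedFDeriv ℝ j (mulS f (compSubConstCLM ℝ y g)) x‖ ≤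
      ∑ i ∈ Finset.range (j + 1),
        (j.choose i : ℝ) * ‖jet i f x‖ * ‖jet (j - i) g (x - y)‖ := by
    have h2 : (mulS f (compSubConstCLM ℝ y g) : E → ℂ) =
        fun x => f x * compSubConstCLM ℝ y g x := funext fun x => mulS_apply _ _ _
    rw [h2]
    refine (norm_iteratedFDeriv_mul_le (N := j) (f.smooth j)
      ((compSubConstCLM ℝ y g).smooth j) x le_rfl).trans_eq ?_
    refine Finset.sum_congr rfl fun i _ => ?_
    rw [← norm_jet, ← norm_jet, jet_compSubConst]
  calc (1 + ‖y‖) ^ N * (‖x‖ ^ k * ‖iteratedFDeriv ℝ j (mulS f (compSubConstCLM ℝ y g)) x‖)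
      ≤ ((1 + ‖x‖) ^ N * (1 + ‖x - y‖) ^ N) * ((1 + ‖x‖) ^ k * ∑ i ∈ Finset.range (j + 1),
        (j.choose i : ℝ) * ‖jet i f x‖ * ‖jet (j - i) g (x - y)‖) := by
        gcongr
        · have h3 := one_add_norm_pow_le N y x
          rwa [norm_sub_rev, mul_comm] at h3
        · linarith
    _ = ∑ i ∈ Finset.range (j + 1), (j.choose i : ℝ) * ((1 + ‖x‖) ^ (k + N) * ‖jet i f x‖) *
        ((1 + ‖x - y‖) ^ N * ‖jet (j - i) g (x - y)‖) := by
        rw [Finset.mul_sum, Finset.mul_sum]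
        refine Finset.sum_congr rfl fun i _ => ?_
        ring
    _ ≤ C := by
        refine Finset.sum_le_sum fun i _ => ?_
        gcongr
        · exact pow_norm_mul_jet_le _ _ _ _
        · exact pow_norm_mul_jet_le _ _ _ _

theorem continuous_seminorm_schwartz (k j : ℕ) :
    Continuous (SchwartzMap.seminorm ℂ k j : 𝓢(E, ℂ) → ℝ) :=
  (schwartz_withSeminorms ℂ E ℂ).continuous_seminorm (k, j)

end Translation

/-! ### Localization and convolution under a tempered distribution -/

section Pairing

variable {n : ℕ}

/-- An exponent for which `(1 + ‖x‖) ^ (-N)` is integrable on `ℝⁿ`. -/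
theorem integrable_one_add_norm_pow_inv :
    Integrable (fun x : Rn n => ((1 + ‖x‖) ^ (n + 1))⁻¹) := by
  have h := integrable_one_add_norm (E := Rn n) (μ := volume) (r := n + 1) (by simp)
  refine h.congr (ae_of_all _ fun x => ?_)
  have : (0 : ℝ) < 1 + ‖x‖ := by positivity
  simp only
  rw [Real.rpow_neg this.le]
  congr 1
  exact_mod_cast Real.rpow_natCast (1 + ‖x‖) (n + 1)

theorem integrable_of_one_add_norm_pow_mul_le {F : Type*} [NormedAddCommGroup F] {g : Rn n → F}
    (hg : AEStronglyMeasurable g) {C : ℝ} (h : ∀ x, (1 + ‖x‖) ^ (n + 1) * ‖g x‖ ≤ C) :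
    Integrable g := by
  refine (integrable_one_add_norm_pow_inv.const_mul C).mono' hg (ae_of_all _ fun x => ?_)
  rw [← div_eq_mul_inv, le_div_iff₀' (by positivity)]
  exact h x

/-- A tempered distribution is recovered from its localizations. -/
theorem tempered_eq_integral_mulS (U : 𝓢'(Rn n, ℂ)) (ψ κ : 𝓢(Rn n, ℂ)) (hκ : ∫ x, κ x = 1) :
    U ψ = ∫ ξ, U (mulS ψ (compSubConstCLM ℝ ξ κ)) := by
  have hc : Continuous fun ξ : Rn n => mulS ψ (compSubConstCLM ℝ ξ κ) :=
    (continuous_mulS ψ).comp (continuous_compSubConst κ)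
  refine tempered_integral hc (fun k j => ?_) ψ (fun x => ?_) U
  · obtain ⟨C, -, hC⟩ := seminorm_mulS_compSubConst_le ψ κ (n + 1) k j
    refine integrable_of_one_add_norm_pow_mul_le (C := C)
      ((continuous_seminorm_schwartz k j).comp hc).aestronglyMeasurable fun x => ?_
    rw [Real.norm_of_nonneg (apply_nonneg _ _)]
    exact hC x
  · simp only [mulS_apply, compSubConstCLM_apply]
    rw [integral_const_mul, integral_sub_left_eq_self (fun y => κ y), hκ, mul_one]

/-- A tempered distribution commutes with convolution. -/
theorem tempered_convolution (U : 𝓢'(Rn n, ℂ)) (a η Ψ : 𝓢(Rn n, ℂ))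
    (hΨ : ∀ t, Ψ t = ∫ y, a y * η (t - y)) :
    U Ψ = ∫ y, a y * U (compSubConstCLM ℝ y η) := by
  have hc : Continuous fun y : Rn n => a y • compSubConstCLM ℝ y η :=
    a.continuous.smul (continuous_compSubConst η)
  have h := tempered_integral (μ := volume) hc (fun k j => ?_) Ψ (fun x => ?_) U
  · simpa using h
  · refine integrable_of_one_add_norm_pow_mul_le
      (C := ‖weightedJet (n + 1 + k) 0 a‖ * ‖weightedJet k j η‖)
      ((continuous_seminorm_schwartz k j).comp hc).aestronglyMeasurable fun x => ?_
    rw [Real.norm_of_nonneg (apply_nonneg _ _), map_smul_eq_mul]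
    have h0 : ‖a x‖ = ‖jet 0 a x‖ := by rw [norm_jet, norm_iteratedFDeriv_zero]
    calc (1 + ‖x‖) ^ (n + 1) * (‖a x‖ * SchwartzMap.seminorm ℂ k j (compSubConstCLM ℝ x η))
        ≤ (1 + ‖x‖) ^ (n + 1) * (‖a x‖ * (‖weightedJet k j η‖ * (1 + ‖x‖) ^ k)) := by
          gcongr
          exact seminorm_compSubConst_le k j η x
      _ = ((1 + ‖x‖) ^ (n + 1 + k) * ‖jet 0 a x‖) * ‖weightedJet k j η‖ := by
          rw [h0]; ring
      _ ≤ _ := by gcongr; exact pow_norm_mul_jet_le _ _ _ _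
  · rw [hΨ]
    rfl

end Pairing

/-! ### Characters and the Fourier transform of Schwartz functions -/

section Character

variable {n : ℕ}

theorem norm_character (ξ t : Rn n) : ‖character ξ t‖ = 1 := by
  rw [character, Complex.norm_exp]
  simp

theorem character_comm (ξ t : Rn n) : character ξ t = character t ξ := by
  rw [character, character, real_inner_comm]

theorem character_add_left (ξ η t : Rn n) :
    character (ξ + η) t = character ξ t * character η t := by
  rw [character, character, character, ← Complex.exp_add, inner_add_right]
  congr 1
  push_cast
  ring

theorem character_neg_left (ξ t : Rn n) : character (-ξ) t = conj (character ξ t) := by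
  rw [character, character, ← Complex.exp_conj]
  congr 1
  simp

theorem character_sub_left (ξ η t : Rn n) :
    character (ξ - η) t = character ξ t * conj (character η t) := by
  rw [sub_eq_add_neg, character_add_left, character_neg_left]

theorem character_sub_right (ξ s t : Rn n) :
    character ξ (s - t) = character ξ s * conj (character ξ t) := by
  rw [character_comm, character_sub_left, character_comm s, character_comm t]

theorem character_mul_conj (ξ t : Rn n) : character ξ t * conj (character ξ t) = 1 := by
  rw [Complex.mul_conj, Complex.normSq_eq_norm_sq, norm_character]
  simp

theorem character_zero_left (t : Rn n) : character (0 : Rn n) t = 1 := by simp [character]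

theorem continuous_character_uncurry : Continuous fun p : Rn n × Rn n => character p.1 p.2 := by
  unfold character
  fun_prop

@[fun_prop]
theorem Continuous.character {α : Type*} [TopologicalSpace α] {f g : α → Rn n}
    (hf : Continuous f) (hg : Continuous g) : Continuous fun a => character (f a) (g a) :=
  continuous_character_uncurry.comp (hf.prodMk hg)

end Character

section FourierS

variable {n : ℕ}

/-- The constant `(2π)⁻ⁿ` of the Fourier inversion formula. -/
noncomputable def invConst (n : ℕ) : ℝ := ((2 * Real.pi) ^ n)⁻¹

theorem invConst_pos (n : ℕ) : 0 < invConst n := by unfold invConst; positivity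

/-- The inverse of the Fourier transform on Schwartz functions. -/
noncomputable def fourierSInv (ψ : 𝓢(Rn n, ℂ)) : 𝓢(Rn n, ℂ) :=
  𝓕⁻ (compCLMOfContinuousLinearEquiv ℂ (scaleEquiv n).symm ψ)

theorem fourierS_eq (ψ : 𝓢(Rn n, ℂ)) :
    fourierS n ψ = compCLMOfContinuousLinearEquiv ℂ (scaleEquiv n) (𝓕 ψ) := rfl

theorem fourierS_fourierSInv (ψ : 𝓢(Rn n, ℂ)) : fourierS n (fourierSInv ψ) = ψ := by
  rw [fourierS_eq, fourierSInv, FourierTransform.fourier_fourierInv_eq]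
  ext x
  simp

theorem fourierSInv_fourierS (ψ : 𝓢(Rn n, ℂ)) : fourierSInv (fourierS n ψ) = ψ := by
  rw [fourierS_eq, fourierSInv]
  have h : compCLMOfContinuousLinearEquiv ℂ (scaleEquiv n).symm
      (compCLMOfContinuousLinearEquiv ℂ (scaleEquiv n) (𝓕 ψ)) = 𝓕 ψ := by
    ext x
    simp
  rw [h, FourierTransform.fourierInv_fourier_eq]

theorem fourierS_apply' (ψ : 𝓢(Rn n, ℂ)) (ξ : Rn n) :
    fourierS n ψ ξ = ∫ x, character ξ x * ψ x := fourierS_apply ψ ξ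

theorem integral_comp_two_pi_smul {F : Type*} [NormedAddCommGroup F] [NormedSpace ℝ F]
    (g : Rn n → F) : ∫ x, g ((2 * Real.pi) • x) = invConst n • ∫ x, g x := by
  rw [Measure.integral_comp_smul, invConst]
  congr 1
  rw [abs_of_pos (by positivity)]
  simp

theorem fourierSInv_apply (ψ : 𝓢(Rn n, ℂ)) (ξ : Rn n) :
    fourierSInv ψ ξ = invConst n * ∫ x, conj (character ξ x) * ψ x := by
  have h1 : fourierSInv ψ ξ = 𝓕⁻ (fun x : Rn n => ψ ((2 * Real.pi) • x)) ξ := by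
    have hf : (compCLMOfContinuousLinearEquiv ℂ (scaleEquiv n).symm ψ : Rn n → ℂ) =
        fun x => ψ ((2 * Real.pi) • x) := by
      funext x
      simp only [compCLMOfContinuousLinearEquiv_apply, Function.comp_apply]
      congr 1
      rw [ContinuousLinearEquiv.symm_apply_eq]
      change x = (2 * Real.pi)⁻¹ • (2 * Real.pi) • x
      rw [inv_smul_smul₀ (by positivity)]
    rw [fourierSInv, SchwartzMap.fourierInv_coe, hf]
  rw [h1, Real.fourierInv_eq']
  have h2 := integral_comp_two_pi_smul (fun x : Rn n => conj (character ξ x) * ψ x)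
  rw [Complex.real_smul] at h2
  rw [← h2]
  congr 1
  ext x
  rw [smul_eq_mul, character, ← Complex.exp_conj, inner_smul_left]
  congr 2
  simp only [map_neg, map_mul, Complex.conj_I, Complex.conj_ofReal, RCLike.conj_to_real]
  push_cast
  ring

theorem integral_norm_sq_fourierS (b : 𝓢(Rn n, ℂ)) :
    ∫ x, ‖fourierS n b x‖ ^ 2 = (2 * Real.pi) ^ n * ∫ x, ‖b x‖ ^ 2 := by
  have h1 := SchwartzMap.integral_norm_sq_fourier b
  have h2 := integral_comp_two_pi_smul (fun x : Rn n => ‖fourierS n b x‖ ^ 2)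
  have h3 : ∀ x : Rn n, fourierS n b ((2 * Real.pi) • x) = 𝓕 b x := by
    intro x
    change 𝓕 b ((2 * Real.pi)⁻¹ • (2 * Real.pi) • x) = _
    rw [inv_smul_smul₀ (by positivity)]
  simp only [h3] at h2
  rw [h1] at h2
  rw [h2, smul_eq_mul, invConst, ← mul_assoc, mul_inv_cancel₀ (by positivity), one_mul]

theorem integrable_prod_bounded {κ b : Rn n → ℂ} (hκ : Integrable κ) (hb : Integrable b)
    {k : Rn n × Rn n → ℂ} (hk : Continuous k) (hk1 : ∀ p, ‖k p‖ ≤ 1) :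
    Integrable (fun p : Rn n × Rn n => k p * (κ p.1 * b p.2)) (volume.prod volume) :=
  (hκ.mul_prod hb).bdd_mul hk.aestronglyMeasurable (ae_of_all _ hk1)

/-- Expand `b` by Fourier inversion and interchange the integrals; the character in `ζ` then has
frequency `t - y`. -/
theorem fourierS_mulS (b κ : 𝓢(Rn n, ℂ)) (t : Rn n) :
    fourierS n (mulS b κ) t = invConst n * ∫ y, fourierS n b y * fourierS n κ (t - y) := by
  have h1 : ∀ ζ, b ζ = invConst n * ∫ y, conj (character ζ y) * fourierS n b y := by
    intro ζ
    rw [← fourierSInv_apply, fourierSInv_fourierS]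
  have hint := integrable_prod_bounded κ.integrable (fourierS n b).integrable
    (k := fun p => character t p.1 * conj (character p.1 p.2)) (by fun_prop)
    (fun p => by simp [norm_character])
  calc fourierS n (mulS b κ) t
      = ∫ ζ, character t ζ * (κ ζ * (invConst n * ∫ y, conj (character ζ y) * fourierS n b y)) := by
        rw [fourierS_apply']
        congr 1; ext ζ
        rw [mulS_apply, ← h1, mul_comm (b ζ)]
    _ = invConst n * ∫ ζ, ∫ y, character t ζ * conj (character ζ y) * (κ ζ * fourierS n b y) := by
        rw [← integral_const_mul]
        congr 1; ext ζ
        rw [← integral_const_mul, ← integral_const_mul, ← integral_const_mul,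
          ← integral_const_mul]
        congr 1; ext y
        ring
    _ = invConst n * ∫ y, ∫ ζ, character t ζ * conj (character ζ y) * (κ ζ * fourierS n b y) := by
        rw [integral_integral_swap hint]
    _ = _ := by
        congr 2; ext y
        rw [fourierS_apply' κ, ← integral_const_mul]
        congr 1; ext ζ
        rw [character_sub_left, character_comm ζ y]
        ring

theorem fourierS_compSubConst (θ : 𝓢(Rn n, ℂ)) (ξ t : Rn n) :
    fourierS n (compSubConstCLM ℝ ξ θ) t = character ξ t * fourierS n θ t := by
  rw [fourierS_apply', fourierS_apply', ← integral_const_mul,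
    ← integral_add_right_eq_self _ ξ]
  congr 1; ext x
  rw [compSubConstCLM_apply, add_sub_cancel_right, character_comm t, character_add_left,
    character_comm x]
  ring

end FourierS

/-! ### The short-time Fourier transform: measurability and relation to localizations -/

theorem measurable_eLpNorm_right {X Y F : Type*} [MeasurableSpace X] [MeasurableSpace Y]
    [NormedAddCommGroup F] [MeasurableSpace F] [OpensMeasurableSpace F] {μ : Measure X} [SFinite μ]
    {f : X → Y → F} (hf : Measurable (Function.uncurry f)) {p : ℝ≥0∞} (hp : p ≠ 0) (hp' : p ≠ ∞) :
    Measurable fun y => eLpNorm (fun x => f x y) p μ := by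
  simp only [eLpNorm_eq_lintegral_rpow_enorm_toReal hp hp']
  refine Measurable.pow_const ?_ _
  refine Measurable.lintegral_prod_left' (f := fun z : X × Y => ‖f z.1 z.2‖ₑ ^ p.toReal) ?_
  exact hf.enorm.pow_const _

section Window

variable {n : ℕ} (φ : 𝓢(Rn n, ℂ))

theorem shiftedWindow_apply' (x ξ t : Rn n) :
    shiftedWindow φ x ξ t = character ξ t * conj (φ (t - x)) := shiftedWindow_apply φ x ξ t

/-- The dependence on `x` becomes a translation up to a unimodular factor, which gives continuity in
`x`. The counterpart for `ξ` is `shiftedWindow_eq_fourierS`, where the translation takes place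
before the Fourier transform. -/
theorem shiftedWindow_eq_compSubConst (x ξ : Rn n) :
    shiftedWindow φ x ξ = character ξ x • compSubConstCLM ℝ x (shiftedWindow φ 0 ξ) := by
  ext t
  have := character_mul_conj ξ x
  simp only [smul_apply, compSubConstCLM_apply, shiftedWindow_apply', smul_eq_mul,
    sub_zero, character_sub_right]
  linear_combination (- character ξ t * conj (φ (t - x))) * this

theorem shiftedWindow_eq_fourierS (x ξ : Rn n) :
    shiftedWindow φ x ξ =
      fourierS n (compSubConstCLM ℝ ξ (fourierSInv (shiftedWindow φ x 0))) := by
  ext t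
  rw [fourierS_compSubConst, fourierS_fourierSInv, shiftedWindow_apply', shiftedWindow_apply',
    character_zero_left, one_mul]

variable (u : 𝓢'(Rn n, ℂ))

theorem continuous_stft_left (ξ : Rn n) : Continuous fun x => stft φ u x ξ := by
  have h : ∀ x, stft φ u x ξ = character ξ x * u (compSubConstCLM ℝ x (shiftedWindow φ 0 ξ)) := by
    intro x
    rw [stft, shiftedWindow_eq_compSubConst, map_smul, smul_eq_mul]
  simp only [h]
  have := u.continuous.comp (continuous_compSubConst (shiftedWindow φ 0 ξ))
  exact (continuous_const.character continuous_id).mul this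

theorem continuous_stft_right (x : Rn n) : Continuous fun ξ => stft φ u x ξ := by
  have h : ∀ ξ, stft φ u x ξ =
      u (fourierS n (compSubConstCLM ℝ ξ (fourierSInv (shiftedWindow φ x 0)))) := by
    intro ξ
    rw [stft, shiftedWindow_eq_fourierS]
  simp only [h]
  exact u.continuous.comp ((fourierS n).continuous.comp (continuous_compSubConst _))

theorem measurable_stft : Measurable fun p : Rn n × Rn n => stft φ u p.1 p.2 := by
  exact measurable_uncurry_of_continuous_of_measurable (ι := Rn n) (u := fun x ξ => stft φ u x ξ)
    (fun ξ => continuous_stft_left φ u ξ) (fun x => (continuous_stft_right φ u x).measurable)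

/-- Localizations of the Fourier transform of `u` in terms of the short-time Fourier transform. -/
theorem fourierD_mulS_compSubConst (b : 𝓢(Rn n, ℂ)) (ξ : Rn n) :
    fourierD u (mulS b (compSubConstCLM ℝ ξ (fourierSInv (shiftedWindow φ 0 0)))) =
      invConst n * ∫ y, fourierS n b y * (conj (character ξ y) * stft φ u y ξ) := by
  -- The Fourier transform of the product is a convolution of `b̂` with `shiftedWindow φ 0 ξ`, and
  -- `u` passes under it. Translating that window by `y` gives `shiftedWindow φ y ξ` up to a
  -- unimodular factor.
  rw [fourierD_apply, tempered_convolution u ((invConst n : ℂ) • fourierS n b)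
    (shiftedWindow φ 0 ξ), ← integral_const_mul]
  · congr 1; ext y
    rw [stft, shiftedWindow_eq_compSubConst φ y, map_smul, smul_eq_mul, smul_apply,
      smul_eq_mul]
    linear_combination (- (invConst n : ℂ) * fourierS n b y *
      u (compSubConstCLM ℝ y (shiftedWindow φ 0 ξ))) * character_mul_conj ξ y
  · intro t
    rw [fourierS_mulS, ← integral_const_mul]
    congr 1; ext y
    rw [← shiftedWindow_eq_fourierS, smul_apply, smul_eq_mul, mul_assoc]

end Window

/-! ### Submultiplicativity and growth of the weight -/

section Weight

variable {n : ℕ}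

theorem one_le_weight {s : ℝ} (hs : 0 ≤ s) (ξ : Rn n) : 1 ≤ weight s ξ := by
  rw [weight, ENNReal.one_le_ofReal]
  exact Real.one_le_rpow (by nlinarith [sq_nonneg ‖ξ‖]) (by positivity)

theorem weight_ne_top (s : ℝ) (ξ : Rn n) : weight s ξ ≠ ∞ := ENNReal.ofReal_ne_top

theorem weight_ne_zero (s : ℝ) (ξ : Rn n) : weight s ξ ≠ 0 := by
  rw [weight]
  have : 0 < (1 + ‖ξ‖ ^ 2) ^ (s / 2) := by positivity
  simpa using this

theorem measurable_weight (s : ℝ) : Measurable (weight s : Rn n → ℝ≥0∞) := by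
  unfold weight
  fun_prop

/-- The constant in the submultiplicativity of the weight. -/
noncomputable def weightConst (s : ℝ) : ℝ≥0∞ := ENNReal.ofReal (2 ^ (s / 2))

theorem weightConst_ne_top (s : ℝ) : weightConst s ≠ ∞ := ENNReal.ofReal_ne_top

theorem weight_add_le {s : ℝ} (hs : 0 ≤ s) (ξ η : Rn n) :
    weight s (ξ + η) ≤ weightConst s * (weight s ξ * weight s η) := by
  rw [weight, weight, weight, weightConst, ← ENNReal.ofReal_mul (by positivity),
    ← ENNReal.ofReal_mul (by positivity), ← Real.mul_rpow (by positivity) (by positivity),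
    ← Real.mul_rpow (by positivity) (by positivity)]
  gcongr
  have h1 := norm_add_le ξ η
  have h2 : ‖ξ + η‖ ^ 2 ≤ (‖ξ‖ + ‖η‖) ^ 2 := by gcongr
  nlinarith [sq_nonneg (‖ξ‖ - ‖η‖), sq_nonneg (‖ξ‖ * ‖η‖)]

theorem weight_le_weight_sub {s : ℝ} (hs : 0 ≤ s) (ξ η : Rn n) :
    weight s ξ ≤ weightConst s * (weight s η * weight s (ξ - η)) := by
  simpa using weight_add_le hs η (ξ - η)

theorem weight_le_pow {s : ℝ} {M : ℕ} (hM : s ≤ M) (ξ : Rn n) :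
    weight s ξ ≤ ENNReal.ofReal ((1 + ‖ξ‖) ^ M) := by
  rw [weight]
  gcongr
  calc (1 + ‖ξ‖ ^ 2) ^ (s / 2) ≤ (1 + ‖ξ‖ ^ 2) ^ ((M : ℝ) / 2) :=
        Real.rpow_le_rpow_of_exponent_le (by nlinarith [sq_nonneg ‖ξ‖]) (by linarith)
    _ ≤ ((1 + ‖ξ‖) ^ 2) ^ ((M : ℝ) / 2) := by
        gcongr
        nlinarith [norm_nonneg ξ]
    _ = (1 + ‖ξ‖) ^ M := by
        rw [← Real.rpow_natCast_mul (by positivity)]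
        rw [← Real.rpow_natCast]
        congr 1
        push_cast
        ring

theorem lintegral_weight_sq_mul_lt_top (s : ℝ) (χ : 𝓢(Rn n, ℂ)) :
    ∫⁻ ξ, weight s ξ ^ 2 * ‖χ ξ‖ₑ ^ 2 < ∞ := by
  obtain ⟨M, hM⟩ := exists_nat_ge s
  have hi : Integrable (fun ξ : Rn n => (((1 + ‖ξ‖) ^ M) ^ 2 * ‖χ ξ‖ ^ 2 : ℝ)) := by
    refine integrable_of_one_add_norm_pow_mul_le
      (C := ‖weightedJet (n + 1 + M) 0 χ‖ * ‖weightedJet M 0 χ‖) (by fun_prop) fun x => ?_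
    have h0 : ‖χ x‖ = ‖jet 0 χ x‖ := by rw [norm_jet, norm_iteratedFDeriv_zero]
    rw [Real.norm_of_nonneg (by positivity)]
    calc (1 + ‖x‖) ^ (n + 1) * (((1 + ‖x‖) ^ M) ^ 2 * ‖χ x‖ ^ 2)
        = ((1 + ‖x‖) ^ (n + 1 + M) * ‖jet 0 χ x‖) * ((1 + ‖x‖) ^ M * ‖jet 0 χ x‖) := by
          rw [h0]; ring
      _ ≤ _ := by gcongr <;> exact pow_norm_mul_jet_le _ _ _ _
  refine lt_of_le_of_lt ?_ hi.lintegral_lt_top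
  refine lintegral_mono fun ξ => ?_
  rw [ENNReal.ofReal_mul (by positivity), ENNReal.ofReal_pow (by positivity),
    ENNReal.ofReal_pow (norm_nonneg _), ofReal_norm]
  gcongr
  exact weight_le_pow hM ξ

end Weight

/-! ### Elementary `L^q` inequalities -/

section Interpolation

variable {X F : Type*} [MeasurableSpace X] {μ : Measure X} [NormedAddCommGroup F]

/-- The simplest case of interpolation: `|h|^q ≤ B^(q - 2) |h|²` almost everywhere. -/
theorem eLpNorm_le_max_of_two_le {h : X → F} {q : ℝ≥0∞} (hq : 2 ≤ q) {B : ℝ≥0∞}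
    (h2 : eLpNorm h 2 μ ≤ B) (htop : eLpNorm h ∞ μ ≤ B) : eLpNorm h q μ ≤ B := by
  rcases eq_or_ne q ∞ with rfl | hq'
  · exact htop
  rcases eq_or_ne B ∞ with rfl | hB
  · exact le_top
  have hq0 : q ≠ 0 := by rintro rfl; simp at hq
  have hqr : 2 ≤ q.toReal := by simpa using ENNReal.toReal_mono hq' hq
  rw [eLpNorm_eq_lintegral_rpow_enorm_toReal hq0 hq']
  rw [one_div, ENNReal.rpow_inv_le_iff (by linarith)]
  have h2' : ∫⁻ x, ‖h x‖ₑ ^ (2 : ℝ) ∂μ ≤ B ^ (2 : ℝ) := by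
    rw [eLpNorm_eq_lintegral_rpow_enorm_toReal two_ne_zero ENNReal.ofNat_ne_top,
      ENNReal.toReal_ofNat, one_div, ENNReal.rpow_inv_le_iff (by norm_num)] at h2
    exact h2
  calc ∫⁻ x, ‖h x‖ₑ ^ q.toReal ∂μ
      ≤ ∫⁻ x, B ^ (q.toReal - 2) * ‖h x‖ₑ ^ (2 : ℝ) ∂μ := by
        refine lintegral_mono_ae ?_
        filter_upwards [enorm_ae_le_eLpNormEssSup h μ] with x hx
        rw [← eLpNorm_exponent_top] at hx
        calc ‖h x‖ₑ ^ q.toReal = ‖h x‖ₑ ^ (q.toReal - 2) * ‖h x‖ₑ ^ (2 : ℝ) := by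
              rw [← ENNReal.rpow_add_of_nonneg _ _ (by linarith) (by norm_num)]
              congr 1; ring
          _ ≤ _ := by
              gcongr
              exact hx.trans htop
    _ = B ^ (q.toReal - 2) * ∫⁻ x, ‖h x‖ₑ ^ (2 : ℝ) ∂μ :=
        lintegral_const_mul' _ _ (ENNReal.rpow_ne_top_of_nonneg (by linarith) hB)
    _ ≤ B ^ (q.toReal - 2) * B ^ (2 : ℝ) := by gcongr
    _ = B ^ q.toReal := by
        rw [← ENNReal.rpow_add_of_nonneg _ _ (by linarith) (by norm_num)]
        congr 1; ring

/-- The hypothesis `p ≤ 2` enters the embedding here: it puts the dual exponent in the range where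
`L²` and `L^∞` bounds suffice. -/
theorem two_le_conjExponent {p : ℝ≥0∞} (hp : p ≤ 2) : 2 ≤ p.conjExponent := by
  rw [ENNReal.conjExponent]
  have h1 : p - 1 ≤ 1 := by
    rw [tsub_le_iff_right]; exact hp.trans_eq one_add_one_eq_two.symm
  calc (2 : ℝ≥0∞) = 1 + 1 := one_add_one_eq_two.symm
    _ ≤ _ := by gcongr; exact ENNReal.one_le_inv.2 h1

theorem lintegral_mul_le_sqrt (f g : X → ℝ≥0∞) (hf : AEMeasurable f μ) (hg : AEMeasurable g μ) :
    ∫⁻ x, f x * g x ∂μ ≤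
      (∫⁻ x, f x ^ 2 ∂μ) ^ (1 / 2 : ℝ) * (∫⁻ x, g x ^ 2 ∂μ) ^ (1 / 2 : ℝ) := by
  have := ENNReal.lintegral_mul_le_Lp_mul_Lq μ Real.HolderConjugate.two_two hf hg
  simpa only [Pi.mul_apply, ENNReal.rpow_two] using this

theorem eLpNorm_two_eq (h : X → F) :
    eLpNorm h 2 μ = (∫⁻ x, ‖h x‖ₑ ^ 2 ∂μ) ^ (1 / 2 : ℝ) := by
  rw [eLpNorm_eq_lintegral_rpow_enorm_toReal two_ne_zero ENNReal.ofNat_ne_top]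
  simp

end Interpolation

/-! ### Densities from weighted `L²` bounds -/

section Density

variable {n : ℕ}

/-- A tempered distribution that is bounded for the norm of a weighted `L²` space with integrable
weight is given by an integrable function. -/
theorem exists_isGivenBy_of_le_lintegral (U : 𝓢'(Rn n, ℂ)) {m : Rn n → ℝ≥0∞} (hm : Measurable m)
    (hm' : ∫⁻ ζ, m ζ ≠ ∞) {D : ℝ≥0∞} (hD : D ≠ ∞)
    (hU : ∀ ψ, ‖U ψ‖ₑ ≤ D * (∫⁻ ζ, m ζ * ‖ψ ζ‖ₑ ^ 2) ^ (1 / 2 : ℝ)) :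
    ∃ g : Rn n → ℂ, IsGivenBy U g ∧ ∀ w : Rn n → ℝ≥0∞, Measurable w →
      ∫⁻ ζ, w ζ * ‖g ζ‖ₑ ≤ D * (∫⁻ ζ, w ζ ^ 2 * m ζ) ^ (1 / 2 : ℝ) := by
  set ν : Measure (Rn n) := volume.withDensity m with hν
  have : IsFiniteMeasure ν := isFiniteMeasure_withDensity hm'
  let J : 𝓢(Rn n, ℂ) →L[ℂ] Lp ℂ 2 ν := SchwartzMap.toLpCLM ℂ ℂ 2 ν
  have hJ : ∀ ψ, ‖J ψ‖ₑ = (∫⁻ ζ, m ζ * ‖ψ ζ‖ₑ ^ 2) ^ (1 / 2 : ℝ) := by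
    intro ψ
    have h1 : ‖J ψ‖ₑ = eLpNorm ψ 2 ν := by
      change ‖(ψ.memLp 2 ν).toLp‖ₑ = _
      rw [Lp.enorm_toLp]
    rw [h1, eLpNorm_two_eq, hν, lintegral_withDensity_eq_lintegral_mul _ hm (by fun_prop)]
    rfl
  have hUJ : ∀ ψ, ‖U ψ‖ ≤ D.toReal * ‖J ψ‖ := by
    intro ψ
    have := hU ψ
    rw [← hJ] at this
    have h2 := ENNReal.toReal_mono (ENNReal.mul_ne_top hD enorm_ne_top) this
    simpa [ENNReal.toReal_mul] using h2
  -- The functional is extended to all of `L²(ν)` by Hahn-Banach, so density of the Schwartz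
  -- functions is not needed. Its Riesz representative `h` gives the density `m · conj h` with
  -- respect to Lebesgue measure.
  obtain ⟨L, hLn, hL⟩ := exists_clm_factor U.toLinearMap J.toLinearMap D.toReal
    ENNReal.toReal_nonneg hUJ
  obtain ⟨h, hmeas, hmem, hh, hUh⟩ : ∃ h : Rn n → ℂ, StronglyMeasurable h ∧ MemLp h 2 ν ∧
      eLpNorm h 2 ν ≤ D ∧ ∀ ψ, U ψ = ∫ ζ, ψ ζ * conj (h ζ) ∂ν := by
    let h : Lp ℂ 2 ν := (InnerProductSpace.toDual ℂ (Lp ℂ 2 ν)).symm L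
    refine ⟨h, Lp.stronglyMeasurable h, Lp.memLp h, ?_, fun ψ => ?_⟩
    · rw [← Lp.enorm_def, ← ofReal_norm, LinearIsometryEquiv.norm_map]
      exact ENNReal.ofReal_le_of_le_toReal hLn
    · have h1 : U ψ = inner ℂ h (J ψ) := by
        rw [InnerProductSpace.toDual_symm_apply]
        exact (hL ψ).symm
      rw [h1, L2.inner_def]
      refine integral_congr_ae ?_
      filter_upwards [SchwartzMap.coeFn_toLp ψ 2 ν] with ζ hζ
      change inner ℂ (h ζ) ((ψ.toLp 2 ν) ζ) = _
      rw [hζ, RCLike.inner_apply]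
  have hmfin : ∀ᵐ ζ, m ζ < ∞ := ae_lt_top hm hm'
  refine ⟨fun ζ => (m ζ).toReal • conj (h ζ), fun ψ => ⟨?_, ?_⟩, fun w hw => ?_⟩
  · have h1 : Integrable (fun ζ => ψ ζ * conj (h ζ)) ν :=
      (ψ.memLp 2 ν).integrable_mul hmem.star
    rw [hν, integrable_withDensity_iff_integrable_smul' hm hmfin] at h1
    refine h1.congr (ae_of_all _ fun ζ => ?_)
    simp only [mul_smul_comm]
  · rw [hUh, hν, integral_withDensity_eq_integral_toReal_smul hm hmfin]
    congr 1; ext ζ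
    simp only [mul_smul_comm]
  · calc ∫⁻ ζ, w ζ * ‖(m ζ).toReal • conj (h ζ)‖ₑ
        ≤ ∫⁻ ζ, m ζ * (w ζ * ‖h ζ‖ₑ) := by
          refine lintegral_mono fun ζ => ?_
          rw [enorm_smul, RCLike.enorm_conj, ← mul_assoc, mul_comm (w ζ), mul_assoc]
          gcongr
          rw [Real.enorm_of_nonneg ENNReal.toReal_nonneg]
          exact ENNReal.ofReal_toReal_le
      _ = ∫⁻ ζ, w ζ * ‖h ζ‖ₑ ∂ν := by
          rw [hν]
          exact (lintegral_withDensity_eq_lintegral_mul _ hm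
            (hw.mul hmeas.measurable.enorm)).symm
      _ ≤ (∫⁻ ζ, w ζ ^ 2 ∂ν) ^ (1 / 2 : ℝ) * (∫⁻ ζ, ‖h ζ‖ₑ ^ 2 ∂ν) ^ (1 / 2 : ℝ) :=
          lintegral_mul_le_sqrt _ _ hw.aemeasurable
            hmeas.measurable.enorm.aemeasurable
      _ = (∫⁻ ζ, w ζ ^ 2 * m ζ) ^ (1 / 2 : ℝ) * eLpNorm h 2 ν := by
          rw [← eLpNorm_two_eq, hν,
            lintegral_withDensity_eq_lintegral_mul _ hm (hw.pow_const 2)]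
          simp only [Pi.mul_apply, mul_comm]
      _ ≤ _ := by rw [mul_comm]; gcongr

end Density

/-! ### The embedding of `M^{p,1}_s` into `FL¹_s` -/

section Embedding

variable {n : ℕ}

@[fun_prop]
theorem measurable_schwartz (f : 𝓢(Rn n, ℂ)) : Measurable (f : Rn n → ℂ) := f.continuous.measurable

theorem eLpNorm_two_fourierS (b : 𝓢(Rn n, ℂ)) :
    eLpNorm (fourierS n b) 2 volume =
      ENNReal.ofReal ((2 * Real.pi) ^ n) ^ (1 / 2 : ℝ) * eLpNorm b 2 volume := by
  have h : ∀ f : 𝓢(Rn n, ℂ), ∫⁻ x, ‖f x‖ₑ ^ 2 = ENNReal.ofReal (∫ x, ‖f x‖ ^ 2) := by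
    intro f
    have hi : Integrable fun x => ‖f x‖ ^ 2 := (f.memLp 2).integrable_norm_pow two_ne_zero
    rw [ofReal_integral_eq_lintegral_ofReal hi (ae_of_all _ fun x => by positivity)]
    congr 1; ext x
    rw [ENNReal.ofReal_pow (norm_nonneg _), ofReal_norm]
  rw [eLpNorm_two_eq, eLpNorm_two_eq, h, h, integral_norm_sq_fourierS,
    ENNReal.ofReal_mul (by positivity), ENNReal.mul_rpow_of_nonneg _ _ (by norm_num)]

theorem eLpNorm_top_fourierS_le (b : 𝓢(Rn n, ℂ)) :
    eLpNorm (fourierS n b) ∞ volume ≤ eLpNorm b 1 volume := by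
  rw [eLpNorm_exponent_top]
  refine eLpNormEssSup_le_of_ae_enorm_bound (ae_of_all _ fun x => ?_)
  rw [fourierS_apply', eLpNorm_one_eq_lintegral_enorm]
  refine (enorm_integral_le_lintegral_enorm _).trans_eq ?_
  congr 1; ext t
  rw [enorm_mul, ← ofReal_norm (character x t), norm_character]
  simp

/-- A substitute for the Hausdorff-Young inequality for localized functions. -/
theorem exists_eLpNorm_fourierS_mulS_le (χ₁ χ₂ : 𝓢(Rn n, ℂ)) :
    ∃ K : ℝ≥0∞, K ≠ ∞ ∧ ∀ (q : ℝ≥0∞), 2 ≤ q → ∀ (ψ : 𝓢(Rn n, ℂ)) (ξ : Rn n),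
      eLpNorm (fourierS n (mulS ψ (compSubConstCLM ℝ ξ (mulS χ₁ χ₂)))) q volume ≤
        K * eLpNorm (fun ζ => ψ ζ * χ₁ (ζ - ξ)) 2 volume := by
  obtain ⟨K₁, hK₁⟩ : ∃ K, K = ENNReal.ofReal ((2 * Real.pi) ^ n) ^ (1 / 2 : ℝ) *
    eLpNorm χ₂ ∞ volume := ⟨_, rfl⟩
  obtain ⟨K₂, hK₂⟩ : ∃ K, K = eLpNorm χ₂ 2 volume := ⟨_, rfl⟩
  have h1 : K₁ ≠ ∞ := by
    rw [hK₁]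
    exact ENNReal.mul_ne_top (ENNReal.rpow_ne_top_of_nonneg (by norm_num) ENNReal.ofReal_ne_top)
      (χ₂.memLp_top volume).eLpNorm_ne_top
  have h2 : K₂ ≠ ∞ := by
    rw [hK₂]
    exact (χ₂.memLp 2 volume).eLpNorm_ne_top
  -- `K₁` comes from Plancherel with `χ₂` in `L^∞`, and `K₂` from the `L¹`-`L^∞` bound with `χ₂` in
  -- `L²`. The factor `χ₁` stays in the local norm. The constant is independent of `q` and `ξ`.
  refine ⟨max K₁ K₂, by simp [h1, h2], fun q hq ψ ξ => ?_⟩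
  set b := mulS ψ (compSubConstCLM ℝ ξ (mulS χ₁ χ₂)) with hb
  have hb' : (b : Rn n → ℂ) =
      (fun ζ => ψ ζ * χ₁ (ζ - ξ)) • (fun ζ => χ₂ (ζ - ξ)) := by
    funext ζ
    rw [hb, mulS_apply, compSubConstCLM_apply, mulS_apply, Pi.smul_apply', smul_eq_mul, mul_assoc]
  have htr : ∀ r, eLpNorm (fun ζ => χ₂ (ζ - ξ)) r volume = eLpNorm χ₂ r volume := fun r =>
    eLpNorm_comp_measurePreserving (g := χ₂) χ₂.continuous.aestronglyMeasurable
      (measurePreserving_sub_right volume ξ)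
  have hm1 : AEStronglyMeasurable (fun ζ => ψ ζ * χ₁ (ζ - ξ)) volume := by fun_prop
  have hm2 : AEStronglyMeasurable (fun ζ => χ₂ (ζ - ξ)) volume := by fun_prop
  refine eLpNorm_le_max_of_two_le hq ?_ ?_
  · rw [eLpNorm_two_fourierS, hb']
    calc _ ≤ ENNReal.ofReal ((2 * Real.pi) ^ n) ^ (1 / 2 : ℝ) *
          (eLpNorm (fun ζ => ψ ζ * χ₁ (ζ - ξ)) 2 volume * eLpNorm χ₂ ∞ volume) := by
          gcongr
          rw [← htr ∞]
          exact eLpNorm_smul_le_eLpNorm_mul_eLpNorm_top 2 _ hm1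
      _ = K₁ * eLpNorm (fun ζ => ψ ζ * χ₁ (ζ - ξ)) 2 volume := by rw [hK₁]; ring
      _ ≤ _ := by gcongr; exact le_max_left _ _
  · refine (eLpNorm_top_fourierS_le b).trans ?_
    rw [hb']
    refine (eLpNorm_smul_le_mul_eLpNorm (p := 2) (q := 2) (r := 1) hm2 hm1).trans ?_
    rw [htr, mul_comm, ← hK₂]
    gcongr
    exact le_max_right _ _

theorem shiftedWindow_ne_zero {φ : 𝓢(Rn n, ℂ)} (hφ : φ ≠ 0) : shiftedWindow φ 0 0 ≠ 0 := by
  intro h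
  refine hφ ?_
  ext t
  have := shiftedWindow_apply' φ 0 0 t
  rw [h, character_zero_left, sub_zero, one_mul] at this
  simpa using this.symm

/-- A nonzero Schwartz function times the square of its conjugate times itself has positive
integral, hence can be normalized. -/
theorem exists_normalized_partition {θ : 𝓢(Rn n, ℂ)} (hθ : θ ≠ 0) :
    ∃ χ₁ χ₂ : 𝓢(Rn n, ℂ), ∫ x, mulS (mulS χ₁ χ₂) θ x = 1 := by
  let θ' : 𝓢(Rn n, ℂ) := postcompCLM (𝕜 := ℝ) (Complex.conjCLE : ℂ →L[ℝ] ℂ) θ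
  have hθ' : ∀ x, θ' x = conj (θ x) := fun x => by simp [θ']
  -- The choice `χ₁ = conj θ`, `χ₂ = θ · conj θ` turns the triple product into `|θ|⁴`, up to
  -- normalization.
  have hpt : ∀ x, mulS (mulS θ' (mulS θ θ')) θ x = ((‖θ x‖ ^ 4 : ℝ) : ℂ) := by
    intro x
    have h := Complex.mul_conj (θ x)
    rw [Complex.normSq_eq_norm_sq] at h
    rw [mulS_apply, mulS_apply, mulS_apply, hθ']
    push_cast at h ⊢
    linear_combination (θ x * conj (θ x) + (‖θ x‖ : ℂ) ^ 2) * h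
  set I := ∫ x, ‖θ x‖ ^ 4 with hI
  have hIne : I ≠ 0 := by
    intro h0
    have hint : Integrable fun x => ‖θ x‖ ^ 4 := (θ.memLp 4).integrable_norm_pow (by norm_num)
    rw [hI, integral_eq_zero_iff_of_nonneg (fun x => by positivity) hint] at h0
    have h1 : (fun x => ‖θ x‖ ^ 4) = fun _ : Rn n => (0 : ℝ) :=
      Continuous.ae_eq_iff_eq volume (by fun_prop) continuous_const |>.1 h0
    refine hθ ?_
    ext x
    have := congrFun h1 x
    simpa using this
  refine ⟨θ', (I⁻¹ : ℂ) • mulS θ θ', ?_⟩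
  have h2 : ∀ x, mulS (mulS θ' ((I⁻¹ : ℂ) • mulS θ θ')) θ x =
      (I⁻¹ : ℂ) * ((‖θ x‖ ^ 4 : ℝ) : ℂ) := by
    intro x
    rw [← hpt]
    simp only [mulS_apply, smul_apply, smul_eq_mul]
    ring
  simp only [h2]
  rw [integral_const_mul, integral_complex_ofReal, ← hI]
  exact inv_mul_cancel₀ (by exact_mod_cast hIne)

/-- Hölder's inequality in `y` applied to `fourierD_mulS_compSubConst`. -/
theorem enorm_fourierD_localized_le (φ : 𝓢(Rn n, ℂ)) (u : 𝓢'(Rn n, ℂ)) {p q : ℝ≥0∞}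
    [p.HolderConjugate q] (b : 𝓢(Rn n, ℂ)) (ξ : Rn n) :
    ‖fourierD u (mulS b (compSubConstCLM ℝ ξ (fourierSInv (shiftedWindow φ 0 0))))‖ₑ ≤
      ENNReal.ofReal (invConst n) *
        (eLpNorm (fun x => stft φ u x ξ) p volume * eLpNorm (fourierS n b) q volume) := by
  rw [fourierD_mulS_compSubConst, enorm_mul]
  have h1 : ‖(invConst n : ℂ)‖ₑ = ENNReal.ofReal (invConst n) := by
    rw [← ofReal_norm, Complex.norm_real, Real.norm_of_nonneg (invConst_pos n).le]
  rw [h1]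
  gcongr
  refine (enorm_integral_le_lintegral_enorm _).trans ?_
  have hm1 : AEStronglyMeasurable (fun x => stft φ u x ξ) volume :=
    (continuous_stft_left φ u ξ).aestronglyMeasurable
  have hm2 : AEStronglyMeasurable (fourierS n b) volume := by fun_prop
  refine le_trans (le_of_eq ?_)
    (eLpNorm_smul_le_mul_eLpNorm (p := p) (q := q) (r := 1) hm2 hm1)
  rw [eLpNorm_one_eq_lintegral_enorm]
  congr 1; ext y
  rw [Pi.smul_apply', smul_eq_mul, enorm_mul, enorm_mul, enorm_mul, RCLike.enorm_conj,
    ← ofReal_norm (character ξ y), norm_character]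
  rw [ENNReal.ofReal_one, one_mul, mul_comm]

/-- The Fourier transform of an element of the modulation space is an integrable function. -/
theorem exists_flNorm_le_modNorm {p : ℝ≥0∞} (hp1 : 1 ≤ p) (hp2 : p ≤ 2) {s : ℝ} (hs : 0 ≤ s)
    {φ : 𝓢(Rn n, ℂ)} (hφ : φ ≠ 0) :
    ∃ C : ℝ≥0∞, C ≠ ∞ ∧ ∀ u, flNorm s u ≤ C * modNorm φ p s u := by
  have hp0 : p ≠ 0 := (zero_lt_one.trans_le hp1).ne'
  have hptop : p ≠ ∞ := (hp2.trans_lt ENNReal.ofNat_lt_top).ne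
  have hpq : p.HolderConjugate p.conjExponent := .conjExponent hp1
  set θ := fourierSInv (shiftedWindow φ 0 0) with hθ
  have hθ0 : θ ≠ 0 := by
    intro h0
    refine shiftedWindow_ne_zero hφ ?_
    rw [← fourierS_fourierSInv (shiftedWindow φ 0 0), ← hθ, h0, map_zero]
  obtain ⟨χ₁, χ₂, hχ⟩ := exists_normalized_partition hθ0
  obtain ⟨K, hK, hKle⟩ := exists_eLpNorm_fourierS_mulS_le χ₁ χ₂
  set K' := ENNReal.ofReal (invConst n) * K with hK'
  have hK'top : K' ≠ ∞ := ENNReal.mul_ne_top ENNReal.ofReal_ne_top hK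
  set S := ∫⁻ ξ, weight s ξ ^ 2 * ‖χ₁ ξ‖ₑ ^ 2 with hS
  have hStop : S ≠ ∞ := (lintegral_weight_sq_mul_lt_top s χ₁).ne
  -- The summand `1` keeps the constant nonzero, so that the right-hand side is `∞` when the
  -- modulation norm is.
  refine ⟨K' * (weightConst s ^ 2 * S) ^ (1 / 2 : ℝ) + 1, ?_, fun u => ?_⟩
  · refine ENNReal.add_ne_top.2 ⟨ENNReal.mul_ne_top hK'top
      (ENNReal.rpow_ne_top_of_nonneg (by norm_num)
        (ENNReal.mul_ne_top (ENNReal.pow_ne_top (weightConst_ne_top s)) hStop)), by simp⟩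
  set a : Rn n → ℝ≥0∞ := fun ξ => eLpNorm (fun x => stft φ u x ξ) p volume with ha
  have ham : Measurable a := measurable_eLpNorm_right (measurable_stft φ u) hp0 hptop
  set A := modNorm φ p s u with hA
  rcases eq_or_ne A ∞ with hAtop | hAtop
  · rw [hAtop, ENNReal.mul_top (by simp)]
    exact le_top
  have hA' : A = ∫⁻ ξ, weight s ξ * a ξ := rfl
  have hwm : Measurable (weight s : Rn n → ℝ≥0∞) := measurable_weight s
  -- The weight of the `L²` space is `(a / ⟨·⟩^s) * |χ₁|²`. Dividing by `⟨ξ⟩^s` balances two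
  -- demands: pairing against `m` must come out of Cauchy-Schwarz, and `∫ ⟨ζ⟩^(2s) m` must be
  -- bounded by `A = ∫ ⟨ξ⟩^s a`.
  set m : Rn n → ℝ≥0∞ := fun ζ => ∫⁻ ξ, a ξ / weight s ξ * ‖χ₁ (ζ - ξ)‖ₑ ^ 2 with hm
  have hkm : Measurable fun z : Rn n × Rn n => a z.2 / weight s z.2 * ‖χ₁ (z.1 - z.2)‖ₑ ^ 2 := by
    fun_prop
  have hmm : Measurable m := hkm.lintegral_prod_right'
  have hswap : ∀ F : Rn n → ℝ≥0∞, Measurable F → ∫⁻ ζ, F ζ * m ζ =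
      ∫⁻ ξ, a ξ / weight s ξ * ∫⁻ ζ, F ζ * ‖χ₁ (ζ - ξ)‖ₑ ^ 2 := by
    intro F hF
    calc ∫⁻ ζ, F ζ * m ζ
        = ∫⁻ ζ, ∫⁻ ξ, F ζ * (a ξ / weight s ξ * ‖χ₁ (ζ - ξ)‖ₑ ^ 2) := by
          congr 1; ext ζ
          rw [lintegral_const_mul _ (by fun_prop)]
      _ = ∫⁻ ξ, ∫⁻ ζ, F ζ * (a ξ / weight s ξ * ‖χ₁ (ζ - ξ)‖ₑ ^ 2) := by
          rw [lintegral_lintegral_swap]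
          exact (by fun_prop : Measurable fun z : Rn n × Rn n =>
            F z.1 * (a z.2 / weight s z.2 * ‖χ₁ (z.1 - z.2)‖ₑ ^ 2)).aemeasurable
      _ = _ := by
          congr 1; ext ξ
          rw [← lintegral_const_mul _ (by fun_prop)]
          congr 1; ext ζ
          ring
  have hw2m : ∫⁻ ζ, weight s ζ ^ 2 * m ζ ≤ weightConst s ^ 2 * S * A := by
    rw [hswap _ (hwm.pow_const 2), hA', ← lintegral_const_mul _ (by fun_prop)]
    refine lintegral_mono fun ξ => ?_
    calc a ξ / weight s ξ * ∫⁻ ζ, weight s ζ ^ 2 * ‖χ₁ (ζ - ξ)‖ₑ ^ 2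
        ≤ a ξ / weight s ξ * ∫⁻ ζ, (weightConst s * weight s ξ) ^ 2 *
            (weight s (ζ - ξ) ^ 2 * ‖χ₁ (ζ - ξ)‖ₑ ^ 2) := by
          refine mul_le_mul_right (lintegral_mono fun ζ => ?_) _
          calc weight s ζ ^ 2 * ‖χ₁ (ζ - ξ)‖ₑ ^ 2
              ≤ (weightConst s * (weight s ξ * weight s (ζ - ξ))) ^ 2 * ‖χ₁ (ζ - ξ)‖ₑ ^ 2 := by
                gcongr
                exact weight_le_weight_sub hs ζ ξ
            _ = _ := by ring
      _ = a ξ / weight s ξ * ((weightConst s * weight s ξ) ^ 2 * S) := by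
          rw [lintegral_const_mul _ (by fun_prop), hS]
          congr 2
          exact lintegral_sub_right_eq_self (fun ζ => weight s ζ ^ 2 * ‖χ₁ ζ‖ₑ ^ 2) ξ
      _ = (a ξ / weight s ξ * weight s ξ) * (weightConst s ^ 2 * S * weight s ξ) := by ring
      _ = _ := by
          rw [ENNReal.div_mul_cancel (weight_ne_zero s ξ) (weight_ne_top s ξ)]
          ring
  have hmtop : ∫⁻ ζ, m ζ ≠ ∞ := by
    refine ne_top_of_le_ne_top (ENNReal.mul_ne_top (ENNReal.mul_ne_top
      (ENNReal.pow_ne_top (weightConst_ne_top s)) hStop) hAtop) (le_trans ?_ hw2m)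
    refine lintegral_mono fun ζ => ?_
    have h1 : (1 : ℝ≥0∞) ≤ weight s ζ ^ 2 := one_le_pow₀ (one_le_weight hs ζ)
    calc m ζ = 1 * m ζ := (one_mul _).symm
      _ ≤ _ := by gcongr
  have hUle : ∀ ψ, ‖fourierD u ψ‖ₑ ≤
      (K' * A ^ (1 / 2 : ℝ)) * (∫⁻ ζ, m ζ * ‖ψ ζ‖ₑ ^ 2) ^ (1 / 2 : ℝ) := by
    intro ψ
    set B : Rn n → ℝ≥0∞ := fun ξ => ∫⁻ ζ, ‖ψ ζ‖ₑ ^ 2 * ‖χ₁ (ζ - ξ)‖ₑ ^ 2 with hB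
    have hBm : Measurable B := by
      refine Measurable.lintegral_prod_left' (f := fun z : Rn n × Rn n =>
        ‖ψ z.1‖ₑ ^ 2 * ‖χ₁ (z.1 - z.2)‖ₑ ^ 2) ?_
      fun_prop
    -- The partition `χ₁ χ₂ θ` is regrouped: `θ` produces the short-time Fourier transform, `χ₂` is
    -- spent on the `L^q` bound, and `χ₁` survives in `B`.
    have hloc : ∀ ξ, ‖fourierD u (mulS ψ (compSubConstCLM ℝ ξ (mulS (mulS χ₁ χ₂) θ)))‖ₑ ≤
        K' * (a ξ * B ξ ^ (1 / 2 : ℝ)) := by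
      intro ξ
      have h1 : mulS ψ (compSubConstCLM ℝ ξ (mulS (mulS χ₁ χ₂) θ)) =
          mulS (mulS ψ (compSubConstCLM ℝ ξ (mulS χ₁ χ₂))) (compSubConstCLM ℝ ξ θ) := by
        ext ζ
        simp only [mulS_apply, compSubConstCLM_apply]
        ring
      rw [h1]
      refine (enorm_fourierD_localized_le φ u (p := p) (q := p.conjExponent) _ ξ).trans ?_
      have h2 := hKle p.conjExponent (two_le_conjExponent hp2) ψ ξ
      have h3 : eLpNorm (fun ζ => ψ ζ * χ₁ (ζ - ξ)) 2 volume = B ξ ^ (1 / 2 : ℝ) := by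
        rw [eLpNorm_two_eq]
        congr 2; ext ζ
        rw [enorm_mul, mul_pow]
      rw [h3] at h2
      calc _ ≤ ENNReal.ofReal (invConst n) * (a ξ * (K * B ξ ^ (1 / 2 : ℝ))) := by gcongr
        _ = _ := by rw [hK']; ring
    have hsq : ∀ x : ℝ≥0∞, (x ^ (1 / 2 : ℝ)) ^ 2 = x := by
      intro x
      rw [← ENNReal.rpow_two, ← ENNReal.rpow_mul]
      norm_num
    calc ‖fourierD u ψ‖ₑ
        ≤ ∫⁻ ξ, K' * (a ξ * B ξ ^ (1 / 2 : ℝ)) := by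
          rw [tempered_eq_integral_mulS (fourierD u) ψ _ hχ]
          exact (enorm_integral_le_lintegral_enorm _).trans (lintegral_mono hloc)
      -- One copy of `a` is split as `(⟨ξ⟩^s a)^(1/2) (a / ⟨ξ⟩^s)^(1/2)`. After Cauchy-Schwarz the
      -- first factor integrates to `A`, the second to the integral of `m |ψ|²`.
      _ = K' * ∫⁻ ξ, (weight s ξ * a ξ) ^ (1 / 2 : ℝ) *
            (a ξ / weight s ξ * B ξ) ^ (1 / 2 : ℝ) := by
          rw [lintegral_const_mul _ (by fun_prop)]
          congr 2; ext ξ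
          rw [← ENNReal.mul_rpow_of_nonneg _ _ (by norm_num)]
          have : weight s ξ * a ξ * (a ξ / weight s ξ * B ξ) = a ξ ^ 2 * B ξ := by
            calc _ = (a ξ / weight s ξ * weight s ξ) * a ξ * B ξ := by ring
              _ = _ := by
                rw [ENNReal.div_mul_cancel (weight_ne_zero s ξ) (weight_ne_top s ξ)]; ring
          rw [this, ENNReal.mul_rpow_of_nonneg _ _ (by norm_num), ← ENNReal.rpow_two,
            ← ENNReal.rpow_mul]
          norm_num
      _ ≤ K' * (A ^ (1 / 2 : ℝ) * (∫⁻ ξ, a ξ / weight s ξ * B ξ) ^ (1 / 2 : ℝ)) := by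
          gcongr
          refine (lintegral_mul_le_sqrt _ _ (by fun_prop) (by fun_prop)).trans_eq ?_
          simp only [hsq]
          rw [hA']
      _ = _ := by
          rw [← hswap _ (by fun_prop), ← mul_assoc]
          simp only [mul_comm]
  obtain ⟨g, hg, hgw⟩ := exists_isGivenBy_of_le_lintegral (fourierD u) hmm hmtop
    (ENNReal.mul_ne_top hK'top (ENNReal.rpow_ne_top_of_nonneg (by norm_num) hAtop)) hUle
  calc flNorm s u ≤ ∫⁻ ξ, weight s ξ * ‖g ξ‖ₑ := iInf₂_le g hg
    _ ≤ K' * A ^ (1 / 2 : ℝ) * (∫⁻ ζ, weight s ζ ^ 2 * m ζ) ^ (1 / 2 : ℝ) := hgw _ hwm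
    _ ≤ K' * A ^ (1 / 2 : ℝ) * (weightConst s ^ 2 * S * A) ^ (1 / 2 : ℝ) := by gcongr
    _ = K' * (weightConst s ^ 2 * S) ^ (1 / 2 : ℝ) * (A ^ (1 / 2 : ℝ) * A ^ (1 / 2 : ℝ)) := by
        rw [ENNReal.mul_rpow_of_nonneg _ A (by norm_num)]
        ring
    _ = K' * (weightConst s ^ 2 * S) ^ (1 / 2 : ℝ) * A := by
        rw [← ENNReal.rpow_add_of_nonneg _ _ (by norm_num) (by norm_num)]
        norm_num
    _ ≤ _ := by gcongr; exact le_self_add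

end Embedding

/-! ### Minkowski's integral inequality -/

section Minkowski

variable {X Y : Type*} [MeasurableSpace X] [MeasurableSpace Y] {μ : Measure X} {ρ : Measure Y}
  [SFinite μ] [SFinite ρ]

/-- Minkowski's integral inequality. -/
theorem lintegral_rpow_lintegral_le {h : X → Y → ℝ≥0∞} (hh : Measurable (Function.uncurry h))
    {p : ℝ} (hp : 1 ≤ p) :
    (∫⁻ x, (∫⁻ y, h x y ∂ρ) ^ p ∂μ) ^ (1 / p) ≤ ∫⁻ y, (∫⁻ x, h x y ^ p ∂μ) ^ (1 / p) ∂ρ := by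
  rcases hp.eq_or_lt with rfl | hp
  · simp only [ENNReal.rpow_one, div_one]
    exact (lintegral_lintegral_swap hh.aemeasurable).le
  have hp0 : 0 < p := by linarith
  set a : Y → ℝ≥0∞ := fun y => (∫⁻ x, h x y ^ p ∂μ) ^ (1 / p) with ha
  have hhp : Measurable fun z : X × Y => h z.1 z.2 := hh
  have hhy : ∀ y, Measurable fun x => h x y := fun y => hhp.comp measurable_prodMk_right
  have ham : Measurable a := by
    refine Measurable.pow_const ?_ _
    exact Measurable.lintegral_prod_left' (f := fun z : X × Y => h z.1 z.2 ^ p)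
      (hhp.pow_const p)
  have hap : ∀ y, ∫⁻ x, h x y ^ p ∂μ = a y ^ p := by
    intro y
    rw [ha]
    simp only
    rw [← ENNReal.rpow_mul, one_div_mul_cancel hp0.ne', ENNReal.rpow_one]
  set A := ∫⁻ y, a y ∂ρ with hA
  rcases eq_or_ne A ∞ with hAt | hAt
  · rw [hAt]; exact le_top
  set q := p.conjExponent with hq
  have hpq : p.HolderConjugate q := Real.HolderConjugate.conjExponent hp
  have hq0 : 0 < q := hpq.symm.pos
  -- The splitting prepared for Hölder. It could fail only where `a y` is `0` or `∞`: in the first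
  -- case `h x y` vanishes for almost every `x`, and the second is a null set because `A` is finite.
  have hle : ∀ᵐ x ∂μ, ∀ᵐ y ∂ρ, h x y ≤ (h x y * a y ^ (-(1 / q))) * a y ^ (1 / q) := by
    have hms : MeasurableSet {z : X × Y |
        h z.1 z.2 ≤ (h z.1 z.2 * a z.2 ^ (-(1 / q))) * a z.2 ^ (1 / q)} := by
      refine measurableSet_le hhp ?_
      fun_prop
    rw [Measure.ae_ae_comm hms]
    filter_upwards [ae_lt_top ham hAt] with y hy
    rcases eq_or_ne (a y) 0 with h0 | h0
    · have h1 := hap y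
      rw [h0, ENNReal.zero_rpow_of_pos hp0, lintegral_eq_zero_iff
        ((hhy y).pow_const p)] at h1
      filter_upwards [h1] with x hx
      have : h x y = 0 := by
        have h2 : h x y ^ p = 0 := hx
        rw [ENNReal.rpow_eq_zero_iff] at h2
        rcases h2 with h2 | h2
        · exact h2.1
        · linarith [h2.2]
      rw [this]; exact zero_le
    · refine ae_of_all _ fun x => ?_
      rw [mul_assoc, ← ENNReal.rpow_add _ _ h0 hy.ne]
      simp
  have hA' : ∀ᵐ x ∂μ, (∫⁻ y, h x y ∂ρ) ^ p ≤
      (∫⁻ y, h x y ^ p * a y ^ (-(p / q)) ∂ρ) * A ^ (p / q) := by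
    filter_upwards [hle] with x hx
    have hxm : Measurable fun y => h x y := hhp.comp measurable_prodMk_left
    have h1 := ENNReal.lintegral_mul_le_Lp_mul_Lq ρ hpq
      (f := fun y => h x y * a y ^ (-(1 / q))) (g := fun y => a y ^ (1 / q))
      (by fun_prop) (by fun_prop)
    calc (∫⁻ y, h x y ∂ρ) ^ p
        ≤ ((∫⁻ y, (h x y * a y ^ (-(1 / q))) ^ p ∂ρ) ^ (1 / p) *
          (∫⁻ y, (a y ^ (1 / q)) ^ q ∂ρ) ^ (1 / q)) ^ p := by
          gcongr
          exact (lintegral_mono_ae hx).trans h1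
      _ = _ := by
          rw [ENNReal.mul_rpow_of_nonneg _ _ hp0.le, ← ENNReal.rpow_mul, ← ENNReal.rpow_mul,
            one_div_mul_cancel hp0.ne', ENNReal.rpow_one]
          congr 1
          · congr 1; ext y
            rw [ENNReal.mul_rpow_of_nonneg _ _ hp0.le, ← ENNReal.rpow_mul]
            congr 2
            ring
          · rw [hA]
            congr 1
            · congr 1; ext y
              rw [← ENNReal.rpow_mul, one_div_mul_cancel hq0.ne', ENNReal.rpow_one]
            · ring
  have hpq1 : p / q = p - 1 := by
    rw [hpq.div_conj_eq_sub_one]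
  rw [one_div, ENNReal.rpow_inv_le_iff hp0]
  calc ∫⁻ x, (∫⁻ y, h x y ∂ρ) ^ p ∂μ
      ≤ ∫⁻ x, (∫⁻ y, h x y ^ p * a y ^ (-(p / q)) ∂ρ) * A ^ (p / q) ∂μ := lintegral_mono_ae hA'
    _ = (∫⁻ x, ∫⁻ y, h x y ^ p * a y ^ (-(p / q)) ∂ρ ∂μ) * A ^ (p / q) :=
        lintegral_mul_const' _ _ (ENNReal.rpow_ne_top_of_nonneg (by positivity) hAt)
    _ = (∫⁻ y, ∫⁻ x, h x y ^ p * a y ^ (-(p / q)) ∂μ ∂ρ) * A ^ (p / q) := by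
        rw [lintegral_lintegral_swap]
        exact (by fun_prop : Measurable fun z : X × Y =>
          h z.1 z.2 ^ p * a z.2 ^ (-(p / q))).aemeasurable
    -- The inner integral is `a^p · a^(-(p - 1)) = a` when `a` is neither `0` nor `∞`.
    _ ≤ A * A ^ (p / q) := by
        gcongr
        rw [hA]
        refine lintegral_mono fun y => ?_
        rw [lintegral_mul_const _ ((hhy y).pow_const p), hap]
        rcases eq_or_ne (a y) 0 with h0 | h0
        · rw [h0, ENNReal.zero_rpow_of_pos hp0, zero_mul]
        rcases eq_or_ne (a y) ∞ with h1 | h1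
        · rw [h1]; exact le_top
        rw [← ENNReal.rpow_add _ _ h0 h1, hpq1]
        simp
    _ = A ^ p := by
        conv_lhs => rw [← ENNReal.rpow_one A, ← ENNReal.rpow_mul, one_mul]
        rw [← ENNReal.rpow_add_of_nonneg _ _ zero_le_one (by positivity), hpq1]
        congr 1; ring

/-- The form in which Minkowski is used: averages in frequency against `g`, with the `Lᵖ` norm taken
in `x`. -/
theorem eLpNorm_le_lintegral_mul_eLpNorm {F G : Type*} [NormedAddCommGroup F]
    [NormedAddCommGroup G] [MeasurableSpace G] [OpensMeasurableSpace G]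
    {V : X → Y → G} (hV : Measurable (Function.uncurry V)) {g : Y → ℝ≥0∞}
    (hg : Measurable g) {p : ℝ≥0∞} (hp1 : 1 ≤ p) (hp' : p ≠ ∞) {f : X → F}
    (hf : ∀ x, ‖f x‖ₑ ≤ ∫⁻ y, g y * ‖V x y‖ₑ ∂ρ) :
    eLpNorm f p μ ≤ ∫⁻ y, g y * eLpNorm (fun x => V x y) p μ ∂ρ := by
  have hp0 : p ≠ 0 := (zero_lt_one.trans_le hp1).ne'
  have hpr : 1 ≤ p.toReal := by simpa using ENNReal.toReal_mono hp' hp1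
  have hVm : Measurable fun z : X × Y => V z.1 z.2 := hV
  simp only [eLpNorm_eq_lintegral_rpow_enorm_toReal hp0 hp']
  have h1 := lintegral_rpow_lintegral_le (μ := μ) (ρ := ρ) (h := fun x y => g y * ‖V x y‖ₑ)
    (by
      change Measurable fun z : X × Y => g z.2 * ‖V z.1 z.2‖ₑ
      have := hVm.enorm
      fun_prop) hpr
  refine le_trans ?_ (h1.trans_eq ?_)
  · gcongr
    exact hf _
  · congr 1; ext y
    have hpos : 0 ≤ p.toReal := by linarith
    have hm : Measurable fun x => ‖V x y‖ₑ ^ p.toReal :=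
      (hVm.comp measurable_prodMk_right).enorm.pow_const _
    simp only [ENNReal.mul_rpow_of_nonneg _ _ hpos]
    rw [lintegral_const_mul _ hm, ENNReal.mul_rpow_of_nonneg _ _ (by positivity),
      ← ENNReal.rpow_mul, mul_one_div_cancel (by linarith), ENNReal.rpow_one]

end Minkowski

/-! ### Jointly measurable functions as `Lᵖ`-valued functions -/

section LpValued

variable {X Y : Type*} [MeasurableSpace X] [MeasurableSpace Y] {μ : Measure X} [SFinite μ]
  [IsSeparable μ]

open Classical in
/-- The class in `Lᵖ` of a function, zero if the function is not in `Lᵖ`. -/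
noncomputable def toLpOrZero (p : ℝ≥0∞) (μ : Measure X) (f : X → ℂ) : Lp ℂ p μ :=
  if h : MemLp f p μ then h.toLp f else 0

theorem toLpOrZero_of_memLp {X : Type*} [MeasurableSpace X] {μ : Measure X} {p : ℝ≥0∞}
    {f : X → ℂ} (h : MemLp f p μ) :
    toLpOrZero p μ f = h.toLp f := dif_pos h

/-- A jointly measurable function is strongly measurable as an `Lᵖ`-valued function. -/
theorem stronglyMeasurable_toLpOrZero {f : X → Y → ℂ} (hf : Measurable (Function.uncurry f))
    {p : ℝ≥0∞} [Fact (1 ≤ p)] [Fact (p ≠ ∞)] :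
    StronglyMeasurable fun y => toLpOrZero p μ (fun x => f x y) := by
  have hp0 : p ≠ 0 := (zero_lt_one.trans_le (Fact.out : 1 ≤ p)).ne'
  have hp' : p ≠ ∞ := Fact.out
  have hfm : ∀ y, AEStronglyMeasurable (fun x => f x y) μ := fun y =>
    (hf.comp measurable_prodMk_right).aestronglyMeasurable
  borelize ↥(Lp ℂ p μ)
  refine Measurable.stronglyMeasurable ?_
  -- For `p < ∞` the space `Lᵖ` is separable, so balls generate the Borel sets and it suffices that
  -- every distance `‖f(·, y) - h‖` is measurable in `y`.
  have hbasis : TopologicalSpace.IsTopologicalBasis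
      {s : Set (Lp ℂ p μ) | ∃ (h : Lp ℂ p μ) (r : ℝ≥0∞), s = {k | ‖k - h‖ₑ < r}} := by
    refine TopologicalSpace.isTopologicalBasis_of_isOpen_of_nhds ?_ ?_
    · rintro _ ⟨h, r, rfl⟩
      exact isOpen_lt (by fun_prop) continuous_const
    · intro k U hk hU
      obtain ⟨ε, hε, hεU⟩ := Metric.isOpen_iff.1 hU k hk
      refine ⟨_, ⟨k, ENNReal.ofReal ε, rfl⟩, by simpa using hε, fun l hl => hεU ?_⟩
      rw [mem_ball_iff_norm]
      have hl' : ‖l - k‖ₑ < ENNReal.ofReal ε := hl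
      rwa [← ofReal_norm, ENNReal.ofReal_lt_ofReal_iff hε] at hl'
  have hgen : (borel (Lp ℂ p μ)) = _ := hbasis.borel_eq_generateFrom
  rw [BorelSpace.measurable_eq (α := Lp ℂ p μ), hgen]
  refine measurable_generateFrom ?_
  rintro _ ⟨h, r, rfl⟩
  have hS : MeasurableSet {y | MemLp (fun x => f x y) p μ} := by
    have : {y | MemLp (fun x => f x y) p μ} = {y | eLpNorm (fun x => f x y) p μ < ∞} := by
      ext y
      exact ⟨fun h => h.2, fun h => ⟨hfm y, h⟩⟩
    rw [this]
    exact measurableSet_lt (measurable_eLpNorm_right hf hp0 hp') measurable_const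
  have hm : Measurable fun y => ‖toLpOrZero p μ (fun x => f x y) - h‖ₑ := by
    classical
    have heq : (fun y => ‖toLpOrZero p μ (fun x => f x y) - h‖ₑ) = fun y =>
        if MemLp (fun x => f x y) p μ then eLpNorm (fun x => f x y - h x) p μ else ‖h‖ₑ := by
      funext y
      split_ifs with hy
      · rw [toLpOrZero_of_memLp hy, Lp.enorm_def]
        refine eLpNorm_congr_ae ?_
        filter_upwards [Lp.coeFn_sub (hy.toLp _) h, hy.coeFn_toLp] with x h1 h2
        rw [h1, Pi.sub_apply, h2]
      · rw [toLpOrZero, dif_neg hy, zero_sub, enorm_neg]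
    rw [heq]
    refine Measurable.ite hS ?_ measurable_const
    refine measurable_eLpNorm_right (f := fun x y => f x y - h x) ?_ hp0 hp'
    have h1 : Measurable fun z : X × Y => f z.1 z.2 := hf
    exact h1.sub ((Lp.stronglyMeasurable h).measurable.comp measurable_fst)
  exact measurableSet_lt hm measurable_const

end LpValued

/-! ### Continuity of translations in weighted `L¹` -/

section TranslationL1

variable {n : ℕ} {E : Type*} [NormedAddCommGroup E]

/-- Continuity of translations in `L¹`. -/
theorem tendsto_lintegral_translate_sub {H : Rn n → E} (hH : Integrable H) :
    Tendsto (fun η => ∫⁻ ξ, ‖H (ξ - η) - H ξ‖ₑ) (𝓝 0) (𝓝 0) := by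
  have hH1 : MemLp H 1 := memLp_one_iff_integrable.2 hH
  let τ : Rn n → C(Rn n, Rn n) := fun η => ⟨fun ξ => ξ - η, by fun_prop⟩
  have hτ : Continuous τ :=
    ContinuousMap.continuous_of_continuous_uncurry _ (by
      change Continuous fun z : Rn n × Rn n => z.2 - z.1
      fun_prop)
  have hmp : ∀ η, MeasurePreserving (τ η) := fun η => measurePreserving_sub_right volume η
  have hc : Continuous fun η => Lp.compMeasurePreserving (τ η) (hmp η) (hH1.toLp H) :=
    continuous_const.compMeasurePreservingLp hτ hmp ENNReal.one_ne_top
  have hc2 : Continuous fun η =>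
      ‖Lp.compMeasurePreserving (τ η) (hmp η) (hH1.toLp H) - hH1.toLp H‖ₑ := by fun_prop
  have heq : ∀ η, ‖Lp.compMeasurePreserving (τ η) (hmp η) (hH1.toLp H) - hH1.toLp H‖ₑ =
      ∫⁻ ξ, ‖H (ξ - η) - H ξ‖ₑ := by
    intro η
    rw [Lp.enorm_def, eLpNorm_one_eq_lintegral_enorm]
    refine lintegral_congr_ae ?_
    filter_upwards [Lp.coeFn_sub (Lp.compMeasurePreserving (τ η) (hmp η) (hH1.toLp H))
      (hH1.toLp H), Lp.coeFn_compMeasurePreserving (hH1.toLp H) (hmp η), hH1.coeFn_toLp,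
      (hmp η).quasiMeasurePreserving.ae hH1.coeFn_toLp] with ξ h1 h2 h3 h4
    rw [h1, Pi.sub_apply, h2, h3, Function.comp_apply, h4]
    rfl
  have h0 : ∫⁻ ξ, ‖H (ξ - 0) - H ξ‖ₑ = 0 := by simp
  simp only [heq] at hc2
  have := hc2.tendsto 0
  rwa [h0] at this

/-- In contrast to `weight_add_le`, the factor tends to `1` as `η → 0`, which makes the weight's
variation under small translations negligible. -/
theorem weight_le_mul_weight_sub {s : ℝ} (hs : 0 ≤ s) (ξ η : Rn n) :
    weight s ξ ≤ ENNReal.ofReal ((1 + ‖η‖) ^ s) * weight s (ξ - η) := by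
  rw [weight, weight, ← ENNReal.ofReal_mul (by positivity)]
  refine ENNReal.ofReal_le_ofReal ?_
  have h1 : ((1 + ‖η‖) ^ s : ℝ) = ((1 + ‖η‖) ^ 2) ^ (s / 2) := by
    rw [← Real.rpow_natCast_mul (by positivity)]
    congr 1
    push_cast
    ring
  rw [h1, ← Real.mul_rpow (by positivity) (by positivity)]
  gcongr
  have h2 : ‖ξ‖ ≤ ‖ξ - η‖ + ‖η‖ := by simpa using norm_add_le (ξ - η) η
  have h3 : ‖ξ‖ ^ 2 ≤ (‖ξ - η‖ + ‖η‖) ^ 2 := by gcongr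
  nlinarith [norm_nonneg η, norm_nonneg (ξ - η), sq_nonneg (‖ξ - η‖ * ‖η‖),
    mul_nonneg (norm_nonneg η) (sq_nonneg (‖ξ - η‖ - 1)), sq_nonneg (‖ξ - η‖)]

variable [NormedSpace ℝ E]

/-- Continuity of translations in a weighted `L¹` space. -/
theorem exists_lintegral_weight_translate_le {s : ℝ} (hs : 0 ≤ s) {V : Rn n → E}
    (hV : AEStronglyMeasurable V) (hVi : ∫⁻ ξ, weight s ξ * ‖V ξ‖ₑ < ∞) {ε : ℝ≥0∞} (hε : 0 < ε) :
    ∃ δ : ℝ, 0 < δ ∧ ∀ η, ‖η‖ < δ → ∫⁻ ξ, weight s ξ * ‖V (ξ - η) - V ξ‖ₑ < ε := by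
  set w : Rn n → ℝ := fun ξ => (1 + ‖ξ‖ ^ 2) ^ (s / 2) with hw
  have hw0 : ∀ ξ, 0 < w ξ := fun ξ => by positivity
  have hwe : ∀ ξ, weight s ξ = ENNReal.ofReal (w ξ) := fun ξ => rfl
  have hwe' : ∀ ξ, ‖w ξ‖ₑ = weight s ξ := fun ξ => Real.enorm_of_nonneg (hw0 ξ).le
  have hwm : AEStronglyMeasurable w volume := by
    have : Measurable w := by fun_prop
    exact this.aestronglyMeasurable
  have hHm : AEStronglyMeasurable (fun ξ => w ξ • V ξ) volume := hwm.smul hV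
  have hH : Integrable fun ξ => w ξ • V ξ := by
    refine ⟨hHm, ?_⟩
    rw [hasFiniteIntegral_iff_enorm]
    simpa only [enorm_smul, hwe'] using hVi
  set A := ∫⁻ ξ, weight s ξ * ‖V ξ‖ₑ with hA
  have hr : ∀ η : Rn n, 1 ≤ (1 + ‖η‖) ^ s := fun η =>
    Real.one_le_rpow (by linarith [norm_nonneg η]) hs
  have hwle : ∀ ξ η : Rn n, w ξ ≤ (1 + ‖η‖) ^ s * w (ξ - η) := by
    intro ξ η
    have := weight_le_mul_weight_sub hs ξ η
    rw [hwe, hwe, ← ENNReal.ofReal_mul (by positivity)] at this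
    exact (ENNReal.ofReal_le_ofReal_iff (mul_nonneg (by positivity) (hw0 _).le)).1 this
  have hwdiff : ∀ ξ η : Rn n, |w ξ - w (ξ - η)| ≤ ((1 + ‖η‖) ^ s - 1) * w (ξ - η) := by
    intro ξ η
    have h1 := hwle ξ η
    have h2 := hwle (ξ - η) (-η)
    rw [sub_neg_eq_add, sub_add_cancel, norm_neg] at h2
    rw [abs_le]
    refine ⟨?_, by linarith⟩
    by_contra hcon
    push Not at hcon
    have h3 := hr η
    have h4 := hw0 (ξ - η)
    have h5 := hw0 ξ
    have h6 : w ξ < w (ξ - η) := by nlinarith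
    nlinarith
  -- `w(ξ)(V(ξ - η) - V(ξ))` is the increment of `wV` plus `(w(ξ) - w(ξ - η)) V(ξ - η)`. The first
  -- is handled by unweighted `L¹` continuity, the second by the relative bound on the weight.
  have hmain : ∀ η, ∫⁻ ξ, weight s ξ * ‖V (ξ - η) - V ξ‖ₑ ≤
      (∫⁻ ξ, ‖w (ξ - η) • V (ξ - η) - w ξ • V ξ‖ₑ) + ENNReal.ofReal ((1 + ‖η‖) ^ s - 1) * A := by
    intro η
    have hVη : AEStronglyMeasurable (fun ξ => V (ξ - η)) volume :=
      hV.comp_measurePreserving (measurePreserving_sub_right volume η)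
    have hHη : AEStronglyMeasurable (fun ξ => w (ξ - η) • V (ξ - η)) volume :=
      hHm.comp_measurePreserving (measurePreserving_sub_right volume η)
    calc ∫⁻ ξ, weight s ξ * ‖V (ξ - η) - V ξ‖ₑ
        ≤ ∫⁻ ξ, (‖w (ξ - η) • V (ξ - η) - w ξ • V ξ‖ₑ +
            ENNReal.ofReal ((1 + ‖η‖) ^ s - 1) * (weight s (ξ - η) * ‖V (ξ - η)‖ₑ)) := by
          refine lintegral_mono fun ξ => ?_
          simp only
          rw [← hwe', ← enorm_smul]
          have h1 : w ξ • (V (ξ - η) - V ξ) = (w (ξ - η) • V (ξ - η) - w ξ • V ξ) +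
              (w ξ - w (ξ - η)) • V (ξ - η) := by
            module
          rw [h1]
          refine (enorm_add_le _ _).trans ?_
          gcongr
          rw [enorm_smul, ← mul_assoc, hwe, ← ENNReal.ofReal_mul (by linarith [hr η])]
          gcongr
          rw [Real.enorm_eq_ofReal_abs]
          exact ENNReal.ofReal_le_ofReal (hwdiff ξ η)
      _ = (∫⁻ ξ, ‖w (ξ - η) • V (ξ - η) - w ξ • V ξ‖ₑ) +
            ∫⁻ ξ, ENNReal.ofReal ((1 + ‖η‖) ^ s - 1) * (weight s (ξ - η) * ‖V (ξ - η)‖ₑ) :=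
          lintegral_add_left' (hHη.sub hHm).enorm _
      _ = _ := by
          rw [lintegral_const_mul' _ _ ENNReal.ofReal_ne_top, hA,
            lintegral_sub_right_eq_self (fun ξ => weight s ξ * ‖V ξ‖ₑ) η]
  have hlim : Tendsto (fun η => (∫⁻ ξ, ‖w (ξ - η) • V (ξ - η) - w ξ • V ξ‖ₑ) +
      ENNReal.ofReal ((1 + ‖η‖) ^ s - 1) * A) (𝓝 0) (𝓝 0) := by
    have h1 := tendsto_lintegral_translate_sub hH
    have h2 : Tendsto (fun η : Rn n => ENNReal.ofReal ((1 + ‖η‖) ^ s - 1) * A) (𝓝 0) (𝓝 0) := by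
      have hc : Continuous fun η : Rn n => ENNReal.ofReal ((1 + ‖η‖) ^ s - 1) := by
        refine ENNReal.continuous_ofReal.comp ((Continuous.rpow_const (by fun_prop)
          fun η => Or.inr hs).sub continuous_const)
      have h3 := ENNReal.Tendsto.mul_const (b := A) (hc.tendsto 0) (Or.inr hVi.ne)
      simpa using h3
    simpa using h1.add h2
  obtain ⟨δ, hδ, hball⟩ := Metric.eventually_nhds_iff.1 (hlim.eventually (gt_mem_nhds hε))
  refine ⟨δ, hδ, fun η hη => (hmain η).trans_lt (hball ?_)⟩
  simpa using hη

end TranslationL1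

/-! ### Young's inequality with weights -/

section Convolution

variable {n : ℕ}

/-- The weighted `L¹` norm is submultiplicative for convolution. -/
theorem lintegral_weight_convolution_le {s : ℝ} (hs : 0 ≤ s) {G a : Rn n → ℝ≥0∞}
    (hG : Measurable G) (ha : Measurable a) :
    ∫⁻ ξ, weight s ξ * ∫⁻ η, G η * a (ξ - η) ≤
      weightConst s * (∫⁻ η, weight s η * G η) * ∫⁻ ξ, weight s ξ * a ξ := by
  have hwm : Measurable (weight s : Rn n → ℝ≥0∞) := measurable_weight s
  calc ∫⁻ ξ, weight s ξ * ∫⁻ η, G η * a (ξ - η)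
      = ∫⁻ ξ, ∫⁻ η, weight s ξ * (G η * a (ξ - η)) := by
        congr 1; ext ξ
        rw [lintegral_const_mul _ (by fun_prop)]
    _ ≤ ∫⁻ ξ, ∫⁻ η, weightConst s * (weight s η * G η) * (weight s (ξ - η) * a (ξ - η)) := by
        refine lintegral_mono fun ξ => lintegral_mono fun η => ?_
        simp only
        calc weight s ξ * (G η * a (ξ - η))
            ≤ (weightConst s * (weight s η * weight s (ξ - η))) * (G η * a (ξ - η)) := by
              gcongr
              exact weight_le_weight_sub hs ξ η
          _ = _ := by ring
    _ = ∫⁻ η, ∫⁻ ξ, weightConst s * (weight s η * G η) * (weight s (ξ - η) * a (ξ - η)) := by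
        rw [lintegral_lintegral_swap]
        exact (by fun_prop : Measurable fun z : Rn n × Rn n => weightConst s *
          (weight s z.2 * G z.2) * (weight s (z.1 - z.2) * a (z.1 - z.2))).aemeasurable
    _ = ∫⁻ η, weightConst s * (weight s η * G η) * ∫⁻ ξ, weight s ξ * a ξ := by
        congr 1; ext η
        rw [lintegral_const_mul _ (by fun_prop),
          lintegral_sub_right_eq_self (fun ξ => weight s ξ * a ξ) η]
    _ = _ := by
        rw [lintegral_mul_const _ (by fun_prop), lintegral_const_mul _ (by fun_prop)]

end Convolution

/-! ### Distributions given by functions -/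

section GivenBy

variable {n : ℕ}

/-- Testing against such functions shows that a function representing a distribution is integrable
on every ball, hence measurable and locally integrable. -/
theorem exists_schwartz_eq_one_on_ball (R : ℝ) :
    ∃ φ : 𝓢(Rn n, ℂ), ∀ x ∈ Metric.ball (0 : Rn n) R, φ x = 1 := by
  let f : ContDiffBump (0 : Rn n) := ⟨|R| + 1, |R| + 2, by positivity, by linarith⟩
  have h1 : HasCompactSupport fun x => (f x : ℂ) :=
    f.hasCompactSupport.comp_left (g := fun r : ℝ => (r : ℂ)) (by simp)
  have h2 : ContDiff ℝ ((⊤ : ℕ∞) : WithTop ℕ∞) fun x => (f x : ℂ) :=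
    Complex.ofRealCLM.contDiff.comp f.contDiff
  refine ⟨h1.toSchwartzMap h2, fun x hx => ?_⟩
  have h3 : f x = 1 := by
    refine f.one_of_mem_closedBall (Metric.ball_subset_closedBall
      (Metric.ball_subset_ball ?_ hx))
    change R ≤ |R| + 1
    linarith [le_abs_self R]
  change (f x : ℂ) = 1
  rw [h3]
  simp

theorem SegalIdeal.IsGivenBy.integrableOn_ball {u : 𝓢'(Rn n, ℂ)} {g : Rn n → ℂ}
    (h : IsGivenBy u g) (R : ℝ) : IntegrableOn g (Metric.ball 0 R) := by
  obtain ⟨φ, hφ⟩ := exists_schwartz_eq_one_on_ball (n := n) R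
  refine (h φ).1.integrableOn.congr_fun (fun x hx => ?_) measurableSet_ball
  simp only [hφ x hx, one_mul]

theorem SegalIdeal.IsGivenBy.aestronglyMeasurable {u : 𝓢'(Rn n, ℂ)} {g : Rn n → ℂ}
    (h : IsGivenBy u g) : AEStronglyMeasurable g := by
  have h1 : ∀ k : ℕ, AEStronglyMeasurable g (volume.restrict (Metric.ball (0 : Rn n) k)) :=
    fun k => (h.integrableOn_ball k).aestronglyMeasurable
  have h2 := (aestronglyMeasurable_iUnion_iff (μ := (volume : Measure (Rn n)))).2 h1
  rwa [Metric.iUnion_ball_nat, Measure.restrict_univ] at h2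

theorem SegalIdeal.IsGivenBy.locallyIntegrable {u : 𝓢'(Rn n, ℂ)} {g : Rn n → ℂ}
    (h : IsGivenBy u g) : LocallyIntegrable g := by
  intro x
  refine ⟨Metric.ball 0 (‖x‖ + 1), Metric.isOpen_ball.mem_nhds (by simp), h.integrableOn_ball _⟩

theorem SegalIdeal.IsGivenBy.congr_ae {u : 𝓢'(Rn n, ℂ)} {g g' : Rn n → ℂ}
    (h : IsGivenBy u g) (hg : g =ᵐ[volume] g') : IsGivenBy u g' := by
  intro φ
  have h1 : (fun x => φ x * g x) =ᵐ[volume] fun x => φ x * g' x := by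
    filter_upwards [hg] with x hx
    rw [hx]
  exact ⟨(h φ).1.congr h1, (h φ).2.trans (integral_congr_ae h1)⟩

theorem SegalIdeal.IsGivenBy.ext {u v : 𝓢'(Rn n, ℂ)} {g : Rn n → ℂ}
    (hu : IsGivenBy u g) (hv : IsGivenBy v g) : u = v := by
  ext φ
  rw [(hu φ).2, (hv φ).2]

theorem SegalIdeal.IsGivenBy.add {u v : 𝓢'(Rn n, ℂ)} {g h : Rn n → ℂ}
    (hu : IsGivenBy u g) (hv : IsGivenBy v h) : IsGivenBy (u + v) (fun x => g x + h x) := by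
  intro φ
  simp only [mul_add]
  refine ⟨(hu φ).1.add (hv φ).1, ?_⟩
  rw [integral_add (hu φ).1 (hv φ).1, ← (hu φ).2, ← (hv φ).2]
  rfl

theorem SegalIdeal.IsGivenBy.smul {u : 𝓢'(Rn n, ℂ)} {g : Rn n → ℂ}
    (hu : IsGivenBy u g) (c : ℂ) : IsGivenBy (c • u) (fun x => c * g x) := by
  intro φ
  simp only [mul_left_comm _ c]
  refine ⟨(hu φ).1.const_mul c, ?_⟩
  rw [integral_const_mul, ← (hu φ).2]
  rfl

theorem SegalIdeal.IsGivenBy.sub {u v : 𝓢'(Rn n, ℂ)} {g h : Rn n → ℂ}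
    (hu : IsGivenBy u g) (hv : IsGivenBy v h) : IsGivenBy (u - v) (fun x => g x - h x) := by
  intro φ
  simp only [mul_sub]
  refine ⟨(hu φ).1.sub (hv φ).1, ?_⟩
  rw [integral_sub (hu φ).1 (hv φ).1, ← (hu φ).2, ← (hv φ).2]
  rfl

theorem isGivenBy_zero : IsGivenBy (0 : 𝓢'(Rn n, ℂ)) (fun _ => 0) := by
  intro φ
  simp

theorem SegalIdeal.IsGivenBy.ae_eq {u : 𝓢'(Rn n, ℂ)} {g g' : Rn n → ℂ}
    (h : IsGivenBy u g) (h' : IsGivenBy u g') : g =ᵐ[volume] g' := by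
  refine ae_eq_of_integral_contDiff_smul_eq h.locallyIntegrable h'.locallyIntegrable ?_
  intro f hf hfc
  have h1 : HasCompactSupport fun x => (f x : ℂ) :=
    hfc.comp_left (g := fun r : ℝ => (r : ℂ)) (by simp)
  have h2 : ContDiff ℝ ((⊤ : ℕ∞) : WithTop ℕ∞) fun x => (f x : ℂ) :=
    Complex.ofRealCLM.contDiff.comp hf
  have h3 := (h (h1.toSchwartzMap h2)).2.symm.trans (h' (h1.toSchwartzMap h2)).2
  simp only [Complex.real_smul]
  exact h3

theorem SegalIdeal.IsGivenBy.eq_of_continuous {u : 𝓢'(Rn n, ℂ)} {g g' : Rn n → ℂ}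
    (h : IsGivenBy u g) (h' : IsGivenBy u g') (hg : Continuous g) (hg' : Continuous g') : g = g' :=
  Continuous.ae_eq_iff_eq volume hg hg' |>.1 (h.ae_eq h')

theorem exists_isGivenBy_of_bounded {f : Rn n → ℂ} (hf : AEStronglyMeasurable f) {C : ℝ}
    (hC : ∀ x, ‖f x‖ ≤ C) : ∃ u : 𝓢'(Rn n, ℂ), IsGivenBy u f := by
  have hm : MemLp f ∞ := memLp_top_of_bound hf C (ae_of_all _ hC)
  refine ⟨Lp.toTemperedDistribution (hm.toLp f), fun φ => ⟨?_, ?_⟩⟩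
  · exact φ.integrable.mul_bdd hf (ae_of_all _ hC)
  · rw [Lp.toTemperedDistribution_apply]
    refine integral_congr_ae ?_
    filter_upwards [hm.coeFn_toLp] with x hx
    rw [hx, smul_eq_mul]

end GivenBy

/-! ### Norm properties of `flNorm` and `modNorm` -/

section FourierNorm

variable {n : ℕ}

theorem flNorm_le (s : ℝ) {u : 𝓢'(Rn n, ℂ)} {g : Rn n → ℂ} (h : IsGivenBy (fourierD u) g) :
    flNorm s u ≤ ∫⁻ ξ, weight s ξ * ‖g ξ‖ₑ := iInf₂_le g h

theorem exists_of_flNorm_lt {s : ℝ} {u : 𝓢'(Rn n, ℂ)} {r : ℝ≥0∞} (h : flNorm s u < r) :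
    ∃ g : Rn n → ℂ, StronglyMeasurable g ∧ IsGivenBy (fourierD u) g ∧
      ∫⁻ ξ, weight s ξ * ‖g ξ‖ₑ < r := by
  simp only [flNorm, iInf_lt_iff] at h
  obtain ⟨g, hg, hlt⟩ := h
  have hm := hg.aestronglyMeasurable
  refine ⟨hm.mk g, hm.stronglyMeasurable_mk, hg.congr_ae hm.ae_eq_mk, ?_⟩
  refine lt_of_le_of_lt (le_of_eq (lintegral_congr_ae ?_)) hlt
  filter_upwards [hm.ae_eq_mk] with ξ hξ
  rw [hξ]

theorem integrable_of_lintegral_weight {s : ℝ} (hs : 0 ≤ s) {g : Rn n → ℂ}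
    (hg : AEStronglyMeasurable g) (h : ∫⁻ ξ, weight s ξ * ‖g ξ‖ₑ < ∞) : Integrable g := by
  refine ⟨hg, ?_⟩
  rw [hasFiniteIntegral_iff_enorm]
  refine lt_of_le_of_lt (lintegral_mono fun ξ => ?_) h
  calc ‖g ξ‖ₑ = 1 * ‖g ξ‖ₑ := (one_mul _).symm
    _ ≤ _ := by gcongr; exact one_le_weight hs ξ

theorem flNorm_zero (s : ℝ) : flNorm s (0 : 𝓢'(Rn n, ℂ)) = 0 := by
  refine le_antisymm ?_ zero_le
  have h : IsGivenBy (fourierD (0 : 𝓢'(Rn n, ℂ))) (fun _ => 0) := isGivenBy_zero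
  refine (flNorm_le s h).trans_eq ?_
  simp

theorem flNorm_add_le (s : ℝ) (u v : 𝓢'(Rn n, ℂ)) : flNorm s (u + v) ≤ flNorm s u + flNorm s v := by
  refine ENNReal.le_of_forall_pos_le_add fun ε hε hlt => ?_
  have hε' : (0 : ℝ≥0∞) < ε / 2 := by simpa using hε.ne'
  obtain ⟨hu, hv⟩ := ENNReal.add_lt_top.1 hlt
  obtain ⟨g, hgm, hg, hgl⟩ := exists_of_flNorm_lt (ENNReal.lt_add_right hu.ne hε'.ne')
  obtain ⟨h, hhm, hh, hhl⟩ := exists_of_flNorm_lt (ENNReal.lt_add_right hv.ne hε'.ne')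
  calc flNorm s (u + v) ≤ ∫⁻ ξ, weight s ξ * ‖g ξ + h ξ‖ₑ := flNorm_le s (hg.add hh)
    _ ≤ ∫⁻ ξ, (weight s ξ * ‖g ξ‖ₑ + weight s ξ * ‖h ξ‖ₑ) := by
        refine lintegral_mono fun ξ => ?_
        rw [← mul_add]
        gcongr
        exact enorm_add_le _ _
    _ = (∫⁻ ξ, weight s ξ * ‖g ξ‖ₑ) + ∫⁻ ξ, weight s ξ * ‖h ξ‖ₑ :=
        lintegral_add_left ((measurable_weight s).mul hgm.measurable.enorm) _
    _ ≤ (flNorm s u + ε / 2) + (flNorm s v + ε / 2) := by gcongr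
    _ = flNorm s u + flNorm s v + ε := by
        rw [add_add_add_comm, ENNReal.add_halves]

theorem flNorm_smul_le (s : ℝ) (c : ℂ) (u : 𝓢'(Rn n, ℂ)) :
    flNorm s (c • u) ≤ ‖c‖ₑ * flNorm s u := by
  rcases eq_or_ne c 0 with rfl | hc
  · have h0 : (0 : ℂ) • u = 0 := zero_smul ℂ u
    rw [h0, flNorm_zero]
    exact zero_le
  have hc' : ‖c‖ₑ ≠ 0 := by simpa using hc
  rw [mul_comm, ← ENNReal.div_le_iff hc' enorm_ne_top]
  refine le_iInf₂ fun g hg => ?_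
  rw [ENNReal.div_le_iff hc' enorm_ne_top]
  refine (flNorm_le s (u := c • u) (hg.smul c)).trans_eq ?_
  rw [← lintegral_mul_const' _ _ enorm_ne_top]
  congr 1; ext ξ
  rw [enorm_mul]
  ring

theorem modNorm_zero (φ : 𝓢(Rn n, ℂ)) (p : ℝ≥0∞) (s : ℝ) : modNorm φ p s 0 = 0 := by
  have : ∀ x ξ, stft φ (0 : 𝓢'(Rn n, ℂ)) x ξ = 0 := fun x ξ => rfl
  simp [modNorm, this]

theorem modNorm_smul_le (φ : 𝓢(Rn n, ℂ)) (p : ℝ≥0∞) (s : ℝ) (c : ℂ) (u : 𝓢'(Rn n, ℂ)) :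
    modNorm φ p s (c • u) ≤ ‖c‖ₑ * modNorm φ p s u := by
  have h : ∀ ξ, (fun x => stft φ (c • u) x ξ) = c • fun x => stft φ u x ξ := fun ξ => rfl
  simp only [modNorm, h, eLpNorm_const_smul]
  rw [← lintegral_const_mul' _ _ enorm_ne_top]
  refine le_of_eq ?_
  congr 1; ext ξ
  ring

theorem modNorm_add_le (φ : 𝓢(Rn n, ℂ)) {p : ℝ≥0∞} (hp1 : 1 ≤ p) (hp' : p ≠ ∞) (s : ℝ)
    (u v : 𝓢'(Rn n, ℂ)) : modNorm φ p s (u + v) ≤ modNorm φ p s u + modNorm φ p s v := by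
  have h : ∀ ξ, (fun x => stft φ (u + v) x ξ) =
    (fun x => stft φ u x ξ) + fun x => stft φ v x ξ := fun ξ => rfl
  have hm := measurable_eLpNorm_right (μ := (volume : Measure (Rn n)))
    (f := fun x ξ => stft φ u x ξ) (measurable_stft φ u)
    (zero_lt_one.trans_le hp1).ne' hp'
  simp only [modNorm, h]
  refine le_trans (lintegral_mono fun ξ => ?_) (lintegral_add_left
    (f := fun ξ => weight s ξ * eLpNorm (fun x => stft φ u x ξ) p volume)
    ((measurable_weight s).mul hm) _).le
  rw [← mul_add]
  gcongr
  exact eLpNorm_add_le (continuous_stft_left φ u ξ).aestronglyMeasurable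
    (continuous_stft_left φ v ξ).aestronglyMeasurable hp1

end FourierNorm

/-! ### Inverse Fourier transforms and products -/

section InverseFourier

variable {n : ℕ}

/-- The inverse Fourier transform of a function. -/
noncomputable def invFourier (g : Rn n → ℂ) (t : Rn n) : ℂ :=
  invConst n * ∫ η, conj (character η t) * g η

theorem continuous_invFourier {g : Rn n → ℂ} (hg : Integrable g) : Continuous (invFourier g) := by
  refine continuous_const.mul ?_
  refine continuous_of_dominated (bound := fun η => ‖g η‖) (fun t => ?_) (fun t => ?_) hg.norm ?_
  · refine AEStronglyMeasurable.mul ?_ hg.aestronglyMeasurable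
    exact (by fun_prop : Continuous fun η : Rn n => conj (character η t)).aestronglyMeasurable
  · exact ae_of_all _ fun η => by simp [norm_character]
  · exact ae_of_all _ fun η => by fun_prop

theorem norm_invFourier_le (g : Rn n → ℂ) (t : Rn n) :
    ‖invFourier g t‖ ≤ invConst n * ∫ η, ‖g η‖ := by
  rw [invFourier, norm_mul, Complex.norm_real, Real.norm_of_nonneg (invConst_pos n).le]
  refine mul_le_mul_of_nonneg_left ?_ (invConst_pos n).le
  refine (norm_integral_le_integral_norm _).trans_eq ?_
  congr 1; ext η
  simp [norm_character]

/-- Fubini's theorem for products with an inverse Fourier transform. -/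
theorem integral_mul_invFourier {h g : Rn n → ℂ} (hh : Integrable h) (hg : Integrable g) :
    ∫ t, h t * invFourier g t = invConst n * ∫ η, g η * ∫ t, conj (character η t) * h t := by
  have hint := integrable_prod_bounded hh hg
    (k := fun p => conj (character p.2 p.1)) (by fun_prop) (fun p => by simp [norm_character])
  calc ∫ t, h t * invFourier g t
      = invConst n * ∫ t, ∫ η, conj (character η t) * (h t * g η) := by
        rw [← integral_const_mul]
        congr 1; ext t
        rw [invFourier, mul_left_comm, ← integral_const_mul]
        congr 2; ext η
        ring
    _ = invConst n * ∫ η, ∫ t, conj (character η t) * (h t * g η) := by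
        rw [integral_integral_swap hint]
    _ = _ := by
        congr 2; ext η
        rw [← integral_const_mul]
        congr 1; ext t
        ring

/-- Write the test function as the Fourier transform of its inverse transform and apply Fubini.
Hence elements of `FL¹_s` are bounded continuous functions. -/
theorem isGivenBy_invFourier {u : 𝓢'(Rn n, ℂ)} {g : Rn n → ℂ} (h : IsGivenBy (fourierD u) g)
    (hg : Integrable g) : IsGivenBy u (invFourier g) := by
  intro ψ
  refine ⟨ψ.integrable.mul_bdd (continuous_invFourier hg).aestronglyMeasurable
    (ae_of_all _ (norm_invFourier_le g)), ?_⟩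
  rw [integral_mul_invFourier ψ.integrable hg]
  have h1 := (h (fourierSInv ψ)).2
  rw [fourierD_apply, fourierS_fourierSInv] at h1
  rw [h1, ← integral_const_mul]
  congr 1; ext η
  rw [fourierSInv_apply]
  ring

end InverseFourier

section Products

variable {n : ℕ}

/-- The short-time Fourier transform of a product. -/
theorem stft_mul (φ : 𝓢(Rn n, ℂ)) {v w : 𝓢'(Rn n, ℂ)} {g f : Rn n → ℂ} (hg : Integrable g)
    (hv : IsGivenBy v f) (hw : IsGivenBy w (fun x => invFourier g x * f x)) (x ξ : Rn n) :
    stft φ w x ξ = invConst n * ∫ η, g η * stft φ v x (ξ - η) := by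
  have h1 : ∀ t, shiftedWindow φ x ξ t * (invFourier g t * f t) =
      (shiftedWindow φ x ξ t * f t) * invFourier g t := fun t => by ring
  rw [stft, (hw _).2]
  simp only [h1]
  rw [integral_mul_invFourier (hv _).1 hg]
  congr 2; ext η
  rw [stft, (hv _).2]
  congr 2; ext t
  rw [shiftedWindow_apply', shiftedWindow_apply', character_sub_left]
  ring

/-- The Fourier transform of a product is a convolution. -/
theorem isGivenBy_fourierD_mul {v w : 𝓢'(Rn n, ℂ)} {g h f : Rn n → ℂ} (hg : Integrable g)
    (hh : Integrable h) (hv : IsGivenBy v f) (hvh : IsGivenBy (fourierD v) h)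
    (hw : IsGivenBy w (fun x => invFourier g x * f x)) :
    IsGivenBy (fourierD w) (fun ξ => invConst n * ∫ η, g η * h (ξ - η)) := by
  have hprod : Integrable (fun z : Rn n × Rn n => g z.2 * h (z.1 - z.2)) (volume.prod volume) :=
    hg.convolution_integrand (ContinuousLinearMap.mul ℂ ℂ) hh
  intro ψ
  have hψ : Integrable (fun z : Rn n × Rn n => ψ z.1 * (g z.2 * h (z.1 - z.2)))
      (volume.prod volume) := by
    refine hprod.bdd_mul (c := SchwartzMap.seminorm ℂ 0 0 ψ) ?_
      (ae_of_all _ fun z => SchwartzMap.norm_le_seminorm ℂ ψ z.1)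
    exact (ψ.continuous.comp continuous_fst).aestronglyMeasurable
  have heq : ∀ ξ, ψ ξ * (invConst n * ∫ η, g η * h (ξ - η)) =
      invConst n * ∫ η, ψ ξ * (g η * h (ξ - η)) := by
    intro ξ
    rw [integral_const_mul]
    ring
  simp only [heq]
  refine ⟨hψ.integral_prod_left.const_mul _, ?_⟩
  rw [integral_const_mul, integral_integral_swap hψ, fourierD_apply, (hw _).2]
  have h1 : ∀ t, fourierS n ψ t * (invFourier g t * f t) =
      (fourierS n ψ t * f t) * invFourier g t := fun t => by ring
  simp only [h1]
  rw [integral_mul_invFourier (hv _).1 hg]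
  congr 2; ext η
  -- Evaluating `v̂` on the translate of `ψ` by `-η` brings out the factor `conj (character η t)`
  -- that Fubini left behind.
  have h2 := (hvh (compSubConstCLM ℝ (-η) ψ)).2
  rw [fourierD_apply, (hv _).2] at h2
  have h3 : ∀ t, fourierS n (compSubConstCLM ℝ (-η) ψ) t * f t =
      conj (character η t) * (fourierS n ψ t * f t) := by
    intro t
    rw [fourierS_compSubConst, character_neg_left]
    ring
  simp only [h3] at h2
  rw [h2, ← integral_const_mul, ← integral_sub_right_eq_self _ η]
  congr 1; ext ξ
  simp only [compSubConstCLM_apply, sub_neg_eq_add, sub_add_cancel]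
  ring

theorem enorm_invConst_mul_integral_le (f : Rn n → ℂ) :
    ‖(invConst n : ℂ) * ∫ η, f η‖ₑ ≤ ∫⁻ η, ENNReal.ofReal (invConst n) * ‖f η‖ₑ := by
  rw [enorm_mul, lintegral_const_mul' _ _ ENNReal.ofReal_ne_top]
  have h1 : ‖(invConst n : ℂ)‖ₑ = ENNReal.ofReal (invConst n) := by
    rw [← ofReal_norm, Complex.norm_real, Real.norm_of_nonneg (invConst_pos n).le]
  rw [h1]
  gcongr
  exact enorm_integral_le_lintegral_enorm _

theorem measurable_uncurry_const_sub {V : Rn n → Rn n → ℂ}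
    (hV : Measurable fun z : Rn n × Rn n => V z.1 z.2) (ξ : Rn n) :
    Measurable (Function.uncurry fun x η => V x (ξ - η)) :=
  hV.comp (measurable_fst.prodMk (measurable_const.sub measurable_snd))

/-- By `stft_mul` and Minkowski, the `Lᵖ` norm in `x` of the product's transform is at most a
convolution of `|g|` with that of `v`; the weighted Young inequality finishes. -/
theorem modNorm_mul_le (φ : 𝓢(Rn n, ℂ)) {p : ℝ≥0∞} (hp1 : 1 ≤ p) (hp' : p ≠ ∞) {s : ℝ}
    (hs : 0 ≤ s) {v w : 𝓢'(Rn n, ℂ)} {g f : Rn n → ℂ} (hgm : StronglyMeasurable g)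
    (hg : Integrable g) (hv : IsGivenBy v f) (hw : IsGivenBy w (fun x => invFourier g x * f x)) :
    modNorm φ p s w ≤ weightConst s * ENNReal.ofReal (invConst n) *
      (∫⁻ η, weight s η * ‖g η‖ₑ) * modNorm φ p s v := by
  have hVm := measurable_stft φ v
  have hg' : Measurable fun η => ‖g η‖ₑ := hgm.measurable.enorm
  have ham : Measurable fun ξ => eLpNorm (fun x => stft φ v x ξ) p volume :=
    measurable_eLpNorm_right (f := fun x ξ => stft φ v x ξ) hVm
      (zero_lt_one.trans_le hp1).ne' hp'
  have hpt : ∀ ξ, eLpNorm (fun x => stft φ w x ξ) p volume ≤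
      ∫⁻ η, ENNReal.ofReal (invConst n) * ‖g η‖ₑ *
        eLpNorm (fun x => stft φ v x (ξ - η)) p volume := by
    intro ξ
    have hm : Measurable (Function.uncurry fun x η => stft φ v x (ξ - η)) :=
      measurable_uncurry_const_sub hVm ξ
    have hle : ∀ x, ‖stft φ w x ξ‖ₑ ≤
        ∫⁻ η, ENNReal.ofReal (invConst n) * ‖g η‖ₑ * ‖stft φ v x (ξ - η)‖ₑ := by
      intro x
      rw [stft_mul φ hg hv hw]
      refine (enorm_invConst_mul_integral_le _).trans_eq (lintegral_congr fun η => ?_)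
      rw [enorm_mul, mul_assoc]
    exact eLpNorm_le_lintegral_mul_eLpNorm hm (hg'.const_mul _) hp1 hp' hle
  calc modNorm φ p s w
      ≤ ∫⁻ ξ, weight s ξ * ∫⁻ η, ENNReal.ofReal (invConst n) * ‖g η‖ₑ *
          eLpNorm (fun x => stft φ v x (ξ - η)) p volume :=
        lintegral_mono fun ξ => mul_le_mul_right (hpt ξ) _
    _ ≤ _ := lintegral_weight_convolution_le hs (hg'.const_mul _) ham
    _ = _ := by
        simp only [mul_left_comm _ (ENNReal.ofReal (invConst n))]
        rw [lintegral_const_mul' _ _ ENNReal.ofReal_ne_top, modNorm]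
        ring

theorem flNorm_mul_le {s : ℝ} (hs : 0 ≤ s) {v w : 𝓢'(Rn n, ℂ)} {g h f : Rn n → ℂ}
    (hgm : StronglyMeasurable g) (hhm : StronglyMeasurable h) (hg : Integrable g)
    (hh : Integrable h) (hv : IsGivenBy v f) (hvh : IsGivenBy (fourierD v) h)
    (hw : IsGivenBy w (fun x => invFourier g x * f x)) :
    flNorm s w ≤ weightConst s * ENNReal.ofReal (invConst n) *
      (∫⁻ η, weight s η * ‖g η‖ₑ) * ∫⁻ η, weight s η * ‖h η‖ₑ := by
  have hg' : Measurable fun η => ‖g η‖ₑ := hgm.measurable.enorm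
  have hh' : Measurable fun η => ‖h η‖ₑ := hhm.measurable.enorm
  calc flNorm s w
      ≤ ∫⁻ ξ, weight s ξ * ‖(invConst n : ℂ) * ∫ η, g η * h (ξ - η)‖ₑ :=
        flNorm_le s (isGivenBy_fourierD_mul hg hh hv hvh hw)
    _ ≤ ∫⁻ ξ, weight s ξ * ∫⁻ η, ENNReal.ofReal (invConst n) * ‖g η‖ₑ * ‖h (ξ - η)‖ₑ := by
        refine lintegral_mono fun ξ => ?_
        simp only
        gcongr
        refine (enorm_invConst_mul_integral_le _).trans_eq ?_
        congr 1; ext η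
        rw [enorm_mul, mul_assoc]
    _ ≤ _ := lintegral_weight_convolution_le hs (by fun_prop) hh'
    _ = _ := by
        simp only [mul_left_comm _ (ENNReal.ofReal (invConst n))]
        rw [lintegral_const_mul' _ _ ENNReal.ofReal_ne_top]
        ring

end Products

/-! ### Schwartz functions lie in the modulation space -/

section SchwartzInModulation

variable {n : ℕ}

/-- The second description places `e` in the modulation space, the first makes multiplication by `e`
a convolution with `ρ`. -/
theorem exists_isGivenBy_fourierSInv (ρ : 𝓢(Rn n, ℂ)) :
    ∃ e : 𝓢'(Rn n, ℂ), IsGivenBy (fourierD e) ρ ∧ IsGivenBy e (fourierSInv ρ) := by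
  obtain ⟨e, he⟩ := exists_isGivenBy_of_bounded
    (fourierSInv ρ).continuous.aestronglyMeasurable
    (SchwartzMap.norm_le_seminorm ℂ (fourierSInv ρ))
  refine ⟨e, fun ψ => ?_, he⟩
  refine ⟨ψ.integrable.mul_bdd ρ.continuous.aestronglyMeasurable
    (ae_of_all _ (SchwartzMap.norm_le_seminorm ℂ ρ)), ?_⟩
  rw [fourierD_apply, (he _).2]
  have h1 : ∀ t, fourierSInv ρ t = invFourier ρ t := fun t => by
    rw [fourierSInv_apply, invFourier]
    congr 2; ext η
    rw [character_comm]
  simp only [h1]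
  rw [integral_mul_invFourier (fourierS n ψ).integrable ρ.integrable, ← integral_const_mul]
  congr 1; ext η
  rw [mul_left_comm, ← fourierSInv_apply, fourierSInv_fourierS, mul_comm]

theorem exists_pow_mul_fourierS_le (N : ℕ) : ∃ (s : Finset (ℕ × ℕ)) (C : ℝ), 0 ≤ C ∧
    ∀ (h : 𝓢(Rn n, ℂ)) (ξ : Rn n), (1 + ‖ξ‖) ^ N * ‖fourierS n h ξ‖ ≤
      C * ∑ m ∈ s, SchwartzMap.seminorm ℂ m.1 m.2 h := by
  have hc : Continuous ((normSeminorm ℂ _).comp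
      ((weightedJet (E := Rn n) N 0).comp (fourierS n)).toLinearMap) := by
    change Continuous fun f => ‖weightedJet (E := Rn n) N 0 (fourierS n f)‖
    exact ((weightedJet (E := Rn n) N 0).continuous.comp (fourierS n).continuous).norm
  obtain ⟨s, C, -, hb⟩ := Seminorm.bound_of_continuous (schwartz_withSeminorms ℂ (Rn n) ℂ) _ hc
  refine ⟨s, C, C.2, fun h ξ => ?_⟩
  have h0 : ‖fourierS n h ξ‖ = ‖jet 0 (fourierS n h) ξ‖ := by
    rw [norm_jet, norm_iteratedFDeriv_zero]
  rw [h0]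
  refine (pow_norm_mul_jet_le N 0 _ ξ).trans ((hb h).trans ?_)
  rw [smul_apply, NNReal.smul_def, smul_eq_mul]
  refine mul_le_mul_of_nonneg_left ?_ C.2
  refine Seminorm.finset_sup_apply_le (Finset.sum_nonneg fun i _ => apply_nonneg _ _) fun m hm => ?_
  exact Finset.single_le_sum (f := fun m : ℕ × ℕ => SchwartzMap.seminorm ℂ m.1 m.2 h)
    (fun i _ => apply_nonneg _ _) hm

/-- For fixed `x` the transform is the Fourier transform of `E` times a translated window. Its decay
in `ξ` costs finitely many seminorms of that product, and these decay in `x`. -/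
theorem exists_stft_decay (φ E : 𝓢(Rn n, ℂ)) {e : 𝓢'(Rn n, ℂ)} (he : IsGivenBy e E) (N : ℕ) :
    ∃ C : ℝ, 0 ≤ C ∧ ∀ x ξ,
      (1 + ‖x‖) ^ (n + 1) * ((1 + ‖ξ‖) ^ N * ‖stft φ e x ξ‖) ≤ C := by
  obtain ⟨s, C, hC0, hC⟩ := exists_pow_mul_fourierS_le (n := n) N
  have h1 : ∀ x ξ, stft φ e x ξ =
      fourierS n (mulS E (compSubConstCLM ℝ x (shiftedWindow φ 0 0))) ξ := by
    intro x ξ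
    rw [stft, (he _).2, fourierS_apply']
    congr 1; ext t
    rw [mulS_apply, compSubConstCLM_apply, shiftedWindow_apply', shiftedWindow_apply',
      character_zero_left, sub_zero]
    ring
  choose D hD0 hD using fun m : ℕ × ℕ =>
    seminorm_mulS_compSubConst_le E (shiftedWindow φ 0 0) (n + 1) m.1 m.2
  refine ⟨C * ∑ m ∈ s, D m, mul_nonneg hC0 (Finset.sum_nonneg fun m _ => hD0 m), fun x ξ => ?_⟩
  rw [h1]
  calc _ ≤ (1 + ‖x‖) ^ (n + 1) * (C * ∑ m ∈ s, SchwartzMap.seminorm ℂ m.1 m.2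
        (mulS E (compSubConstCLM ℝ x (shiftedWindow φ 0 0)))) := by
        refine mul_le_mul_of_nonneg_left (hC _ ξ) (by positivity)
    _ = C * ∑ m ∈ s, (1 + ‖x‖) ^ (n + 1) * SchwartzMap.seminorm ℂ m.1 m.2
        (mulS E (compSubConstCLM ℝ x (shiftedWindow φ 0 0))) := by
        rw [mul_left_comm, Finset.mul_sum]
    _ ≤ _ := by
        gcongr with m hm
        exact hD m x

/-- Schwartz functions belong to the modulation space. -/
theorem modNorm_lt_top_of_schwartz (φ E : 𝓢(Rn n, ℂ)) {e : 𝓢'(Rn n, ℂ)} (he : IsGivenBy e E)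
    {p : ℝ≥0∞} (hp1 : 1 ≤ p) (hp' : p ≠ ∞) (s : ℝ) : modNorm φ p s e < ∞ := by
  obtain ⟨M, hM⟩ := exists_nat_ge s
  obtain ⟨C, hC0, hC⟩ := exists_stft_decay φ E he (M + (n + 1))
  set k : Rn n → ℝ := fun x => ((1 + ‖x‖) ^ (n + 1))⁻¹ with hk
  have hk0 : ∀ x, 0 ≤ k x := fun x => by positivity
  have hk1 : ∀ x, k x ≤ 1 := fun x => inv_le_one_of_one_le₀
    (one_le_pow₀ (by linarith [norm_nonneg x]))
  have hp0 : p ≠ 0 := (zero_lt_one.trans_le hp1).ne'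
  have hpr : 1 ≤ p.toReal := by simpa using ENNReal.toReal_mono hp' hp1
  have hkint : Integrable k := integrable_one_add_norm_pow_inv
  have hkp : eLpNorm k p volume < ∞ := by
    rw [eLpNorm_lt_top_iff_lintegral_rpow_enorm_lt_top hp0 hp']
    refine lt_of_le_of_lt (lintegral_mono fun x => ?_) hkint.2
    have h1 : ‖k x‖ₑ ≤ 1 := by
      rw [Real.enorm_of_nonneg (hk0 x)]
      exact ENNReal.ofReal_le_one.2 (hk1 x)
    calc ‖k x‖ₑ ^ p.toReal ≤ ‖k x‖ₑ ^ (1 : ℝ) := ENNReal.rpow_le_rpow_of_exponent_ge h1 hpr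
      _ = _ := ENNReal.rpow_one _
  have hbound : ∀ ξ, weight s ξ * eLpNorm (fun x => stft φ e x ξ) p volume ≤
      ENNReal.ofReal (k ξ) * (ENNReal.ofReal C * eLpNorm k p volume) := by
    intro ξ
    have h2 : eLpNorm (fun x => stft φ e x ξ) p volume ≤
        ENNReal.ofReal (C / (1 + ‖ξ‖) ^ (M + (n + 1))) * eLpNorm k p volume := by
      refine eLpNorm_le_mul_eLpNorm_of_ae_le_mul (ae_of_all _ fun x => ?_) p
      have h3 := hC x ξ
      rw [Real.norm_of_nonneg (hk0 x), hk]
      simp only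
      rw [← div_eq_mul_inv, div_div, le_div_iff₀' (by positivity)]
      calc _ = _ := by ring
        _ ≤ C := h3
    calc weight s ξ * eLpNorm (fun x => stft φ e x ξ) p volume
        ≤ ENNReal.ofReal ((1 + ‖ξ‖) ^ M) *
          (ENNReal.ofReal (C / (1 + ‖ξ‖) ^ (M + (n + 1))) * eLpNorm k p volume) := by
          gcongr
          exact weight_le_pow hM ξ
      _ = _ := by
          rw [← mul_assoc, ← mul_assoc, ← ENNReal.ofReal_mul (by positivity),
            ← ENNReal.ofReal_mul (hk0 ξ)]
          congr 2
          rw [hk, pow_add]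
          field_simp
  calc modNorm φ p s e ≤ ∫⁻ ξ, ENNReal.ofReal (k ξ) * (ENNReal.ofReal C * eLpNorm k p volume) :=
        lintegral_mono hbound
    _ = (∫⁻ ξ, ENNReal.ofReal (k ξ)) * (ENNReal.ofReal C * eLpNorm k p volume) :=
        lintegral_mul_const' _ _ (ENNReal.mul_ne_top ENNReal.ofReal_ne_top hkp.ne)
    _ < ∞ := ENNReal.mul_lt_top hkint.lintegral_lt_top
        (ENNReal.mul_lt_top ENNReal.ofReal_lt_top hkp)

end SchwartzInModulation

/-! ### Approximate units -/

section ApproximateUnits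

variable {n : ℕ}

/-- A nonnegative bump with integral `(2π)ⁿ`, so that `(2π)⁻ⁿ ρ` is a probability density supported
near `0`. -/
theorem exists_schwartz_approx_unit {δ : ℝ} (hδ : 0 < δ) :
    ∃ ρ : 𝓢(Rn n, ℂ), HasCompactSupport ρ ∧ (∀ η, ρ η ≠ 0 → ‖η‖ < δ) ∧
      (invConst n : ℂ) * ∫ η, ρ η = 1 ∧ ∫⁻ η, ENNReal.ofReal (invConst n) * ‖ρ η‖ₑ = 1 := by
  let f : ContDiffBump (0 : Rn n) := ⟨δ / 2, δ, by positivity, by linarith⟩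
  have hc := invConst_pos n
  set r : Rn n → ℝ := fun η => (invConst n)⁻¹ * f.normed volume η with hr
  have hr0 : ∀ η, 0 ≤ r η := fun η => mul_nonneg (by positivity) (f.nonneg_normed _)
  have hrc : HasCompactSupport r := f.hasCompactSupport_normed.mul_left
  have h1 : HasCompactSupport fun x => (r x : ℂ) :=
    hrc.comp_left (g := fun r : ℝ => (r : ℂ)) (by simp)
  have h2 : ContDiff ℝ ((⊤ : ℕ∞) : WithTop ℕ∞) fun x => (r x : ℂ) :=
    Complex.ofRealCLM.contDiff.comp (contDiff_const.mul f.contDiff_normed)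
  have hint : invConst n * ∫ η, r η = 1 := by
    rw [hr, integral_const_mul, f.integral_normed, mul_one, mul_inv_cancel₀ hc.ne']
  have hri : Integrable r := f.integrable_normed.const_mul _
  refine ⟨h1.toSchwartzMap h2, h1, fun η hη => ?_, ?_, ?_⟩
  · have h3 : η ∈ Function.support (f.normed volume) := by
      intro h0
      apply hη
      change ((r η : ℝ) : ℂ) = 0
      rw [hr]
      simp [h0]
    rw [f.support_normed_eq] at h3
    simpa using h3
  · change (invConst n : ℂ) * ∫ η, ((r η : ℝ) : ℂ) = 1
    rw [integral_complex_ofReal]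
    exact_mod_cast hint
  · have h4 : ∀ η, ‖(h1.toSchwartzMap h2) η‖ₑ = ENNReal.ofReal (r η) := by
      intro η
      change ‖((r η : ℝ) : ℂ)‖ₑ = _
      rw [← ofReal_norm, Complex.norm_real, Real.norm_of_nonneg (hr0 η)]
    simp only [h4]
    rw [lintegral_const_mul' _ _ ENNReal.ofReal_ne_top,
      ← ofReal_integral_eq_lintegral_ofReal hri (ae_of_all _ hr0), ← ENNReal.ofReal_mul hc.le,
      hint, ENNReal.ofReal_one]

/-- Tonelli: an average of quantities that are at most `ε` on the support of `k` is at most `ε`. It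
serves both norms. -/
theorem lintegral_weight_mul_average_le {s : ℝ} {k : Rn n → ℝ≥0∞} (hk : Measurable k)
    {D : Rn n → Rn n → ℝ≥0∞} (hD : Measurable fun z : Rn n × Rn n => D z.1 z.2) {ε : ℝ≥0∞}
    (h : ∀ η, k η ≠ 0 → ∫⁻ ξ, weight s ξ * D ξ η ≤ ε) (hk1 : ∫⁻ η, k η = 1) :
    ∫⁻ ξ, weight s ξ * ∫⁻ η, k η * D ξ η ≤ ε := by
  have hwm : Measurable (weight s : Rn n → ℝ≥0∞) := measurable_weight s
  have hD1 : ∀ ξ, Measurable fun η => D ξ η := fun ξ => hD.comp measurable_prodMk_left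
  have hD2 : ∀ η, Measurable fun ξ => D ξ η := fun η => hD.comp measurable_prodMk_right
  calc ∫⁻ ξ, weight s ξ * ∫⁻ η, k η * D ξ η
      = ∫⁻ ξ, ∫⁻ η, weight s ξ * (k η * D ξ η) :=
        lintegral_congr fun ξ => (lintegral_const_mul _ (hk.mul (hD1 ξ))).symm
    _ = ∫⁻ η, ∫⁻ ξ, weight s ξ * (k η * D ξ η) :=
        lintegral_lintegral_swap ((hwm.comp measurable_fst).mul
          ((hk.comp measurable_snd).mul hD)).aemeasurable
    _ = ∫⁻ η, k η * ∫⁻ ξ, weight s ξ * D ξ η := by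
        refine lintegral_congr fun η => ?_
        rw [← lintegral_const_mul (k η) (f := fun ξ => weight s ξ * D ξ η) (hwm.mul (hD2 η))]
        exact lintegral_congr fun ξ => mul_left_comm _ _ _
    _ ≤ ∫⁻ η, k η * ε := by
        refine lintegral_mono fun η => ?_
        rcases eq_or_ne (k η) 0 with h0 | h0
        · simp [h0]
        · exact mul_le_mul_right (h η h0) _
    _ = ε := by rw [lintegral_mul_const _ hk, hk1, one_mul]

theorem average_sub_eq {ρ : Rn n → ℂ} (hρ : Integrable ρ) (hρ1 : (invConst n : ℂ) * ∫ η, ρ η = 1)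
    {a : Rn n → ℂ} {ξ : Rn n} (ha : Integrable fun η => ρ η * a (ξ - η)) :
    (invConst n : ℂ) * ∫ η, ρ η * (a (ξ - η) - a ξ) =
      (invConst n * ∫ η, ρ η * a (ξ - η)) - a ξ := by
  simp only [mul_sub]
  rw [integral_sub ha (hρ.mul_const _), mul_sub, integral_mul_const, ← mul_assoc, hρ1, one_mul]

/-- The Fourier transform of `w - u` is an average of the increments `g(ξ - η) - g(ξ)` over small
`η`. -/
theorem exists_flNorm_mul_sub_lt {s : ℝ} (hs : 0 ≤ s) {u : 𝓢'(Rn n, ℂ)} {f : Rn n → ℂ}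
    (huf : IsGivenBy u f) (hu : flNorm s u < ∞) {ε : ℝ≥0∞} (hε : 0 < ε) :
    ∃ ρ : 𝓢(Rn n, ℂ), ∀ w : 𝓢'(Rn n, ℂ), IsGivenBy w (fun x => invFourier ρ x * f x) →
      flNorm s (w - u) < ε := by
  obtain ⟨ε', hε', hεε⟩ := exists_between hε
  obtain ⟨g, hgm, hg, hgi⟩ := exists_of_flNorm_lt hu
  have hgint := integrable_of_lintegral_weight hs hgm.aestronglyMeasurable hgi
  obtain ⟨δ, hδ, hδ'⟩ :=
    exists_lintegral_weight_translate_le hs hgm.aestronglyMeasurable hgi hε'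
  obtain ⟨ρ, hρc, hρδ, hρ1, hρ2⟩ := exists_schwartz_approx_unit (n := n) hδ
  refine ⟨ρ, fun w hw => lt_of_le_of_lt ?_ hεε⟩
  have h1 : IsGivenBy (fourierD (w - u)) (fun ξ => invConst n * ∫ η, ρ η * (g (ξ - η) - g ξ)) := by
    have h2 := (isGivenBy_fourierD_mul ρ.integrable hgint huf hg hw).sub hg
    have h3 : fourierD (w - u) = fourierD w - fourierD u := rfl
    rw [h3]
    convert h2 using 2 with ξ
    refine average_sub_eq ρ.integrable hρ1 ?_
    exact (hgint.comp_sub_left ξ).bdd_mul ρ.continuous.aestronglyMeasurable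
      (ae_of_all _ (SchwartzMap.norm_le_seminorm ℂ ρ))
  have hρm : Measurable fun η => ENNReal.ofReal (invConst n) * ‖ρ η‖ₑ :=
    (ρ.continuous.measurable.enorm).const_mul _
  have hgm' := hgm.measurable
  calc flNorm s (w - u)
      ≤ ∫⁻ ξ, weight s ξ * ‖(invConst n : ℂ) * ∫ η, ρ η * (g (ξ - η) - g ξ)‖ₑ := flNorm_le s h1
    _ ≤ ∫⁻ ξ, weight s ξ * ∫⁻ η, ENNReal.ofReal (invConst n) * ‖ρ η‖ₑ * ‖g (ξ - η) - g ξ‖ₑ := by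
        refine lintegral_mono fun ξ => mul_le_mul_right ?_ _
        refine (enorm_invConst_mul_integral_le _).trans_eq (lintegral_congr fun η => ?_)
        rw [enorm_mul, mul_assoc]
    _ ≤ ε' := by
        refine lintegral_weight_mul_average_le hρm
          (D := fun ξ η => ‖g (ξ - η) - g ξ‖ₑ) (by fun_prop) (fun η hη => (hδ' η ?_).le) hρ2
        exact hρδ η fun h0 => hη (by simp [h0])

/-- Translation continuity applied to `ξ ↦ V_φ u(·, ξ)` with values in `Lᵖ`. Finiteness of the norm
places almost every slice in `Lᵖ`; the others are replaced by zero. -/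
theorem exists_translate_eLpNorm_lt (φ : 𝓢(Rn n, ℂ)) {p : ℝ≥0∞} (hp1 : 1 ≤ p) (hp' : p ≠ ∞)
    {s : ℝ} (hs : 0 ≤ s) {u : 𝓢'(Rn n, ℂ)} (hu : modNorm φ p s u < ∞) {ε : ℝ≥0∞} (hε : 0 < ε) :
    ∃ δ : ℝ, 0 < δ ∧ ∀ η, ‖η‖ < δ → ∫⁻ ξ, weight s ξ *
      eLpNorm (fun x => stft φ u x (ξ - η) - stft φ u x ξ) p volume < ε := by
  have : Fact (1 ≤ p) := ⟨hp1⟩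
  have : Fact (p ≠ ∞) := ⟨hp'⟩
  have hm := measurable_stft φ u
  have hcont := continuous_stft_left φ u
  have hmeas : ∀ ξ, AEStronglyMeasurable (fun x => stft φ u x ξ) volume := fun ξ =>
    (hcont ξ).aestronglyMeasurable
  rw [modNorm] at hu
  generalize stft φ u = V at *
  have hWm : StronglyMeasurable fun ξ => toLpOrZero p volume (fun x => V x ξ) :=
    stronglyMeasurable_toLpOrZero hm
  have hWi : ∫⁻ ξ, weight s ξ * ‖toLpOrZero p volume (fun x => V x ξ)‖ₑ < ∞ := by
    refine lt_of_le_of_lt (lintegral_mono fun ξ => mul_le_mul_right ?_ _) hu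
    by_cases h : MemLp (fun x => V x ξ) p volume
    · rw [toLpOrZero_of_memLp h, Lp.enorm_toLp]
    · rw [toLpOrZero, dif_neg h, enorm_zero]
      exact zero_le
  have hmem : ∀ᵐ ξ, MemLp (fun x => V x ξ) p volume := by
    have h1 := ae_lt_top ((measurable_weight s).mul (measurable_eLpNorm_right (f := V)
      (μ := (volume : Measure (Rn n))) hm (zero_lt_one.trans_le hp1).ne' hp')) hu.ne
    filter_upwards [h1] with ξ hξ
    exact ⟨hmeas ξ, ENNReal.lt_top_of_mul_ne_top_right hξ.ne (weight_ne_zero s ξ)⟩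
  obtain ⟨δ, hδ, h⟩ := exists_lintegral_weight_translate_le hs hWm.aestronglyMeasurable hWi hε
  refine ⟨δ, hδ, fun η hη => lt_of_le_of_lt (le_of_eq (lintegral_congr_ae ?_)) (h η hη)⟩
  filter_upwards [hmem, (measurePreserving_sub_right volume η).quasiMeasurePreserving.ae hmem]
    with ξ h1 h2
  rw [toLpOrZero_of_memLp h1, toLpOrZero_of_memLp h2, ← MemLp.toLp_sub, Lp.enorm_toLp]
  rfl

theorem measurable_eLpNorm_translate_sub {V : Rn n → Rn n → ℂ}
    (hV : Measurable fun z : Rn n × Rn n => V z.1 z.2) {p : ℝ≥0∞} (hp1 : 1 ≤ p) (hp' : p ≠ ∞) :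
    Measurable fun z : Rn n × Rn n =>
      eLpNorm (fun x => V x (z.1 - z.2) - V x z.1) p volume := by
  refine measurable_eLpNorm_right (f := fun x (z : Rn n × Rn n) => V x (z.1 - z.2) - V x z.1) ?_
    (zero_lt_one.trans_le hp1).ne' hp'
  refine Measurable.sub ?_ ?_
  · exact hV.comp (f := fun z : Rn n × Rn n × Rn n => (z.1, z.2.1 - z.2.2)) (by fun_prop)
  · exact hV.comp (f := fun z : Rn n × Rn n × Rn n => (z.1, z.2.1)) (by fun_prop)

theorem exists_modNorm_mul_sub_lt (φ : 𝓢(Rn n, ℂ)) {p : ℝ≥0∞} (hp1 : 1 ≤ p) (hp' : p ≠ ∞)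
    {s : ℝ} (hs : 0 ≤ s) {u : 𝓢'(Rn n, ℂ)} {f : Rn n → ℂ}
    (huf : IsGivenBy u f) (hu : modNorm φ p s u < ∞) {ε : ℝ≥0∞} (hε : 0 < ε) :
    ∃ ρ : 𝓢(Rn n, ℂ), ∀ w : 𝓢'(Rn n, ℂ), IsGivenBy w (fun x => invFourier ρ x * f x) →
      modNorm φ p s (w - u) < ε := by
  obtain ⟨ε', hε', hεε⟩ := exists_between hε
  obtain ⟨δ, hδ, hδ'⟩ := exists_translate_eLpNorm_lt φ hp1 hp' hs hu hε'
  obtain ⟨ρ, hρc, hρδ, hρ1, hρ2⟩ := exists_schwartz_approx_unit (n := n) hδ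
  refine ⟨ρ, fun w hw => lt_of_le_of_lt ?_ hεε⟩
  have h1 : ∀ x ξ, stft φ (w - u) x ξ =
      invConst n * ∫ η, ρ η * (stft φ u x (ξ - η) - stft φ u x ξ) := by
    intro x ξ
    have hcont : Continuous fun η => stft φ u x (ξ - η) :=
      (continuous_stft_right φ u x).comp (continuous_const.sub continuous_id)
    rw [average_sub_eq (a := fun ξ => stft φ u x ξ) ρ.integrable hρ1
      ((ρ.continuous.mul hcont).integrable_of_hasCompactSupport hρc.mul_right),
      ← stft_mul φ ρ.integrable huf hw]
    rfl
  have hρm : Measurable fun η => ENNReal.ofReal (invConst n) * ‖ρ η‖ₑ :=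
    (ρ.continuous.measurable.enorm).const_mul _
  have hDm := measurable_eLpNorm_translate_sub (measurable_stft φ u) hp1 hp'
  have hpt : ∀ ξ, eLpNorm (fun x => stft φ (w - u) x ξ) p volume ≤
      ∫⁻ η, ENNReal.ofReal (invConst n) * ‖ρ η‖ₑ *
        eLpNorm (fun x => stft φ u x (ξ - η) - stft φ u x ξ) p volume := by
    intro ξ
    have hm : Measurable (Function.uncurry fun x η => stft φ u x (ξ - η) - stft φ u x ξ) :=
      (measurable_uncurry_const_sub (measurable_stft φ u) ξ).sub
        ((continuous_stft_left φ u ξ).measurable.comp measurable_fst)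
    refine eLpNorm_le_lintegral_mul_eLpNorm hm hρm hp1 hp' fun x => ?_
    rw [h1]
    refine (enorm_invConst_mul_integral_le _).trans_eq (lintegral_congr fun η => ?_)
    rw [enorm_mul, mul_assoc]
  calc modNorm φ p s (w - u)
      ≤ ∫⁻ ξ, weight s ξ * ∫⁻ η, ENNReal.ofReal (invConst n) * ‖ρ η‖ₑ *
          eLpNorm (fun x => stft φ u x (ξ - η) - stft φ u x ξ) p volume :=
        lintegral_mono fun ξ => mul_le_mul_right (hpt ξ) _
    _ ≤ ε' := lintegral_weight_mul_average_le hρm hDm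
        (fun η hη => (hδ' η (hρδ η fun h0 => hη (by simp [h0]))).le) hρ2

end ApproximateUnits

/-! ### Algebra of pointwise products -/

section PointwiseProduct

variable {n : ℕ} {u u' v v' w w' : 𝓢'(Rn n, ℂ)}

theorem SegalIdeal.IsPointwiseProduct.comm (h : IsPointwiseProduct u v w) :
    IsPointwiseProduct v u w := by
  obtain ⟨f, g, hf, hg, hu, hv, hw⟩ := h
  refine ⟨g, f, hg, hf, hv, hu, ?_⟩
  simpa only [mul_comm] using hw

theorem SegalIdeal.IsPointwiseProduct.sub_right (h : IsPointwiseProduct u v w)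
    (h' : IsPointwiseProduct u v' w') : IsPointwiseProduct u (v - v') (w - w') := by
  obtain ⟨f, g, hf, hg, hu, hv, hw⟩ := h
  obtain ⟨f', g', hf', hg', hu', hv', hw'⟩ := h'
  obtain rfl := hu.eq_of_continuous hu' hf hf'
  refine ⟨f, fun x => g x - g' x, hf, hg.sub hg', hu, hv.sub hv', ?_⟩
  simpa only [mul_sub] using hw.sub hw'

theorem SegalIdeal.IsPointwiseProduct.sub_left (h : IsPointwiseProduct u v w)
    (h' : IsPointwiseProduct u' v w') : IsPointwiseProduct (u - u') v (w - w') :=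
  (h.comm.sub_right h'.comm).comm

theorem SegalIdeal.IsPointwiseProduct.unique (h : IsPointwiseProduct u v w)
    (h' : IsPointwiseProduct u v w') : w = w' := by
  obtain ⟨f, g, hf, hg, hu, hv, hw⟩ := h
  obtain ⟨f', g', hf', hg', hu', hv', hw'⟩ := h'
  obtain rfl := hu.eq_of_continuous hu' hf hf'
  obtain rfl := hv.eq_of_continuous hv' hg hg'
  exact hw.ext hw'

end PointwiseProduct

/-! ### The abstract ideal theorem -/

section SegalPair

variable {n : ℕ}

/-- `N` is the norm of an algebra of functions, and `M` is the norm of an ideal of it that is a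
Banach module over the algebra and contains approximate units for both norms. -/
structure SegalPair (N M : 𝓢'(Rn n, ℂ) → ℝ≥0∞) : Prop where
  norm_zero : N 0 = 0
  norm_add : ∀ u v, N (u + v) ≤ N u + N v
  norm_smul : ∀ (c : ℂ) u, N (c • u) ≤ ‖c‖ₑ * N u
  mod_zero : M 0 = 0
  mod_add : ∀ u v, M (u + v) ≤ M u + M v
  mod_smul : ∀ (c : ℂ) u, M (c • u) ≤ ‖c‖ₑ * M u
  exists_norm_le : ∃ C, C ≠ ∞ ∧ ∀ u, N u ≤ C * M u
  exists_mul : ∀ u v, N u < ∞ → N v < ∞ → ∃ w, IsPointwiseProduct u v w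
  exists_norm_mul_le : ∃ C, C ≠ ∞ ∧ ∀ u v w, IsPointwiseProduct u v w → N u < ∞ → N v < ∞ →
    N w ≤ C * N u * N v
  exists_mod_mul_le : ∃ C, C ≠ ∞ ∧ ∀ u v w, IsPointwiseProduct u v w → N u < ∞ → M v < ∞ →
    M w ≤ C * N u * M v
  norm_approx : ∀ u, N u < ∞ → ∀ ε, 0 < ε →
    ∃ e w, M e < ∞ ∧ IsPointwiseProduct e u w ∧ N (w - u) < ε
  mod_approx : ∀ u, M u < ∞ → ∀ ε, 0 < ε →
    ∃ e w, M e < ∞ ∧ IsPointwiseProduct e u w ∧ M (w - u) < ε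

/-- The choice `δ = ε / C` also covers `C = 0`, where it is `∞`. -/
theorem exists_pos_mul_lt_of_ne_top {C ε : ℝ≥0∞} (hC : C ≠ ∞) (hε : 0 < ε) :
    ∃ δ, 0 < δ ∧ ∀ x, x < δ → C * x < ε := by
  refine ⟨ε / C, ENNReal.div_pos hε.ne' hC, fun x hx => ?_⟩
  exact ENNReal.mul_lt_of_lt_div' hx

namespace SegalPair

variable {N M : 𝓢'(Rn n, ℂ) → ℝ≥0∞}

theorem norm_neg (h : SegalPair N M) (u : 𝓢'(Rn n, ℂ)) : N (-u) ≤ N u := by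
  have h1 := h.norm_smul (-1) u
  have h2 : (-1 : ℂ) • u = -u := neg_one_smul ℂ u
  rwa [h2, enorm_neg, enorm_one, one_mul] at h1

theorem norm_sub_comm_le (h : SegalPair N M) (u v : 𝓢'(Rn n, ℂ)) : N (u - v) ≤ N (v - u) := by
  simpa using h.norm_neg (v - u)

theorem norm_sub_le (h : SegalPair N M) (u v : 𝓢'(Rn n, ℂ)) : N (u - v) ≤ N u + N v := by
  rw [sub_eq_add_neg]
  exact (h.norm_add _ _).trans (add_le_add_right (h.norm_neg v) _)

theorem norm_sub_triangle (h : SegalPair N M) (u v w : 𝓢'(Rn n, ℂ)) :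
    N (u - w) ≤ N (u - v) + N (v - w) := by
  simpa using h.norm_add (u - v) (v - w)

theorem mod_neg (h : SegalPair N M) (u : 𝓢'(Rn n, ℂ)) : M (-u) ≤ M u := by
  have h1 := h.mod_smul (-1) u
  have h2 : (-1 : ℂ) • u = -u := neg_one_smul ℂ u
  rwa [h2, enorm_neg, enorm_one, one_mul] at h1

theorem mod_sub_comm_le (h : SegalPair N M) (u v : 𝓢'(Rn n, ℂ)) : M (u - v) ≤ M (v - u) := by
  simpa using h.mod_neg (v - u)

theorem mod_sub_triangle (h : SegalPair N M) (u v w : 𝓢'(Rn n, ℂ)) :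
    M (u - w) ≤ M (u - v) + M (v - w) := by
  simpa using h.mod_add (u - v) (v - w)

theorem norm_lt_top (h : SegalPair N M) {u : 𝓢'(Rn n, ℂ)} (hu : M u < ∞) : N u < ∞ := by
  obtain ⟨C, hC, hle⟩ := h.exists_norm_le
  exact (hle u).trans_lt (ENNReal.mul_lt_top hC.lt_top hu)

theorem norm_mul_lt_top (h : SegalPair N M) {u v w : 𝓢'(Rn n, ℂ)} (hw : IsPointwiseProduct u v w)
    (hu : N u < ∞) (hv : N v < ∞) : N w < ∞ := by
  obtain ⟨C, hC, hle⟩ := h.exists_norm_mul_le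
  exact (hle u v w hw hu hv).trans_lt (ENNReal.mul_lt_top (ENNReal.mul_lt_top hC.lt_top hu) hv)

theorem mod_mul_lt_top (h : SegalPair N M) {u v w : 𝓢'(Rn n, ℂ)} (hw : IsPointwiseProduct u v w)
    (hu : N u < ∞) (hv : M v < ∞) : M w < ∞ := by
  obtain ⟨C, hC, hle⟩ := h.exists_mod_mul_le
  exact (hle u v w hw hu hv).trans_lt (ENNReal.mul_lt_top (ENNReal.mul_lt_top hC.lt_top hu) hv)

/-- A closed ideal of the algebra intersects the smaller space in a closed ideal. -/
theorem isClosedIdeal_inter (h : SegalPair N M) {I : Set 𝓢'(Rn n, ℂ)} (hI : IsClosedIdeal N I) :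
    IsClosedIdeal M (I ∩ space M) where
  subset_space := Set.inter_subset_right
  zero_mem := ⟨hI.zero_mem, by simp [space, h.mod_zero]⟩
  add_mem u hu v hv := ⟨hI.add_mem u hu.1 v hv.1,
    (h.mod_add u v).trans_lt (ENNReal.add_lt_top.2 ⟨hu.2, hv.2⟩)⟩
  smul_mem c u hu := ⟨hI.smul_mem c u hu.1,
    (h.mod_smul c u).trans_lt (ENNReal.mul_lt_top enorm_lt_top hu.2)⟩
  mul_mem u hu v hv := by
    obtain ⟨w, hw, hp⟩ := hI.mul_mem u (h.norm_lt_top hu) v hv.1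
    exact ⟨w, ⟨hw, h.mod_mul_lt_top hp (h.norm_lt_top hu) hv.2⟩, hp⟩
  closure_subset u hu := by
    refine ⟨hI.closure_subset ⟨h.norm_lt_top hu.1, fun ε hε => ?_⟩, hu.1⟩
    obtain ⟨C, hC, hle⟩ := h.exists_norm_le
    obtain ⟨δ, hδ, hCδ⟩ := exists_pos_mul_lt_of_ne_top hC hε
    obtain ⟨v, hv, hlt⟩ := hu.2 δ hδ
    exact ⟨v, hv.1, (hle _).trans_lt (hCδ _ hlt)⟩

/-- The closure of a closed ideal of the smaller space is a closed ideal of the algebra. -/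
theorem isClosedIdeal_normClosure (h : SegalPair N M) {J : Set 𝓢'(Rn n, ℂ)}
    (hJ : IsClosedIdeal M J) : IsClosedIdeal N (normClosure N J) where
  subset_space u hu := hu.1
  zero_mem := ⟨by simp [space, h.norm_zero], fun ε hε => ⟨0, hJ.zero_mem, by
    rwa [sub_zero, h.norm_zero]⟩⟩
  add_mem u hu v hv := by
    refine ⟨(h.norm_add u v).trans_lt (ENNReal.add_lt_top.2 ⟨hu.1, hv.1⟩), fun ε hε => ?_⟩
    obtain ⟨u', hu', hul⟩ := hu.2 (ε / 2) (ENNReal.half_pos hε.ne')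
    obtain ⟨v', hv', hvl⟩ := hv.2 (ε / 2) (ENNReal.half_pos hε.ne')
    refine ⟨u' + v', hJ.add_mem u' hu' v' hv', ?_⟩
    rw [add_sub_add_comm]
    exact (h.norm_add _ _).trans_lt ((ENNReal.add_lt_add hul hvl).trans_eq (ENNReal.add_halves ε))
  smul_mem c u hu := by
    refine ⟨(h.norm_smul c u).trans_lt (ENNReal.mul_lt_top enorm_lt_top hu.1), fun ε hε => ?_⟩
    obtain ⟨δ, hδ, hcδ⟩ := exists_pos_mul_lt_of_ne_top (enorm_ne_top (x := c)) hε
    obtain ⟨u', hu', hul⟩ := hu.2 δ hδ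
    refine ⟨c • u', hJ.smul_mem c u' hu', ?_⟩
    have h1 : c • u - c • u' = c • (u - u') := (smul_sub c u u').symm
    rw [h1]
    exact (h.norm_smul _ _).trans_lt (hcδ _ hul)
  mul_mem f hf g hg := by
    obtain ⟨w, hw⟩ := h.exists_mul f g hf hg.1
    refine ⟨w, ⟨h.norm_mul_lt_top hw hf hg.1, fun ε hε => ?_⟩, hw⟩
    obtain ⟨C, hC, hle⟩ := h.exists_norm_mul_le
    have hε2 := ENNReal.half_pos hε.ne'
    obtain ⟨δ, hδ, hδ'⟩ := exists_pos_mul_lt_of_ne_top (ENNReal.mul_ne_top hC (LT.lt.ne hf)) hε2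
    -- The chain is `fg ≈ fk ≈ f₁k` with `f₁ = ef` in the smaller space, which puts `f₁k` in `J`.
    -- The element `k` is fixed first, since the accuracy `δ'` of `f₁` depends on `N k`.
    obtain ⟨k, hk, hkl⟩ := hg.2 δ hδ
    have hkN : N k < ∞ := h.norm_lt_top (hJ.subset_space hk)
    obtain ⟨w₁, hw₁⟩ := h.exists_mul f k hf hkN
    obtain ⟨δ', hδ₁, hδ₁'⟩ := exists_pos_mul_lt_of_ne_top (ENNReal.mul_ne_top hC hkN.ne) hε2
    obtain ⟨e, f₁, he, hf₁, hfl⟩ := h.norm_approx f hf δ' hδ₁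
    have hf₁M : M f₁ < ∞ := h.mod_mul_lt_top hf₁.comm hf he
    obtain ⟨w₂, hw₂, hw₂p⟩ := hJ.mul_mem f₁ hf₁M k hk
    refine ⟨w₂, hw₂, (h.norm_sub_triangle w w₁ w₂).trans_lt
      ((ENNReal.add_lt_add ?_ ?_).trans_eq (ENNReal.add_halves ε))⟩
    · have hgk : N (g - k) < ∞ :=
        (h.norm_sub_le g k).trans_lt (ENNReal.add_lt_top.2 ⟨hg.1, hkN⟩)
      exact (hle _ _ _ (hw.sub_right hw₁) hf hgk).trans_lt (hδ' _ hkl)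
    · have hff : N (f - f₁) < ∞ :=
        (h.norm_sub_le f f₁).trans_lt (ENNReal.add_lt_top.2 ⟨hf, h.norm_lt_top hf₁M⟩)
      refine (hle _ _ _ (hw₁.sub_left hw₂p) hff hkN).trans_lt ?_
      rw [mul_right_comm]
      exact hδ₁' _ ((h.norm_sub_comm_le f f₁).trans_lt hfl)
  closure_subset u hu := by
    refine ⟨hu.1, fun ε hε => ?_⟩
    obtain ⟨v, hv, hvl⟩ := hu.2 (ε / 2) (ENNReal.half_pos hε.ne')
    obtain ⟨w, hw, hwl⟩ := hv.2 (ε / 2) (ENNReal.half_pos hε.ne')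
    exact ⟨w, hw, (h.norm_sub_triangle u v w).trans_lt
      ((ENNReal.add_lt_add hvl hwl).trans_eq (ENNReal.add_halves ε))⟩

/-- For `u ∈ I` the product `eu` lies in `I` because `I` is an ideal, and in the smaller space
because of the module bound applied to `e`; it approximates `u`. -/
theorem normClosure_inter (h : SegalPair N M) {I : Set 𝓢'(Rn n, ℂ)} (hI : IsClosedIdeal N I) :
    normClosure N (I ∩ space M) = I := by
  refine Set.Subset.antisymm (fun u hu => hI.closure_subset ⟨hu.1, fun ε hε => ?_⟩)
    fun u hu => ⟨hI.subset_space hu, fun ε hε => ?_⟩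
  · obtain ⟨v, hv, hlt⟩ := hu.2 ε hε
    exact ⟨v, hv.1, hlt⟩
  · have huN : N u < ∞ := hI.subset_space hu
    obtain ⟨e, w, he, hw, hlt⟩ := h.norm_approx u huN ε hε
    obtain ⟨w', hw', hp⟩ := hI.mul_mem e (h.norm_lt_top he) u hu
    obtain rfl := hw.unique hp
    exact ⟨w, ⟨hw', h.mod_mul_lt_top hw.comm huN he⟩, (h.norm_sub_comm_le u w).trans_lt hlt⟩

/-- Multiplication by a fixed `e` turns `N`-approximation into `M`-approximation: `M(e(u - k)) ≤ C
N(u - k) M(e)`. -/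
theorem inter_normClosure (h : SegalPair N M) {J : Set 𝓢'(Rn n, ℂ)} (hJ : IsClosedIdeal M J) :
    normClosure N J ∩ space M = J := by
  refine Set.Subset.antisymm (fun u hu => hJ.closure_subset ⟨hu.2, fun ε hε => ?_⟩) fun u hu =>
    ⟨⟨h.norm_lt_top (hJ.subset_space hu), fun ε hε => ⟨u, hu, by rwa [sub_self, h.norm_zero]⟩⟩,
      hJ.subset_space hu⟩
  have hε2 := ENNReal.half_pos hε.ne'
  obtain ⟨C, hC, hle⟩ := h.exists_mod_mul_le
  obtain ⟨e, w, he, hw, hlt⟩ := h.mod_approx u hu.2 (ε / 2) hε2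
  -- The unit `e` is already fixed, so `δ` may depend on `M e`; hence no bounded approximate unit is
  -- needed.
  obtain ⟨δ, hδ, hδ'⟩ := exists_pos_mul_lt_of_ne_top (ENNReal.mul_ne_top hC he.ne) hε2
  obtain ⟨k, hk, hkl⟩ := hu.1.2 δ hδ
  obtain ⟨w₁, hw₁, hp⟩ := hJ.mul_mem e he k hk
  refine ⟨w₁, hw₁, (h.mod_sub_triangle u w w₁).trans_lt
    ((ENNReal.add_lt_add ((h.mod_sub_comm_le u w).trans_lt hlt) ?_).trans_eq
      (ENNReal.add_halves ε))⟩
  have huk : N (u - k) < ∞ := (h.norm_sub_le u k).trans_lt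
    (ENNReal.add_lt_top.2 ⟨hu.1.1, h.norm_lt_top (hJ.subset_space hk)⟩)
  refine (hle _ _ _ (hw.sub_right hp).comm huk he).trans_lt ?_
  rw [mul_right_comm]
  exact hδ' _ hkl

end SegalPair

end SegalPair

/-! ### Verification of the Segal pair and conclusion -/

section Main

variable {n : ℕ}

/-- The infimum defining `flNorm` is attained because the density is unique almost everywhere, and
the density is integrable since the weight is at least `1`. -/
theorem exists_fourier_density {s : ℝ} (hs : 0 ≤ s) {u : 𝓢'(Rn n, ℂ)} (hu : flNorm s u < ∞) :
    ∃ g : Rn n → ℂ, StronglyMeasurable g ∧ Integrable g ∧ IsGivenBy (fourierD u) g ∧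
      IsGivenBy u (invFourier g) ∧ ∫⁻ ξ, weight s ξ * ‖g ξ‖ₑ = flNorm s u := by
  obtain ⟨g, hgm, hg, hgi⟩ := exists_of_flNorm_lt hu
  have hint := integrable_of_lintegral_weight hs hgm.aestronglyMeasurable hgi
  refine ⟨g, hgm, hint, hg, isGivenBy_invFourier hg hint, le_antisymm (le_iInf₂ fun g' hg' => ?_)
    (flNorm_le s hg)⟩
  refine le_of_eq (lintegral_congr_ae ?_)
  filter_upwards [hg.ae_eq hg'] with ξ hξ
  rw [hξ]

theorem SegalIdeal.IsPointwiseProduct.isGivenBy_invFourier_mul {u v w : 𝓢'(Rn n, ℂ)}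
    {g f : Rn n → ℂ} (h : IsPointwiseProduct u v w) (hg : Integrable g)
    (hu : IsGivenBy u (invFourier g)) (hv : IsGivenBy v f) (hf : Continuous f) :
    IsGivenBy w (fun x => invFourier g x * f x) := by
  obtain ⟨f', g', hf', hg', hu', hv', hw'⟩ := h
  rwa [hu.eq_of_continuous hu' (continuous_invFourier hg) hf',
    hv.eq_of_continuous hv' hf hg']

theorem exists_isPointwiseProduct {u v : 𝓢'(Rn n, ℂ)} {g h : Rn n → ℂ} (hg : Integrable g)
    (hh : Integrable h) (hu : IsGivenBy u (invFourier g)) (hv : IsGivenBy v (invFourier h)) :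
    ∃ w, IsPointwiseProduct u v w ∧
      IsGivenBy w (fun x => invFourier g x * invFourier h x) := by
  have hgc := continuous_invFourier hg
  have hhc := continuous_invFourier hh
  obtain ⟨w, hw⟩ := exists_isGivenBy_of_bounded (hgc.mul hhc).aestronglyMeasurable
    (C := (invConst n * ∫ η, ‖g η‖) * (invConst n * ∫ η, ‖h η‖)) fun x => by
      rw [Pi.mul_apply, norm_mul]
      exact mul_le_mul (norm_invFourier_le g x) (norm_invFourier_le h x) (norm_nonneg _)
        (mul_nonneg (invConst_pos n).le (integral_nonneg fun _ => norm_nonneg _))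
  exact ⟨w, ⟨_, _, hgc, hhc, hu, hv, hw⟩, hw⟩

theorem segalPair (φ : 𝓢(Rn n, ℂ)) (hφ : φ ≠ 0) {p : ℝ≥0∞} (hp1 : 1 ≤ p) (hp2 : p ≤ 2) {s : ℝ}
    (hs : 0 ≤ s) : SegalPair (flNorm (n := n) s) (modNorm φ p s) := by
  have hp' : p ≠ ∞ := ne_top_of_le_ne_top ENNReal.ofNat_ne_top hp2
  have hC := exists_flNorm_le_modNorm hp1 hp2 hs hφ
  have hlt : ∀ u, modNorm φ p s u < ∞ → flNorm s u < ∞ := fun u hu => by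
    obtain ⟨C, hC, hle⟩ := hC
    exact (hle u).trans_lt (ENNReal.mul_lt_top hC.lt_top hu)
  have hunit : ∀ ρ : 𝓢(Rn n, ℂ), ∃ e, modNorm φ p s e < ∞ ∧ IsGivenBy e (invFourier ρ) := by
    intro ρ
    obtain ⟨e, he, he'⟩ := exists_isGivenBy_fourierSInv ρ
    exact ⟨e, modNorm_lt_top_of_schwartz φ _ he' hp1 hp' s,
      isGivenBy_invFourier he ρ.integrable⟩
  have hW : weightConst s * ENNReal.ofReal (invConst n) ≠ ∞ :=
    ENNReal.mul_ne_top (weightConst_ne_top s) ENNReal.ofReal_ne_top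
  refine
    { norm_zero := flNorm_zero s
      norm_add := flNorm_add_le s
      norm_smul := flNorm_smul_le s
      mod_zero := modNorm_zero φ p s
      mod_add := modNorm_add_le φ hp1 hp' s
      mod_smul := modNorm_smul_le φ p s
      exists_norm_le := hC
      exists_mul := fun u v hu hv => ?_
      exists_norm_mul_le := ⟨_, hW, fun u v w hw hu hv => ?_⟩
      exists_mod_mul_le := ⟨_, hW, fun u v w hw hu hv => ?_⟩
      norm_approx := fun u hu ε hε => ?_
      mod_approx := fun u hu ε hε => ?_ }
  · obtain ⟨g, -, hg, -, hug, -⟩ := exists_fourier_density hs hu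
    obtain ⟨h, -, hh, -, hvh, -⟩ := exists_fourier_density hs hv
    obtain ⟨w, hw, -⟩ := exists_isPointwiseProduct hg hh hug hvh
    exact ⟨w, hw⟩
  · obtain ⟨g, hgm, hg, -, hug, hgn⟩ := exists_fourier_density hs hu
    obtain ⟨h, hhm, hh, hvh, hvh', hhn⟩ := exists_fourier_density hs hv
    rw [← hgn, ← hhn]
    exact flNorm_mul_le hs hgm hhm hg hh hvh' hvh
      (hw.isGivenBy_invFourier_mul hg hug hvh' (continuous_invFourier hh))
  · obtain ⟨g, hgm, hg, -, hug, hgn⟩ := exists_fourier_density hs hu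
    obtain ⟨h, -, hh, -, hvh, -⟩ := exists_fourier_density hs (hlt v hv)
    rw [← hgn]
    exact modNorm_mul_le φ hp1 hp' hs hgm hg hvh
      (hw.isGivenBy_invFourier_mul hg hug hvh (continuous_invFourier hh))
  · obtain ⟨h, -, hh, -, huh, -⟩ := exists_fourier_density hs hu
    obtain ⟨ρ, hρ⟩ := exists_flNorm_mul_sub_lt hs huh hu hε
    obtain ⟨e, he, he'⟩ := hunit ρ
    obtain ⟨w, hw, hw'⟩ := exists_isPointwiseProduct ρ.integrable hh he' huh
    exact ⟨e, w, he, hw, hρ w hw'⟩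
  · obtain ⟨h, -, hh, -, huh, -⟩ := exists_fourier_density hs (hlt u hu)
    obtain ⟨ρ, hρ⟩ := exists_modNorm_mul_sub_lt φ hp1 hp' hs huh hu hε
    obtain ⟨e, he, he'⟩ := hunit ρ
    obtain ⟨w, hw, hw'⟩ := exists_isPointwiseProduct ρ.integrable hh he' huh
    exact ⟨e, w, he, hw, hρ w hw'⟩

end Main

theorem mainTheorem4 (n : ℕ) (p : ℝ≥0∞) (hp1 : 1 ≤ p) (hp2 : p ≤ 2) (s : ℝ) (hs : 0 ≤ s)
    (φ : 𝓢(Rn n, ℂ)) (hφ : φ ≠ 0) :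
    Set.BijOn (fun I : Set 𝓢'(Rn n, ℂ) => I ∩ space (modNorm φ p s))
      {I | IsClosedIdeal (flNorm s) I} {I | IsClosedIdeal (modNorm φ p s) I} ∧
    Set.MapsTo (normClosure (flNorm s))
      {I | IsClosedIdeal (modNorm φ p s) I} {I | IsClosedIdeal (flNorm s) I} ∧
    Set.InvOn (normClosure (flNorm s))
      (fun I : Set 𝓢'(Rn n, ℂ) => I ∩ space (modNorm φ p s))
      {I | IsClosedIdeal (flNorm s) I} {I | IsClosedIdeal (modNorm φ p s) I} := by
  have h := segalPair φ hφ hp1 hp2 hs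
  have hmaps : Set.MapsTo (normClosure (flNorm s))
      {I | IsClosedIdeal (modNorm φ p s) I} {I | IsClosedIdeal (flNorm s) I} :=
    fun J hJ => h.isClosedIdeal_normClosure hJ
  have hinv : Set.InvOn (normClosure (flNorm s))
      (fun I : Set 𝓢'(Rn n, ℂ) => I ∩ space (modNorm φ p s))
      {I | IsClosedIdeal (flNorm s) I} {I | IsClosedIdeal (modNorm φ p s) I} :=
    ⟨fun I hI => h.normClosure_inter hI, fun J hJ => h.inter_normClosure hJ⟩
  exact ⟨hinv.bijOn (fun I hI => h.isClosedIdeal_inter hI) hmaps, hmaps, hinv⟩
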